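/- All spaces are over $\mathbb K\in\{\mathbb R,\mathbb C\}$. A Banach function space on a measure space is an ideal $E$ of $L^0$ with a complete lattice norm. For a Banach space $X$ let $E(X)=\{f\in L^0(X): \|f\|_X\in E\}$ (classes of strongly measurable functions) with norm $\big\|\,\|f\|_X\big\|_E$, let $E\tilde\otimes X$ be the closure of $E\otimes X$ in $E(X)$, and let $E^\times=\{g\in L^0: ge\in L^1\ \forall e\in E\}$, $E^\times(X)=\{g\in L^0(X):\|g\|_X\in E^\times\}$. A Banach dual pair $\langle X,Y\rangle$ is a pair of Banach spaces with a bounded bilinear form $X\times Y\to\mathbb K$ inducing injections $X\to Y^*$ and $Y\to X^*$; a Köthe dual pair $\langle F,G\rangle$ is a pair of Banach function spaces on the same measure space with $F\cdot G\subset L^1$ that is a Banach dual pair under $\langle f,g\rangle=\int fg$. Vector-valued function spaces are paired by $\int\langle f(\cdot),g(\cdot)\rangle$, and $\sigma(V,W)$ is the weak topology on $V$ generated by the pairing with $W$. An operator is regular if it is a linear combination of positive operators; for regular $T$, $\|T\|_r=\inf\{\|R\| : R\ge 0,\ |Te|\le R|e|\ \forall e\}$. Let $(A,\mu)$ be a semi-finite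 measure space, let $\langle F,G\rangle$ be a Köthe dual pair of Banach function spaces on a measure space $(B,\nu)$, and let $T\in\mathcal L(L^\infty(A),G)$ be $\sigma(L^\infty(A),L^1(A))$-to-$\sigma(G,F)$ continuous, with adjoint $S\in\mathcal L(F,L^1(A))$. Suppose that the image of $g\mapsto\langle\,\cdot\,,g\rangle$, $G\to F^*$, is a band in $F^*$. Then the following are equivalent: (a) $T$ is regular. (b) $S$ is regular. (c) $T\otimes I_{\ell^\infty}$ extends to a bounded linear operator $L^\infty(A)\tilde\otimes\ell^\infty\to G\tilde\otimes\ell^\infty$. (d) $S\otimes I_{\ell^1}$ extends to a bounded linear operator $F\tilde\otimes\ell^1\to L^1(A;\ell^1)$. (e) For every Banach dual pair $\langle X,Y\rangle$, $T\otimes I_Y$ extends to an operator $T_Y\in\mathcal L(L^\infty(A;Y),G(Y))$ that is $\sigma(L^\infty(A;Y),L^1(A;X))$-to-$\sigma(G(Y),F\tilde\otimes X)$ continuous. (f) For every Banach dual pair $\langle X,Y\rangle$, $S\otimes I_X$ extends to an operator $S_X\in\mathcal L(F\tilde\otimes X,L^1(A;X))$ that is $\sigma(F\tilde\otimes X,F^\times(Y))$-to-$\sigma(L^1(A;X),L^\infty(A;Y))$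 continuous. These assertions hold if $G$ has a strong order unit. When they hold, for every Banach dual pair $\langle X,Y\rangle$ the operators $S_X$ and $T_Y$ are adjoints of each other with respect to the dualities $\langle F\tilde\otimes X,G(Y)\rangle$ and $\langle L^1(A;X),L^\infty(A;Y)\rangle$, and $\|S_X\|\le\|S\|_r$, $\|T_Y\|\le\|T\|_r$. -/

import Mathlib

open MeasureTheory Filter Topology
open scoped ENNReal

universe v w

noncomputable section

/-- A measure space is semi-finite if every measurable set of positive measure contains a
measurable subset of positive finite measure. -/
def IsSemifiniteMeasure {α : Type*} [MeasurableSpace α] (μ : Measure α) : Prop :=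
  ∀ s, MeasurableSet s → 0 < μ s → ∃ t ⊆ s, MeasurableSet t ∧ 0 < μ t ∧ μ t < ∞

/-- A Banach function space on `(α, μ)`: an ideal of `L⁰(α)` with a complete lattice norm. -/
structure BanachFunctionSpace (𝕜 : Type*) [RCLike 𝕜] {α : Type*} [MeasurableSpace α]
    (μ : Measure α) where
  carrier : Submodule 𝕜 (α →ₘ[μ] 𝕜)
  solid : ∀ f g : α →ₘ[μ] 𝕜, g ∈ carrier → (∀ᵐ a ∂μ, ‖f a‖ ≤ ‖g a‖) → f ∈ carrier
  nrm : carrier → ℝ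
  nrm_add_le : ∀ f g, nrm (f + g) ≤ nrm f + nrm g
  nrm_smul : ∀ (c : 𝕜) (f), nrm (c • f) = ‖c‖ * nrm f
  eq_zero_of_nrm : ∀ f, nrm f = 0 → f = 0
  nrm_mono : ∀ f g : carrier,
    (∀ᵐ a ∂μ, ‖(f : α →ₘ[μ] 𝕜) a‖ ≤ ‖(g : α →ₘ[μ] 𝕜) a‖) → nrm f ≤ nrm g
  complete : ∀ u : ℕ → carrier,
    (∀ ε > 0, ∃ N, ∀ m ≥ N, ∀ n ≥ N, nrm (u m - u n) < ε) →
    ∃ f, Tendsto (fun n => nrm (u n - f)) atTop (𝓝 0)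

/-- The pointwise norm `|f|_X` of `f ∈ L⁰(α; X)`, as an element of `L⁰(α)`. -/
def absL0 (𝕜 : Type*) [RCLike 𝕜] {α : Type*} [MeasurableSpace α] {μ : Measure α}
    {X : Type*} [NormedAddCommGroup X] (f : α →ₘ[μ] X) : α →ₘ[μ] 𝕜 :=
  f.comp (fun x => ((‖x‖ : ℝ) : 𝕜)) (RCLike.continuous_ofReal.comp continuous_norm)

theorem norm_absL0 (𝕜 : Type*) [RCLike 𝕜] {α : Type*} [MeasurableSpace α] {μ : Measure α}
    {X : Type*} [NormedAddCommGroup X] (f : α →ₘ[μ] X) :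
    ∀ᵐ a ∂μ, ‖absL0 𝕜 f a‖ = ‖f a‖ := by
  filter_upwards [f.coeFn_comp (fun x => ((‖x‖ : ℝ) : 𝕜))
    (RCLike.continuous_ofReal.comp continuous_norm)] with a ha
  rw [absL0, ha]
  simp

namespace BanachFunctionSpace

variable {𝕜 : Type*} [RCLike 𝕜] {α : Type*} [MeasurableSpace α] {μ : Measure α}

theorem nrm_nonneg (E : BanachFunctionSpace 𝕜 μ) (f : E.carrier) : 0 ≤ E.nrm f := by
  have h0 : E.nrm 0 = 0 := by simpa using E.nrm_smul 0 0
  have h1 := E.nrm_mono 0 f (by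
    filter_upwards [AEEqFun.coeFn_zero (μ := μ) (β := 𝕜) (α := α)] with a ha
    have : (((0 : E.carrier) : α →ₘ[μ] 𝕜)) a = 0 := ha
    rw [this]; simp)
  linarith

/-- The normed space underlying a Banach function space. -/
def Elem (E : BanachFunctionSpace 𝕜 μ) : Type _ := E.carrier

instance : CoeSort (BanachFunctionSpace 𝕜 μ) (Type _) := ⟨Elem⟩

instance (E : BanachFunctionSpace 𝕜 μ) : AddCommGroup E :=
  inferInstanceAs (AddCommGroup E.carrier)

instance (E : BanachFunctionSpace 𝕜 μ) : Module 𝕜 E := inferInstanceAs (Module 𝕜 E.carrier)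

instance (E : BanachFunctionSpace 𝕜 μ) : Norm E := ⟨E.nrm⟩

theorem core (E : BanachFunctionSpace 𝕜 μ) : NormedSpace.Core 𝕜 E where
  norm_nonneg f := E.nrm_nonneg f
  norm_smul c f := E.nrm_smul c f
  norm_triangle f g := E.nrm_add_le f g
  norm_eq_zero_iff f := ⟨E.eq_zero_of_nrm f, fun h => by
    subst h
    have h0 : E.nrm 0 = 0 := by simpa using E.nrm_smul 0 0
    exact h0⟩

instance (E : BanachFunctionSpace 𝕜 μ) : NormedAddCommGroup E :=
  NormedAddCommGroup.ofCore E.core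

instance (E : BanachFunctionSpace 𝕜 μ) : NormedSpace 𝕜 E := NormedSpace.ofCore E.core

/-- The equivalence class of functions that an element of `E` is. -/
def Elem.toL0 {E : BanachFunctionSpace 𝕜 μ} (f : E) : α →ₘ[μ] 𝕜 := Subtype.val f

instance (E : BanachFunctionSpace 𝕜 μ) : CoeFun E (fun _ => α → 𝕜) := ⟨fun f => f.toL0⟩

/-- The Lebesgue space `L^p(α)` as a Banach function space. -/
def lebesgue (𝕜 : Type*) [RCLike 𝕜] {α : Type*} [MeasurableSpace α] (μ : Measure α)
    (p : ℝ≥0∞) [Fact (1 ≤ p)] : BanachFunctionSpace 𝕜 μ where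
  carrier := Lp.LpSubmodule 𝕜 𝕜 p μ
  solid f _ hg h := Lp.mem_Lp_of_ae_le (f := f) (g := ⟨_, hg⟩) h
  nrm f := (eLpNorm (f : α →ₘ[μ] 𝕜) p μ).toReal
  nrm_add_le f g := norm_add_le (⟨f.1, f.2⟩ : Lp 𝕜 p μ) ⟨g.1, g.2⟩
  nrm_smul c f := norm_smul c (⟨f.1, f.2⟩ : Lp 𝕜 p μ)
  eq_zero_of_nrm f h := by
    have h1 : (⟨f.1, f.2⟩ : Lp 𝕜 p μ) = 0 := norm_eq_zero.1 h
    exact Subtype.ext (congrArg Subtype.val h1)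
  nrm_mono f g h := Lp.norm_le_norm_of_ae_le (f := ⟨f.1, f.2⟩) (g := ⟨g.1, g.2⟩) h
  complete u hu := by
    have hc : CauchySeq (fun n => (⟨(u n).1, (u n).2⟩ : Lp 𝕜 p μ)) := by
      rw [Metric.cauchySeq_iff]
      intro ε hε
      obtain ⟨N, hN⟩ := hu ε hε
      refine ⟨N, fun m hm n hn => ?_⟩
      rw [dist_eq_norm]
      exact hN m hm n hn
    obtain ⟨f, hf⟩ := cauchySeq_tendsto_of_complete hc
    exact ⟨⟨f.1, f.2⟩, (tendsto_iff_norm_sub_tendsto_zero.1 hf)⟩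

/-- `f ≥ 0` almost everywhere. -/
def IsNonneg {E : BanachFunctionSpace 𝕜 μ} (f : E) : Prop :=
  ∀ᵐ a ∂μ, 0 ≤ RCLike.re (f a) ∧ RCLike.im (f a) = 0

/-- The modulus `|f|` of an element of `E`. -/
def Elem.abs {E : BanachFunctionSpace 𝕜 μ} (f : E) : E :=
  ⟨absL0 𝕜 f.toL0, E.solid _ _ f.2 ((norm_absL0 𝕜 f.toL0).mono fun _ h => h.le)⟩

/-- `E` has a strong order unit. -/
def HasStrongOrderUnit (E : BanachFunctionSpace 𝕜 μ) : Prop :=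
  ∃ u : E, IsNonneg u ∧ ∀ f : E, ∃ c : ℝ, 0 ≤ c ∧ ∀ᵐ a ∂μ, ‖f a‖ ≤ c * RCLike.re (u a)

/-- The Köthe dual `E^×`, as a set of elements of `L⁰(α)`. -/
def kotheDual (E : BanachFunctionSpace 𝕜 μ) : Set (α →ₘ[μ] 𝕜) :=
  {f | ∀ e : E, Integrable (fun a => f a * e a) μ}

section Bochner

variable (E : BanachFunctionSpace 𝕜 μ) (X : Type*) [NormedAddCommGroup X] [NormedSpace 𝕜 X]

/-- The Köthe–Bochner space `E(X) = {f ∈ L⁰(α; X) : |f|_X ∈ E}` as a subspace of `L⁰(α; X)`. -/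
def bochnerSubmodule : Submodule 𝕜 (α →ₘ[μ] X) where
  carrier := {f | absL0 𝕜 f ∈ E.carrier}
  zero_mem' := by
    refine E.solid _ 0 E.carrier.zero_mem ?_
    filter_upwards [norm_absL0 𝕜 (0 : α →ₘ[μ] X), AEEqFun.coeFn_zero (μ := μ) (β := X) (α := α)]
      with a h1 h2
    rw [h1, h2]; simp
  add_mem' {f g} hf hg := by
    refine E.solid _ (absL0 𝕜 f + absL0 𝕜 g) (E.carrier.add_mem hf hg) ?_
    filter_upwards [norm_absL0 𝕜 (f + g), AEEqFun.coeFn_add f g,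
      AEEqFun.coeFn_add (absL0 𝕜 f) (absL0 𝕜 g),
      f.coeFn_comp (fun x => ((‖x‖ : ℝ) : 𝕜)) (RCLike.continuous_ofReal.comp continuous_norm),
      g.coeFn_comp (fun x => ((‖x‖ : ℝ) : 𝕜)) (RCLike.continuous_ofReal.comp continuous_norm)]
      with a h1 h2 h3 h4 h5
    rw [h1, h2, h3, Pi.add_apply, Pi.add_apply, absL0, absL0, h4, h5]
    simp only [Function.comp_apply]
    rw [← RCLike.ofReal_add, RCLike.norm_ofReal]
    exact (norm_add_le _ _).trans (le_abs_self _)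
  smul_mem' c f hf := by
    refine E.solid _ (c • absL0 𝕜 f) (E.carrier.smul_mem c hf) ?_
    filter_upwards [norm_absL0 𝕜 (c • f), AEEqFun.coeFn_smul c f,
      AEEqFun.coeFn_smul c (absL0 𝕜 f), norm_absL0 𝕜 f] with a h1 h2 h3 h4
    rw [h1, h2, h3, Pi.smul_apply, Pi.smul_apply, norm_smul, norm_smul, h4]

/-- The Köthe–Bochner space `E(X)` as a type, normed by `‖f‖ = ‖ |f|_X ‖_E`. -/
def Bochner : Type _ := E.bochnerSubmodule X

instance : AddCommGroup (E.Bochner X) := inferInstanceAs (AddCommGroup (E.bochnerSubmodule X))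

instance : Module 𝕜 (E.Bochner X) := inferInstanceAs (Module 𝕜 (E.bochnerSubmodule X))

instance : Norm (E.Bochner X) := ⟨fun f => E.nrm ⟨absL0 𝕜 f.1, f.2⟩⟩

theorem bochnerCore : NormedSpace.Core 𝕜 (E.Bochner X) where
  norm_nonneg f := E.nrm_nonneg _
  norm_smul c f := by
    have hc : E.nrm (c • ⟨absL0 𝕜 f.1, f.2⟩) = ‖c‖ * E.nrm ⟨absL0 𝕜 f.1, f.2⟩ :=
      E.nrm_smul c _
    have hae : ∀ᵐ a ∂μ, ‖absL0 𝕜 (c • f.1) a‖ = ‖(c • absL0 𝕜 f.1 : α →ₘ[μ] 𝕜) a‖ := by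
      filter_upwards [norm_absL0 𝕜 (c • f.1), AEEqFun.coeFn_smul c f.1,
        AEEqFun.coeFn_smul c (absL0 𝕜 f.1), norm_absL0 𝕜 f.1] with a h1 h2 h3 h4
      rw [h1, h2, h3, Pi.smul_apply, Pi.smul_apply, norm_smul, norm_smul, h4]
    rw [show ‖f‖ = E.nrm ⟨absL0 𝕜 f.1, f.2⟩ from rfl, ← hc]
    exact le_antisymm (E.nrm_mono _ _ (hae.mono fun _ h => h.le))
      (E.nrm_mono _ _ (hae.mono fun _ h => h.ge))
  norm_triangle f g := by
    refine le_trans (E.nrm_mono _ (⟨absL0 𝕜 f.1, f.2⟩ + ⟨absL0 𝕜 g.1, g.2⟩) ?_)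
      (E.nrm_add_le _ _)
    filter_upwards [norm_absL0 𝕜 (f.1 + g.1), AEEqFun.coeFn_add f.1 g.1,
      AEEqFun.coeFn_add (absL0 𝕜 f.1) (absL0 𝕜 g.1),
      f.1.coeFn_comp (fun x => ((‖x‖ : ℝ) : 𝕜)) (RCLike.continuous_ofReal.comp continuous_norm),
      g.1.coeFn_comp (fun x => ((‖x‖ : ℝ) : 𝕜)) (RCLike.continuous_ofReal.comp continuous_norm)]
      with a h1 h2 h3 h4 h5
    refine h1.le.trans ?_
    refine le_trans ?_ (congrArg norm h3).ge
    rw [h2, Pi.add_apply, Pi.add_apply, absL0, absL0, h4, h5]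
    simp only [Function.comp_apply]
    rw [← RCLike.ofReal_add, RCLike.norm_ofReal]
    exact (norm_add_le _ _).trans (le_abs_self _)
  norm_eq_zero_iff f := by
    constructor
    · intro h
      have h0 : absL0 𝕜 f.1 = 0 := congrArg Subtype.val (E.eq_zero_of_nrm _ h)
      refine Subtype.ext (AEEqFun.ext ?_)
      filter_upwards [norm_absL0 𝕜 f.1, AEEqFun.coeFn_zero (μ := μ) (β := 𝕜) (α := α),
        AEEqFun.coeFn_zero (μ := μ) (β := X) (α := α)] with a h1 h2 h3
      rw [h0, h2] at h1
      have h4 : f.1 a = 0 := norm_eq_zero.1 (by rw [← h1]; simp)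
      exact h4.trans h3.symm
    · rintro rfl
      have h0 : E.nrm 0 = 0 := by simpa using E.nrm_smul 0 0
      refine le_antisymm ?_ (E.nrm_nonneg _)
      rw [← h0]
      refine E.nrm_mono _ _ ?_
      filter_upwards [norm_absL0 𝕜 (0 : α →ₘ[μ] X),
        AEEqFun.coeFn_zero (μ := μ) (β := X) (α := α)] with a h1 h2
      refine h1.le.trans ?_
      rw [h2]; simp

instance : NormedAddCommGroup (E.Bochner X) := NormedAddCommGroup.ofCore (E.bochnerCore X)

instance : NormedSpace 𝕜 (E.Bochner X) := NormedSpace.ofCore (E.bochnerCore X)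

variable {E X}

/-- The equivalence class of functions that an element of `E(X)` is. -/
def Bochner.toL0 (f : E.Bochner X) : α →ₘ[μ] X := Subtype.val f

/-- The elementary tensor `f ⊗ x`, i.e. the function `a ↦ f(a) x`, in `E(X)`. -/
def tmul (f : E) (x : X) : E.Bochner X :=
  ⟨f.toL0.comp (fun c : 𝕜 => c • x) (continuous_id.smul continuous_const), by
    refine E.solid _ (((‖x‖ : ℝ) : 𝕜) • f.toL0) (E.carrier.smul_mem _ f.2) ?_
    filter_upwards [norm_absL0 𝕜 (f.toL0.comp (fun c : 𝕜 => c • x)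
      (continuous_id.smul continuous_const)), f.toL0.coeFn_comp (fun c : 𝕜 => c • x)
      (continuous_id.smul continuous_const),
      AEEqFun.coeFn_smul ((‖x‖ : ℝ) : 𝕜) f.toL0] with a h1 h2 h3
    rw [h1, h2, h3, Function.comp_apply, Pi.smul_apply, norm_smul, norm_smul,
      RCLike.norm_ofReal, abs_norm, mul_comm]⟩

variable (E X)

/-- `E ⊗̃ X`: the closure of `E ⊗ X` (the span of the elementary tensors) in `E(X)`. -/
def tensor : Submodule 𝕜 (E.Bochner X) :=
  (Submodule.span 𝕜 {φ | ∃ (f : E) (x : X), φ = tmul f x}).topologicalClosure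

variable {E X}

/-- The elementary tensor `f ⊗ x` as an element of `E ⊗̃ X`. -/
def tmul' (f : E) (x : X) : E.tensor X :=
  ⟨tmul f x, Submodule.le_topologicalClosure _ (Submodule.subset_span ⟨f, x, rfl⟩)⟩

variable (E X)

/-- `E^×(X) = {f ∈ L⁰(α; X) : |f|_X ∈ E^×}`. -/
def kotheDualBochner : Set (α →ₘ[μ] X) := {f | absL0 𝕜 f ∈ E.kotheDual}

end Bochner

end BanachFunctionSpace

open BanachFunctionSpace

section Order

variable {𝕜 : Type*} [RCLike 𝕜] {α β : Type*} [MeasurableSpace α] [MeasurableSpace β]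
  {μ : Measure α} {ν : Measure β} {E : BanachFunctionSpace 𝕜 μ} {G : BanachFunctionSpace 𝕜 ν}

/-- A positive operator between Banach function spaces. -/
def IsPositiveOp (R : E →L[𝕜] G) : Prop := ∀ f : E, IsNonneg f → IsNonneg (R f)

/-- A regular operator: a linear combination of positive operators. -/
def IsRegularOp (T : E →L[𝕜] G) : Prop :=
  T ∈ Submodule.span 𝕜 {R : E →L[𝕜] G | IsPositiveOp R}

/-- The positive operator `R` dominates `T`: `|T f| ≤ R |f|` for all `f ∈ E`. -/
def IsDominant (R T : E →L[𝕜] G) : Prop :=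
  IsPositiveOp R ∧ ∀ f : E, ∀ᵐ b ∂ν, ‖T f b‖ ≤ RCLike.re (R f.abs b)

/-- The regular norm `‖T‖_r`: the infimum of `‖R‖` over the positive operators `R` dominating
`T` (meaningful for operators that have a dominant, in particular for regular ones). -/
def regularNorm (T : E →L[𝕜] G) : ℝ := sInf {r | ∃ R : E →L[𝕜] G, IsDominant R T ∧ r = ‖R‖}

/-- The order of the dual `E*`: `φ ≤ ψ` iff `ψ - φ` is a positive functional. -/
def DualLE (φ ψ : E →L[𝕜] 𝕜) : Prop :=
  ∀ f : E, IsNonneg f → 0 ≤ RCLike.re (ψ f - φ f) ∧ RCLike.im (ψ f - φ f) = 0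

/-- The modulus of a functional in the Banach lattice `E*`, evaluated at `|f|`:
`|φ|(|f|) = sup {|φ(g)| : |g| ≤ |f|}`. -/
def dualModulus (φ : E →L[𝕜] 𝕜) (f : E) : ℝ :=
  ⨆ g : {g : E // ∀ᵐ a ∂μ, ‖g a‖ ≤ ‖f a‖}, ‖φ g.1‖

/-- A band in the Banach lattice `E*`: a linear subspace that is solid, and that contains the
supremum in `E*` of each of its upward directed sets of positive elements having one. -/
structure IsDualBand (I : Set (E →L[𝕜] 𝕜)) : Prop where
  linear : ∃ V : Submodule 𝕜 (E →L[𝕜] 𝕜), (V : Set (E →L[𝕜] 𝕜)) = I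
  solid : ∀ φ ∈ I, ∀ ψ : E →L[𝕜] 𝕜, (∀ f, dualModulus ψ f ≤ dualModulus φ f) → ψ ∈ I
  order_closed : ∀ D : Set (E →L[𝕜] 𝕜), D ⊆ I → D.Nonempty → DirectedOn DualLE D →
    (∀ φ ∈ D, DualLE 0 φ) → ∀ φ : E →L[𝕜] 𝕜, (∀ ψ ∈ D, DualLE ψ φ) →
    (∀ χ : E →L[𝕜] 𝕜, (∀ ψ ∈ D, DualLE ψ χ) → DualLE φ χ) → φ ∈ I

end Order

section Duality

variable {𝕜 : Type*} [RCLike 𝕜]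

/-- A Banach duality between `X` and `Y`: a bounded bilinear form that induces injections
`X → Y*` and `Y → X*`. -/
def IsBanachDuality {X Y : Type*} [NormedAddCommGroup X] [NormedSpace 𝕜 X]
    [NormedAddCommGroup Y] [NormedSpace 𝕜 Y] (P : X →L[𝕜] Y →L[𝕜] 𝕜) : Prop :=
  Function.Injective P ∧ Function.Injective P.flip

variable {β : Type*} [MeasurableSpace β] {ν : Measure β}

/-- The pairing `∫ f g`. -/
def scalarPairing (f g : β →ₘ[ν] 𝕜) : 𝕜 := ∫ b, f b * g b ∂ν

/-- The pairing `∫ ⟨f, g⟩` induced by a pairing of `X` with `Y`. -/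
def bochnerPairing {X Y : Type*} [NormedAddCommGroup X] [NormedSpace 𝕜 X]
    [NormedAddCommGroup Y] [NormedSpace 𝕜 Y] (P : X →L[𝕜] Y →L[𝕜] 𝕜)
    (f : β →ₘ[ν] X) (g : β →ₘ[ν] Y) : 𝕜 := ∫ b, P (f b) (g b) ∂ν

/-- `⟨F, G⟩` is a Köthe dual pair: `F · G ⊆ L¹`, and `∫ f g` is a Banach duality. -/
structure IsKotheDualPair (F G : BanachFunctionSpace 𝕜 ν) : Prop where
  integrable : ∀ (f : F) (g : G), Integrable (fun b => f b * g b) ν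
  bounded : ∃ C : ℝ, ∀ (f : F) (g : G), ‖scalarPairing f.toL0 g.toL0‖ ≤ C * ‖f‖ * ‖g‖
  separating_left : ∀ f : F, (∀ g : G, scalarPairing f.toL0 g.toL0 = 0) → f = 0
  separating_right : ∀ g : G, (∀ f : F, scalarPairing f.toL0 g.toL0 = 0) → g = 0

/-- The image of `g ↦ ⟨·, g⟩`, `G → F*`. -/
def kotheImage (F G : BanachFunctionSpace 𝕜 ν) : Set (F →L[𝕜] 𝕜) :=
  {φ | ∃ g : G, ∀ f : F, φ f = scalarPairing f.toL0 g.toL0}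

/-- The weak topology `σ(V, W)` on `V` generated by a pairing `p` of `V` with `W`: the coarsest
topology making `p · w` continuous for all `w ∈ W`. -/
abbrev weakTop {V W : Type*} (p : V → W → 𝕜) : TopologicalSpace V :=
  TopologicalSpace.induced (fun v w => p v w) Pi.topologicalSpace

end Duality

section Extensions

variable {𝕜 : Type*} [RCLike 𝕜] {A B : Type*} [MeasurableSpace A] [MeasurableSpace B]
  {μ : Measure A} {ν : Measure B} {F G : BanachFunctionSpace 𝕜 ν}

/-- `σ(L^∞, L^1)`-to-`σ(G, F)` continuity of `T : L^∞ → G`. -/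
def IsWeakContinuous (F : BanachFunctionSpace 𝕜 ν) (T : lebesgue 𝕜 μ ∞ →L[𝕜] G) : Prop :=
  @Continuous _ _
    (weakTop fun (h : lebesgue 𝕜 μ ∞) (k : lebesgue 𝕜 μ 1) => scalarPairing h.toL0 k.toL0)
    (weakTop fun (g : G) (f : F) => scalarPairing g.toL0 f.toL0) T

variable {X Y : Type*} [NormedAddCommGroup X] [NormedSpace 𝕜 X]
  [NormedAddCommGroup Y] [NormedSpace 𝕜 Y]

/-- `T_Y : L^∞(A; Y) → G(Y)` is an extension of `T ⊗ I_Y` that is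
`σ(L^∞(A; Y), L^1(A; X))`-to-`σ(G(Y), F ⊗̃ X)` continuous. -/
def IsWeakExtensionT (F : BanachFunctionSpace 𝕜 ν) (T : lebesgue 𝕜 μ ∞ →L[𝕜] G)
    (P : X →L[𝕜] Y →L[𝕜] 𝕜) (TY : (lebesgue 𝕜 μ ∞).Bochner Y →L[𝕜] G.Bochner Y) : Prop :=
  (∀ (h : lebesgue 𝕜 μ ∞) (y : Y), TY (tmul h y) = tmul (T h) y) ∧
  @Continuous _ _
    (weakTop fun (h : (lebesgue 𝕜 μ ∞).Bochner Y) (k : (lebesgue 𝕜 μ 1).Bochner X) =>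
      bochnerPairing P k.toL0 h.toL0)
    (weakTop fun (g : G.Bochner Y) (φ : F.tensor X) => bochnerPairing P φ.1.toL0 g.toL0) TY

/-- `S_X : F ⊗̃ X → L^1(A; X)` is an extension of `S ⊗ I_X` that is
`σ(F ⊗̃ X, F^×(Y))`-to-`σ(L^1(A; X), L^∞(A; Y))` continuous. -/
def IsWeakExtensionS (S : F →L[𝕜] lebesgue 𝕜 μ 1)
    (P : X →L[𝕜] Y →L[𝕜] 𝕜) (SX : F.tensor X →L[𝕜] (lebesgue 𝕜 μ 1).Bochner X) : Prop :=
  (∀ (f : F) (x : X), SX (tmul' f x) = tmul (S f) x) ∧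
  @Continuous _ _
    (weakTop fun (φ : F.tensor X) (g : F.kotheDualBochner Y) => bochnerPairing P φ.1.toL0 g.1)
    (weakTop fun (k : (lebesgue 𝕜 μ 1).Bochner X) (h : (lebesgue 𝕜 μ ∞).Bochner Y) =>
      bochnerPairing P k.toL0 h.toL0) SX

end Extensions

end

open BanachFunctionSpace

/-! The engine is the Kantorovich formula: the modulus of an operator S at f ≥ 0 should be the
supremum of the sums ∑ |S(θ_i f)| over finite measurable partitions of unity (θ_i). These sums
increase under refinement, and if their suprema exist in the target they are additive in f, hence
extend to a linear map dominating S (`exists_linear_of_isLUB`). Regularity thus becomes the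
existence of suprema of directed families. In L¹ a norm bound suffices, because the norm is additive
on the positive cone (`exists_isLUB_lebesgue_one`). In G a bound in F* suffices: Banach–Alaoglu
yields a supremum in F*, and the band hypothesis puts it into G (`IsKotheDualPair.exists_isLUB`).

All conditions are brought back to regularity of S. Suppose that the images under T of any finite
family in the unit ball of L^∞ have a common majorant g with ‖g‖ ≤ C. Testing S(θ_i f) against its
conjugate phase s_i gives ∑ ‖S(θ_i f)‖ = ∑ ⟨θ_i f, T s_i⟩ ≤ ∫ |f| |g|, so S is regular
(`isRegularOp_adjoint_of_bound`). Such majorants come from a positive dominant of T, from a strong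
order unit, or from an ampliation of T to ℓ^∞. An ampliation of S to ℓ¹ bounds ∑ ‖S(θ_i f)‖
directly. Conversely, a dominant of S bounds the partition sums of T in F*, and the band property
makes T regular (`isRegularOp_of_adjoint`).

For the extensions, ψ is called the ampliation of φ if l ∘ ψ = S(l ∘ φ) for every functional l. If R
dominates S, then |ψ|_X ≤ R|φ|_X a.e. (`IsAmpliation.ae_norm_le`); this gives closedness of the
domain and the bound ‖R‖, hence the regular norm after taking the infimum. On F ⊗̃ X density of the
elementary tensors finishes the construction. In L^∞(A; Y) their span need not be dense, but
countably-valued functions are; their images are a.e. convergent series, identified by passing to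
the adjoint and dominated convergence (`mem_ampliationDomain_top`). Adjointness is checked on
elementary tensors, and it implies the weak continuity. -/

noncomputable section

open scoped ComplexOrder

namespace BanachFunctionSpace

/-! ### Order, modulus and completeness of a Banach function space -/

section Basic

variable {𝕜 : Type*} [RCLike 𝕜] {α : Type*} [MeasurableSpace α] {μ : Measure α}
  {E : BanachFunctionSpace 𝕜 μ}

theorem Elem.ext_ae {f g : E} (h : ∀ᵐ a ∂μ, f a = g a) : f = g :=
  Subtype.ext (AEEqFun.ext h)

theorem Elem.coe_add (f g : E) : ∀ᵐ a ∂μ, (f + g) a = f a + g a := AEEqFun.coeFn_add f.1 g.1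

theorem Elem.coe_sub (f g : E) : ∀ᵐ a ∂μ, (f - g) a = f a - g a := AEEqFun.coeFn_sub f.1 g.1

theorem Elem.coe_neg (f : E) : ∀ᵐ a ∂μ, (-f) a = - f a := AEEqFun.coeFn_neg f.1

theorem Elem.coe_zero : ∀ᵐ a ∂μ, (0 : E) a = 0 :=
  AEEqFun.coeFn_zero (μ := μ) (β := 𝕜) (α := α)

theorem Elem.coe_smul (c : 𝕜) (f : E) : ∀ᵐ a ∂μ, (c • f) a = c * f a :=
  AEEqFun.coeFn_smul c f.1

theorem Elem.coe_sum {ι : Type*} (s : Finset ι) (f : ι → E) :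
    ∀ᵐ a ∂μ, (∑ i ∈ s, f i) a = ∑ i ∈ s, f i a := by
  classical
  induction s using Finset.induction_on with
  | empty => simpa using Elem.coe_zero
  | insert i s hi ih =>
    rw [Finset.sum_insert hi]
    filter_upwards [Elem.coe_add (f i) (∑ i ∈ s, f i), ih] with a h1 h2
    rw [h1, h2, Finset.sum_insert hi]

theorem Elem.stronglyMeasurable (f : E) : StronglyMeasurable f := f.toL0.stronglyMeasurable

theorem Elem.measurable (f : E) : Measurable f := f.stronglyMeasurable.measurable

theorem Elem.norm_le_norm {f g : E} (h : ∀ᵐ a ∂μ, ‖f a‖ ≤ ‖g a‖) : ‖f‖ ≤ ‖g‖ := E.nrm_mono f g h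

theorem Elem.norm_congr {f g : E} (h : ∀ᵐ a ∂μ, ‖f a‖ = ‖g a‖) : ‖f‖ = ‖g‖ :=
  le_antisymm (norm_le_norm (h.mono fun _ h => h.le)) (norm_le_norm (h.mono fun _ h => h.ge))

instance : CompleteSpace E := by
  refine Metric.complete_of_cauchySeq_tendsto fun u hu => ?_
  obtain ⟨f, hf⟩ := E.complete u (by
    intro ε hε
    obtain ⟨N, hN⟩ := Metric.cauchySeq_iff.1 hu ε hε
    exact ⟨N, fun m hm n hn => by
      have := hN m hm n hn
      rwa [dist_eq_norm] at this⟩)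
  exact ⟨f, tendsto_iff_norm_sub_tendsto_zero.2 hf⟩

variable (E) in
/-- The element of `E` given by a measurable function dominated by an element of `E`. -/
def ofDominated (u : α → 𝕜) (hu : AEStronglyMeasurable u μ) (g : E)
    (h : ∀ᵐ a ∂μ, ‖u a‖ ≤ ‖g a‖) : E :=
  ⟨AEEqFun.mk u hu, E.solid _ _ g.2 (by
    filter_upwards [h, AEEqFun.coeFn_mk u hu] with a h1 h2
    rw [h2]; exact h1)⟩

theorem coe_ofDominated {u : α → 𝕜} (hu : AEStronglyMeasurable u μ) {g : E}
    (h : ∀ᵐ a ∂μ, ‖u a‖ ≤ ‖g a‖) : ∀ᵐ a ∂μ, E.ofDominated u hu g h a = u a :=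
  AEEqFun.coeFn_mk u hu

theorem exists_of_dominated {u : α → 𝕜} (hu : AEStronglyMeasurable u μ) (g : E)
    (h : ∀ᵐ a ∂μ, ‖u a‖ ≤ ‖g a‖) : ∃ f : E, (∀ᵐ a ∂μ, f a = u a) ∧ ‖f‖ ≤ ‖g‖ := by
  refine ⟨E.ofDominated u hu g h, coe_ofDominated hu h, Elem.norm_le_norm ?_⟩
  filter_upwards [h, coe_ofDominated hu h] with a h1 h2
  rwa [h2]

theorem Elem.coe_abs (f : E) : ∀ᵐ a ∂μ, f.abs a = ((‖f a‖ : ℝ) : 𝕜) :=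
  f.toL0.coeFn_comp (fun x => ((‖x‖ : ℝ) : 𝕜)) (RCLike.continuous_ofReal.comp continuous_norm)

theorem Elem.norm_coe_abs (f : E) : ∀ᵐ a ∂μ, ‖f.abs a‖ = ‖f a‖ := by
  filter_upwards [f.coe_abs] with a h
  rw [h]; simp

theorem Elem.norm_abs (f : E) : ‖f.abs‖ = ‖f‖ := norm_congr f.norm_coe_abs

open Classical in
variable (E) in
/-- Multiplication of an element of `E` by a measurable function bounded by `1`
(and zero if the function does not have these properties). -/
def mulFun (m : α → 𝕜) (f : E) : E :=
  if h : Measurable m ∧ ∀ a, ‖m a‖ ≤ 1 then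
    E.ofDominated (fun a => m a * f a)
      (h.1.mul f.measurable).aestronglyMeasurable f
      (ae_of_all _ fun a => by
        rw [norm_mul]; exact mul_le_of_le_one_left (norm_nonneg _) (h.2 a))
  else 0

theorem coe_mulFun {m : α → 𝕜} (hm : Measurable m) (hb : ∀ a, ‖m a‖ ≤ 1) (f : E) :
    ∀ᵐ a ∂μ, E.mulFun m f a = m a * f a := by
  rw [mulFun, dif_pos ⟨hm, hb⟩]
  exact coe_ofDominated _ _

theorem norm_mulFun_le {m : α → 𝕜} (hm : Measurable m) (hb : ∀ a, ‖m a‖ ≤ 1) (f : E) :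
    ‖E.mulFun m f‖ ≤ ‖f‖ := by
  refine Elem.norm_le_norm ?_
  filter_upwards [coe_mulFun hm hb f] with a h
  rw [h, norm_mul]
  exact mul_le_of_le_one_left (norm_nonneg _) (hb a)

/-- The order is that of the scalars, taken a.e.: over ℂ comparable elements differ by a real
function, so E is ordered but not a lattice, and suprema are always meant as `IsLUB`. -/
instance : PartialOrder E where
  le f g := IsNonneg (g - f)
  le_refl f := by
    show IsNonneg (f - f)
    filter_upwards [Elem.coe_sub f f] with a h
    rw [h]; simp
  le_trans f g k h1 h2 := by
    show IsNonneg (k - f)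
    filter_upwards [Elem.coe_sub k f, Elem.coe_sub k g, Elem.coe_sub g f, h1, h2] with a e1 e2 e3 h1 h2
    rw [e1]; rw [e2] at h2; rw [e3] at h1
    simp only [map_sub] at *
    constructor <;> linarith
  le_antisymm f g h1 h2 := by
    refine Elem.ext_ae ?_
    filter_upwards [Elem.coe_sub f g, Elem.coe_sub g f, h1, h2] with a e1 e2 h1 h2
    rw [e2] at h1; rw [e1] at h2
    simp only [map_sub] at *
    exact RCLike.ext (by linarith) (by linarith)

theorem Elem.le_def {f g : E} : f ≤ g ↔ IsNonneg (g - f) := Iff.rfl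

theorem isNonneg_iff {f : E} : IsNonneg f ↔ 0 ≤ f := by rw [Elem.le_def, sub_zero]

theorem Elem.le_iff_ae {f g : E} : f ≤ g ↔ ∀ᵐ a ∂μ, f a ≤ g a := by
  rw [Elem.le_def]
  constructor <;> intro h <;> filter_upwards [Elem.coe_sub g f, h] with a e h
  · rw [e] at h
    rwa [← sub_nonneg, RCLike.nonneg_iff]
  · rw [e]
    rwa [← sub_nonneg, RCLike.nonneg_iff] at h

theorem Elem.nonneg_iff_ae {f : E} : 0 ≤ f ↔ ∀ᵐ a ∂μ, 0 ≤ f a := by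
  rw [← isNonneg_iff]
  exact eventually_congr (ae_of_all _ fun a => RCLike.nonneg_iff.symm)

/-- A nonnegative element is a.e. equal to its pointwise norm. -/
theorem Elem.coe_eq_norm {f : E} (hf : 0 ≤ f) : ∀ᵐ a ∂μ, f a = ((‖f a‖ : ℝ) : 𝕜) := by
  filter_upwards [Elem.nonneg_iff_ae.1 hf] with a h
  exact (RCLike.norm_of_nonneg' h).symm

instance : IsOrderedAddMonoid E where
  add_le_add_left f g h k := by
    rw [Elem.le_def] at *
    rwa [add_sub_add_right_eq_sub]

theorem Elem.abs_nonneg (f : E) : 0 ≤ f.abs := by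
  rw [Elem.nonneg_iff_ae]
  filter_upwards [f.coe_abs] with a h
  rw [h]; exact RCLike.ofReal_nonneg.2 (norm_nonneg _)

theorem Elem.abs_of_nonneg {f : E} (hf : 0 ≤ f) : f.abs = f := by
  refine Elem.ext_ae ?_
  filter_upwards [f.coe_abs, Elem.coe_eq_norm hf] with a h1 h2
  rw [h1, ← h2]

/-- Comparison of nonnegative elements through norms. -/
theorem Elem.le_of_norm_le {f g : E} (hf : 0 ≤ f) (hg : 0 ≤ g) (h : ∀ᵐ a ∂μ, ‖f a‖ ≤ ‖g a‖) :
    f ≤ g := by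
  rw [Elem.le_iff_ae]
  filter_upwards [h, Elem.coe_eq_norm hf, Elem.coe_eq_norm hg] with a h h1 h2
  rw [h1, h2]; exact RCLike.ofReal_le_ofReal.2 h

theorem Elem.norm_coe_le {f g : E} (hf : 0 ≤ f) (h : f ≤ g) : ∀ᵐ a ∂μ, ‖f a‖ ≤ ‖g a‖ := by
  filter_upwards [Elem.le_iff_ae.1 h, Elem.coe_eq_norm hf, Elem.coe_eq_norm (hf.trans h)]
    with a h h1 h2
  rw [h1, h2] at h; exact RCLike.ofReal_le_ofReal.1 h

theorem Elem.norm_mono {f g : E} (hf : 0 ≤ f) (h : f ≤ g) : ‖f‖ ≤ ‖g‖ :=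
  Elem.norm_le_norm (Elem.norm_coe_le hf h)

theorem Elem.smul_nonneg' {f : E} (hf : 0 ≤ f) {r : ℝ} (hr : 0 ≤ r) : 0 ≤ (r : 𝕜) • f := by
  rw [Elem.nonneg_iff_ae] at *
  filter_upwards [hf, Elem.coe_smul (r : 𝕜) f] with a h1 h2
  rw [h2]; exact mul_nonneg (RCLike.ofReal_nonneg.2 hr) h1

/-- The nonnegative cone is closed. -/
theorem isClosed_nonneg : IsClosed {f : E | 0 ≤ f} := by
  refine isClosed_of_closure_subset fun f hf => ?_
  -- The positive part of Re f is, pointwise, the nonnegative number nearest to f. Hence its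
  -- distance to f is at most that of any g ≥ 0, and it must equal f.
  have hm : AEStronglyMeasurable (fun a => ((max (RCLike.re (f a)) 0 : ℝ) : 𝕜)) μ :=
    (RCLike.continuous_ofReal.measurable.comp
      ((RCLike.continuous_re.measurable.comp f.measurable).max measurable_const)).aestronglyMeasurable
  obtain ⟨p, hp, -⟩ := exists_of_dominated hm f (ae_of_all _ fun a => by
    rw [RCLike.norm_ofReal, abs_of_nonneg (le_max_right _ _)]
    exact max_le (RCLike.re_le_norm _) (norm_nonneg _))
  have hp0 : 0 ≤ p := by
    rw [Elem.nonneg_iff_ae]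
    filter_upwards [hp] with a h
    rw [h]; exact RCLike.ofReal_nonneg.2 (le_max_right _ _)
  suffices f = p by rw [this]; exact hp0
  rw [← sub_eq_zero, ← norm_le_zero_iff]
  refine le_of_forall_pos_le_add fun ε hε => ?_
  obtain ⟨g, hg, hd⟩ := Metric.mem_closure_iff.1 hf ε hε
  rw [zero_add]
  refine le_trans (Elem.norm_le_norm (g := f - g) ?_) (by rw [← dist_eq_norm]; exact hd.le)
  filter_upwards [Elem.coe_sub f p, Elem.coe_sub f g, hp, Elem.nonneg_iff_ae.1 hg] with a h1 h2 h3 h4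
  rw [h1, h2, h3]
  rw [RCLike.nonneg_iff] at h4
  refine le_of_sq_le_sq ?_ (norm_nonneg _)
  rw [← RCLike.normSq_eq_def', ← RCLike.normSq_eq_def', RCLike.normSq_apply, RCLike.normSq_apply]
  simp only [map_sub, RCLike.ofReal_re, RCLike.ofReal_im, h4.2, sub_zero]
  rcases le_total 0 (RCLike.re (f a)) with h | h
  · rw [max_eq_left h]; nlinarith [sq_nonneg (RCLike.re (f a) - RCLike.re (g a))]
  · rw [max_eq_right h]; nlinarith [h4.1]

theorem isClosed_le (f : E) : IsClosed {g : E | f ≤ g} := by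
  have : {g : E | f ≤ g} = (fun g => g - f) ⁻¹' {g | 0 ≤ g} := by ext g; simp
  rw [this]
  exact isClosed_nonneg.preimage (by fun_prop)

theorem isClosed_ge (f : E) : IsClosed {g : E | g ≤ f} := by
  have : {g : E | g ≤ f} = (fun g => f - g) ⁻¹' {g | 0 ≤ g} := by ext g; simp
  rw [this]
  exact isClosed_nonneg.preimage (by fun_prop)

end Basic

end BanachFunctionSpace

/-! ### Köthe–Bochner spaces: pointwise calculus, functionals, completeness -/

namespace BanachFunctionSpace

/-- A series of vector-valued functions whose partial sums of norms are bounded a.e. -/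
theorem ae_summable_of_bounded {α : Type*} [MeasurableSpace α] {μ : Measure α}
    {X : Type*} [NormedAddCommGroup X] [CompleteSpace X] {u : ℕ → α → X}
    (hu : ∀ n, AEStronglyMeasurable (u n) μ) {w : α → ℝ}
    (h : ∀ N, ∀ᵐ a ∂μ, ∑ n ∈ Finset.range N, ‖u n a‖ ≤ w a) :
    (∀ᵐ a ∂μ, Summable (fun n => ‖u n a‖) ∧ ∑' n, ‖u n a‖ ≤ w a) ∧
      AEStronglyMeasurable (fun a => ∑' n, u n a) μ := by
  have h1 : ∀ᵐ a ∂μ, Summable (fun n => ‖u n a‖) ∧ ∑' n, ‖u n a‖ ≤ w a := by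
    filter_upwards [ae_all_iff.2 h] with a ha
    have hs : Summable (fun n => ‖u n a‖) :=
      summable_of_sum_range_le (fun _ => norm_nonneg _) ha
    exact ⟨hs, Real.tsum_le_of_sum_range_le (fun _ => norm_nonneg _) ha⟩
  refine ⟨h1, aestronglyMeasurable_of_tendsto_ae atTop
    (f := fun N a => ∑ n ∈ Finset.range N, u n a) (fun N => ?_) ?_⟩
  · exact Finset.aestronglyMeasurable_fun_sum _ fun n _ => hu n
  · filter_upwards [h1] with a ha
    exact ha.1.of_norm.hasSum.tendsto_sum_nat

section BochnerBasic

variable {𝕜 : Type*} [RCLike 𝕜] {α : Type*} [MeasurableSpace α] {μ : Measure α}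
  {E : BanachFunctionSpace 𝕜 μ} {X : Type*} [NormedAddCommGroup X] [NormedSpace 𝕜 X]

namespace Bochner

theorem ext_ae {f g : E.Bochner X} (h : ∀ᵐ a ∂μ, f.toL0 a = g.toL0 a) : f = g :=
  Subtype.ext (AEEqFun.ext h)

theorem coe_add (f g : E.Bochner X) : ∀ᵐ a ∂μ, (f + g).toL0 a = f.toL0 a + g.toL0 a :=
  AEEqFun.coeFn_add f.1 g.1

theorem coe_sub (f g : E.Bochner X) : ∀ᵐ a ∂μ, (f - g).toL0 a = f.toL0 a - g.toL0 a :=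
  AEEqFun.coeFn_sub f.1 g.1

theorem coe_smul (c : 𝕜) (f : E.Bochner X) : ∀ᵐ a ∂μ, (c • f).toL0 a = c • f.toL0 a :=
  AEEqFun.coeFn_smul c f.1

theorem coe_zero : ∀ᵐ a ∂μ, (0 : E.Bochner X).toL0 a = 0 :=
  AEEqFun.coeFn_zero (μ := μ) (β := X) (α := α)

theorem coe_sum {ι : Type*} (s : Finset ι) (f : ι → E.Bochner X) :
    ∀ᵐ a ∂μ, (∑ i ∈ s, f i).toL0 a = ∑ i ∈ s, (f i).toL0 a := by
  classical
  induction s using Finset.induction_on with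
  | empty => simpa using coe_zero
  | insert i s hi ih =>
    rw [Finset.sum_insert hi]
    filter_upwards [coe_add (f i) (∑ i ∈ s, f i), ih] with a h1 h2
    rw [h1, h2, Finset.sum_insert hi]

theorem stronglyMeasurable (f : E.Bochner X) : StronglyMeasurable f.toL0 :=
  f.toL0.stronglyMeasurable

/-- The pointwise norm of an element of `E(X)`, as an element of `E`. -/
def absE (f : E.Bochner X) : E := ⟨absL0 𝕜 f.toL0, f.2⟩

theorem norm_absE (f : E.Bochner X) : ‖f.absE‖ = ‖f‖ := rfl

theorem coe_absE (f : E.Bochner X) : ∀ᵐ a ∂μ, f.absE a = ((‖f.toL0 a‖ : ℝ) : 𝕜) :=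
  f.toL0.coeFn_comp (fun x => ((‖x‖ : ℝ) : 𝕜)) (RCLike.continuous_ofReal.comp continuous_norm)

theorem norm_coe_absE (f : E.Bochner X) : ∀ᵐ a ∂μ, ‖f.absE a‖ = ‖f.toL0 a‖ := by
  filter_upwards [f.coe_absE] with a h
  rw [h]; simp

theorem absE_nonneg (f : E.Bochner X) : 0 ≤ f.absE := by
  rw [Elem.nonneg_iff_ae]
  filter_upwards [f.coe_absE] with a h
  rw [h]; exact RCLike.ofReal_nonneg.2 (norm_nonneg _)

theorem norm_le_of_ae {f : E.Bochner X} {g : E} (h : ∀ᵐ a ∂μ, ‖f.toL0 a‖ ≤ ‖g a‖) :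
    ‖f‖ ≤ ‖g‖ := by
  rw [← norm_absE]
  refine Elem.norm_le_norm ?_
  filter_upwards [f.norm_coe_absE, h] with a h1 h2
  rwa [h1]

theorem norm_ge_of_ae {f : E.Bochner X} {g : E} (h : ∀ᵐ a ∂μ, ‖g a‖ ≤ ‖f.toL0 a‖) :
    ‖g‖ ≤ ‖f‖ := by
  rw [← norm_absE]
  refine Elem.norm_le_norm ?_
  filter_upwards [f.norm_coe_absE, h] with a h1 h2
  rwa [h1]

theorem exists_of_dominated {u : α → X} (hu : AEStronglyMeasurable u μ) (g : E)
    (h : ∀ᵐ a ∂μ, ‖u a‖ ≤ ‖g a‖) : ∃ f : E.Bochner X, ∀ᵐ a ∂μ, f.toL0 a = u a := by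
  refine ⟨⟨AEEqFun.mk u hu, E.solid _ _ g.2 ?_⟩, AEEqFun.coeFn_mk u hu⟩
  filter_upwards [h, AEEqFun.coeFn_mk u hu, norm_absL0 𝕜 (AEEqFun.mk u hu)] with a h1 h2 h3
  rw [h3, h2]; exact h1

/-- Composition with a functional, `E(X) → E`. -/
def dualComp (l : X →L[𝕜] 𝕜) : E.Bochner X →L[𝕜] E :=
  have hdom (f : E.Bochner X) : ∀ᵐ a ∂μ, ‖l (f.toL0 a)‖ ≤ ‖(((‖l‖ : ℝ) : 𝕜) • f.absE) a‖ := by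
    filter_upwards [Elem.coe_smul ((‖l‖ : ℝ) : 𝕜) f.absE, f.norm_coe_absE] with a h1 h2
    rw [h1, norm_mul, h2, RCLike.norm_ofReal, abs_norm]
    exact l.le_opNorm _
  have hm (f : E.Bochner X) : AEStronglyMeasurable (fun a => l (f.toL0 a)) μ :=
    (l.continuous.comp_stronglyMeasurable f.stronglyMeasurable).aestronglyMeasurable
  LinearMap.mkContinuous
    { toFun := fun f => E.ofDominated (fun a => l (f.toL0 a)) (hm f) _ (hdom f)
      map_add' := fun f g => by
        refine Elem.ext_ae ?_
        filter_upwards [coe_ofDominated (hm f) (hdom f), coe_ofDominated (hm g) (hdom g),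
          coe_ofDominated (hm (f + g)) (hdom (f + g)), coe_add f g, Elem.coe_add
          (E.ofDominated (fun a => l (f.toL0 a)) (hm f) _ (hdom f))
          (E.ofDominated (fun a => l (g.toL0 a)) (hm g) _ (hdom g))] with a h1 h2 h3 h4 h5
        rw [h3, h5, h1, h2, h4, map_add]
      map_smul' := fun c f => by
        refine Elem.ext_ae ?_
        filter_upwards [coe_ofDominated (hm f) (hdom f),
          coe_ofDominated (hm (c • f)) (hdom (c • f)), coe_smul c f, Elem.coe_smul c
          (E.ofDominated (fun a => l (f.toL0 a)) (hm f) _ (hdom f))] with a h1 h3 h4 h5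
        rw [h3, RingHom.id_apply, h5, h1, h4, map_smul, smul_eq_mul] }
    ‖l‖ fun f => by
      refine (Elem.norm_le_norm (g := ((‖l‖ : ℝ) : 𝕜) • f.absE) ?_).trans_eq ?_
      · filter_upwards [coe_ofDominated (hm f) (hdom f), hdom f] with a h1 h2
        exact (congrArg norm h1).le.trans h2
      · rw [norm_smul, RCLike.norm_ofReal, abs_norm, norm_absE]

theorem coe_dualComp (l : X →L[𝕜] 𝕜) (f : E.Bochner X) :
    ∀ᵐ a ∂μ, dualComp l f a = l (f.toL0 a) :=
  AEEqFun.coeFn_mk (fun a => l (f.toL0 a)) _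

/-- Riesz–Fischer: for an absolutely summable series the pointwise norms sum in E to some v. The
partial sums stay below v, so the series converges absolutely a.e., and each remainder is dominated
by v minus a partial sum, which tends to 0 in E. -/
instance [CompleteSpace X] : CompleteSpace (E.Bochner X) := by
  refine NormedAddCommGroup.completeSpace_of_summable_imp_tendsto fun u hu => ?_
  have hs : Summable fun n => (u n).absE := Summable.of_norm hu
  set v : E := ∑' n, (u n).absE with hv
  have hle (N : ℕ) : ∑ n ∈ Finset.range N, (u n).absE ≤ v := by
    refine (isClosed_le _).mem_of_tendsto hs.hasSum.tendsto_sum_nat ?_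
    filter_upwards [eventually_ge_atTop N] with M hM
    exact Finset.sum_le_sum_of_subset_of_nonneg (Finset.range_mono hM)
      fun n _ _ => (u n).absE_nonneg
  have hcoe : ∀ᵐ a ∂μ, ∀ n, (u n).absE a = ((‖(u n).toL0 a‖ : ℝ) : 𝕜) :=
    ae_all_iff.2 fun n => (u n).coe_absE
  have hv0 : 0 ≤ v := by simpa using hle 0
  have hpart (N : ℕ) : ∀ᵐ a ∂μ, ∑ n ∈ Finset.range N, ‖(u n).toL0 a‖ ≤ RCLike.re (v a) := by
    filter_upwards [Elem.le_iff_ae.1 (hle N), hcoe, Elem.coe_sum (Finset.range N)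
      fun n => (u n).absE] with a h1 h2 h3
    rw [h3] at h1
    simp only [h2, ← RCLike.ofReal_sum] at h1
    simpa using (RCLike.le_iff_re_im.1 h1).1
  obtain ⟨hsum, hmeas⟩ := ae_summable_of_bounded
    (fun n => (u n).stronglyMeasurable.aestronglyMeasurable) hpart
  obtain ⟨f, hf⟩ := exists_of_dominated (E := E) hmeas v (by
    filter_upwards [hsum] with a ha
    exact (norm_tsum_le_tsum_norm ha.1).trans (ha.2.trans (RCLike.re_le_norm _)))
  refine ⟨f, tendsto_iff_norm_sub_tendsto_zero.2 ?_⟩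
  have hlim : Tendsto (fun N => ‖v - ∑ n ∈ Finset.range N, (u n).absE‖) atTop (𝓝 0) := by
    have := (tendsto_const_nhds (x := v)).sub hs.hasSum.tendsto_sum_nat
    simpa [← hv] using this.norm
  refine squeeze_zero (fun _ => norm_nonneg _) (fun N => ?_) hlim
  refine norm_le_of_ae ?_
  filter_upwards [coe_sub (∑ n ∈ Finset.range N, u n) f, coe_sum (Finset.range N) u, hf,
    Elem.coe_sub v (∑ n ∈ Finset.range N, (u n).absE), Elem.coe_sum (Finset.range N)
      fun n => (u n).absE, hcoe, hsum] with a h1 h2 h3 h4 h5 h6 h7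
  rw [h1, h2, h3, h4, h5]
  simp only [h6, ← RCLike.ofReal_sum]
  have e1 := h7.1.of_norm.sum_add_tsum_nat_add N
  have e2 := h7.1.sum_add_tsum_nat_add N
  have hs' : Summable fun n => ‖(u (n + N)).toL0 a‖ :=
    (summable_nat_add_iff (f := fun n => ‖(u n).toL0 a‖) N).2 h7.1
  rw [← e1, sub_add_cancel_left, norm_neg]
  refine (norm_tsum_le_tsum_norm hs').trans (le_trans ?_ (RCLike.re_le_norm _))
  rw [map_sub, RCLike.ofReal_re]
  linarith [h7.2]

end Bochner

theorem coe_tmul (f : E) (x : X) : ∀ᵐ a ∂μ, (tmul f x).toL0 a = f a • x :=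
  f.toL0.coeFn_comp (fun c : 𝕜 => c • x) (continuous_id.smul continuous_const)

theorem coe_sum_tmul {ι : Type*} (s : Finset ι) (f : ι → E) (x : ι → X) :
    ∀ᵐ a ∂μ, (∑ i ∈ s, tmul (f i) (x i)).toL0 a = ∑ i ∈ s, f i a • x i := by
  have : ∀ᵐ a ∂μ, ∀ i ∈ s, (tmul (f i) (x i)).toL0 a = f i a • x i :=
    (ae_ball_iff s.countable_toSet).2 fun i _ => coe_tmul (f i) (x i)
  filter_upwards [Bochner.coe_sum s fun i => tmul (f i) (x i), this] with a h1 h2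
  rw [h1]; exact Finset.sum_congr rfl h2

theorem dualComp_tmul (l : X →L[𝕜] 𝕜) (f : E) (x : X) : Bochner.dualComp l (tmul f x) = l x • f := by
  refine Elem.ext_ae ?_
  filter_upwards [Bochner.coe_dualComp l (tmul f x), coe_tmul f x, Elem.coe_smul (l x) f]
    with a h1 h2 h3
  rw [h1, h2, h3, map_smul, smul_eq_mul, mul_comm]

end BochnerBasic

end BanachFunctionSpace

/-! ### Decomposition into nonnegative elements -/

namespace BanachFunctionSpace

section Decomposition

variable {𝕜 : Type*} [RCLike 𝕜] {α : Type*} [MeasurableSpace α] {μ : Measure α}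
  {E : BanachFunctionSpace 𝕜 μ}

/-- A measurable real function dominated by an element of `E`, if nonnegative, gives a
nonnegative element of `E`. -/
theorem exists_nonneg_of_dominated {u : α → ℝ} (hu : Measurable u) (h0 : ∀ a, 0 ≤ u a) (g : E)
    (h : ∀ a, u a ≤ ‖g a‖) :
    ∃ f : E, 0 ≤ f ∧ (∀ᵐ a ∂μ, f a = ((u a : ℝ) : 𝕜)) ∧ ‖f‖ ≤ ‖g‖ := by
  obtain ⟨f, hf, hn⟩ := exists_of_dominated (E := E) (u := fun a => ((u a : ℝ) : 𝕜))
    (RCLike.continuous_ofReal.measurable.comp hu).aestronglyMeasurable g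
    (ae_of_all _ fun a => by rw [RCLike.norm_ofReal, abs_of_nonneg (h0 a)]; exact h a)
  refine ⟨f, ?_, hf, hn⟩
  rw [Elem.nonneg_iff_ae]
  filter_upwards [hf] with a h
  rw [h]; exact RCLike.ofReal_nonneg.2 (h0 a)

/-- Every element is a combination of four nonnegative elements. -/
theorem exists_decomp (f : E) : ∃ p n q r : E, (0 ≤ p ∧ 0 ≤ n ∧ 0 ≤ q ∧ 0 ≤ r) ∧
    (‖p‖ ≤ ‖f‖ ∧ ‖n‖ ≤ ‖f‖ ∧ ‖q‖ ≤ ‖f‖ ∧ ‖r‖ ≤ ‖f‖) ∧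
    f = p - n + (RCLike.I : 𝕜) • (q - r) ∧
    (∀ᵐ a ∂μ, p a = ((max (RCLike.re (f a)) 0 : ℝ) : 𝕜)) ∧
    ∀ᵐ a ∂μ, n a = ((max (-RCLike.re (f a)) 0 : ℝ) : 𝕜) := by
  have hre : Measurable fun a => RCLike.re (f a) :=
    RCLike.continuous_re.measurable.comp f.measurable
  have him : Measurable fun a => RCLike.im (f a) :=
    RCLike.continuous_im.measurable.comp f.measurable
  obtain ⟨p, hp0, hp, hpn⟩ := exists_nonneg_of_dominated (E := E) (hre.max measurable_const)
    (fun a => le_max_right _ 0) f fun a => max_le (RCLike.re_le_norm _) (norm_nonneg _)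
  obtain ⟨n, hn0, hn, hnn⟩ := exists_nonneg_of_dominated (E := E) (hre.neg.max measurable_const)
    (fun a => le_max_right _ 0) f fun a => max_le
      ((neg_le_abs _).trans (RCLike.abs_re_le_norm _)) (norm_nonneg _)
  obtain ⟨q, hq0, hq, hqn⟩ := exists_nonneg_of_dominated (E := E) (him.max measurable_const)
    (fun a => le_max_right _ 0) f fun a => max_le (RCLike.im_le_norm _) (norm_nonneg _)
  obtain ⟨r, hr0, hr, hrn⟩ := exists_nonneg_of_dominated (E := E) (him.neg.max measurable_const)
    (fun a => le_max_right _ 0) f fun a => max_le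
      ((neg_le_abs _).trans (RCLike.abs_im_le_norm _)) (norm_nonneg _)
  refine ⟨p, n, q, r, ⟨hp0, hn0, hq0, hr0⟩, ⟨hpn, hnn, hqn, hrn⟩, ?_, hp, hn⟩
  refine Elem.ext_ae ?_
  filter_upwards [hp, hn, hq, hr, Elem.coe_add (p - n) ((RCLike.I : 𝕜) • (q - r)),
    Elem.coe_sub p n, Elem.coe_sub q r, Elem.coe_smul (RCLike.I : 𝕜) (q - r)]
    with a h1 h2 h3 h4 h5 h6 h7 h8
  rw [h5, h6, h8, h7, h1, h2, h3, h4, ← RCLike.ofReal_sub, ← RCLike.ofReal_sub]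
  have key (x : ℝ) : max x 0 - max (-x) 0 = x := by
    exact max_zero_sub_max_neg_zero_eq_self x
  simp only [Pi.neg_apply]
  rw [key, key, mul_comm, RCLike.re_add_im]

end Decomposition

end BanachFunctionSpace

/-! ### Positive and dominated operators -/

section Positive

variable {𝕜 : Type*} [RCLike 𝕜] {α β : Type*} [MeasurableSpace α] [MeasurableSpace β]
  {μ : Measure α} {ν : Measure β} {E : BanachFunctionSpace 𝕜 μ} {G : BanachFunctionSpace 𝕜 ν}

theorem isPositiveOp_iff {R : E →L[𝕜] G} : IsPositiveOp R ↔ ∀ f : E, 0 ≤ f → 0 ≤ R f := by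
  simp only [IsPositiveOp, isNonneg_iff]

theorem IsPositiveOp.map_nonneg {R : E →L[𝕜] G} (hR : IsPositiveOp R) {f : E} (hf : 0 ≤ f) :
    0 ≤ R f := isPositiveOp_iff.1 hR f hf

theorem IsPositiveOp.mono {R : E →L[𝕜] G} (hR : IsPositiveOp R) {f g : E} (h : f ≤ g) :
    R f ≤ R g := by
  have := hR.map_nonneg (sub_nonneg.2 h)
  rwa [map_sub, sub_nonneg] at this

/-- Here f = p + i(q − r) with p, q, r ≥ 0. The images of q and r are real, so only R p contributes
to the real part. -/
theorem IsPositiveOp.re_nonneg {R : E →L[𝕜] G} (hR : IsPositiveOp R) {f : E}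
    (hf : ∀ᵐ a ∂μ, 0 ≤ RCLike.re (f a)) : ∀ᵐ b ∂ν, 0 ≤ RCLike.re (R f b) := by
  obtain ⟨p, n, q, r, ⟨hp, -, hq, hr⟩, -, hf', -, hn⟩ := exists_decomp f
  have hn0 : n = 0 := by
    refine Elem.ext_ae ?_
    filter_upwards [hf, hn, Elem.coe_zero (E := E)] with a h1 h2 h3
    rw [h2, h3, max_eq_right (by linarith), RCLike.ofReal_zero]
  rw [hn0, sub_zero] at hf'
  rw [hf', map_add, map_smul, map_sub]
  filter_upwards [Elem.coe_add (R p) ((RCLike.I : 𝕜) • (R q - R r)),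
    Elem.coe_smul (RCLike.I : 𝕜) (R q - R r), Elem.coe_sub (R q) (R r),
    Elem.nonneg_iff_ae.1 (hR.map_nonneg hp), Elem.nonneg_iff_ae.1 (hR.map_nonneg hq),
    Elem.nonneg_iff_ae.1 (hR.map_nonneg hr)] with b h1 h2 h3 h4 h5 h6
  rw [RCLike.nonneg_iff] at h4 h5 h6
  rw [h1, h2, h3]
  simp [h4.1, h5.2, h6.2]

/-- The inequality extends to all c by density, and c = conj z gives |z|² ≤ |z| M. Only countably
many c are tested, so that each may carry its own null set. -/
theorem norm_le_of_dense_re_le {z : 𝕜} {M : ℝ} (hM : 0 ≤ M)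
    (h : ∀ n, RCLike.re (TopologicalSpace.denseSeq 𝕜 n * z) ≤
      ‖TopologicalSpace.denseSeq 𝕜 n‖ * M) : ‖z‖ ≤ M := by
  have hall (c : 𝕜) : RCLike.re (c * z) ≤ ‖c‖ * M := by
    have hc : IsClosed {c : 𝕜 | RCLike.re (c * z) ≤ ‖c‖ * M} :=
      isClosed_le (RCLike.continuous_re.comp (continuous_id.mul continuous_const))
        (continuous_norm.mul continuous_const)
    have hd : closure (Set.range (TopologicalSpace.denseSeq 𝕜)) ⊆
        {c : 𝕜 | RCLike.re (c * z) ≤ ‖c‖ * M} :=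
      closure_minimal (by rintro _ ⟨n, rfl⟩; exact h n) hc
    rw [(TopologicalSpace.denseRange_denseSeq 𝕜).closure_range] at hd
    exact hd (Set.mem_univ c)
  have := hall (starRingEnd 𝕜 z)
  rw [RCLike.conj_mul, RCLike.norm_conj, ← RCLike.ofReal_pow, RCLike.ofReal_re] at this
  rcases (norm_nonneg z).eq_or_lt with h0 | h0
  · rwa [← h0]
  · nlinarith

/-- For fixed c the function |c||f| − c f has nonnegative real part, and R preserves this. Countably
many c recover the modulus. -/
theorem IsPositiveOp.norm_le {R : E →L[𝕜] G} (hR : IsPositiveOp R) (f : E) :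
    ∀ᵐ b ∂ν, ‖R f b‖ ≤ RCLike.re (R f.abs b) := by
  have h1 (c : 𝕜) : ∀ᵐ b ∂ν, RCLike.re (c * R f b) ≤ ‖c‖ * RCLike.re (R f.abs b) := by
    have h2 : ∀ᵐ a ∂μ, 0 ≤ RCLike.re ((((‖c‖ : ℝ) : 𝕜) • f.abs - c • f) a) := by
      filter_upwards [Elem.coe_sub (((‖c‖ : ℝ) : 𝕜) • f.abs) (c • f), f.coe_abs,
        Elem.coe_smul ((‖c‖ : ℝ) : 𝕜) f.abs, Elem.coe_smul c f] with a e1 e2 e3 e4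
      rw [e1, e3, e4, e2, map_sub, ← RCLike.ofReal_mul, RCLike.ofReal_re, sub_nonneg, ← norm_mul]
      exact RCLike.re_le_norm _
    have h3 := hR.re_nonneg h2
    rw [map_sub, map_smul, map_smul] at h3
    filter_upwards [h3, Elem.coe_sub (((‖c‖ : ℝ) : 𝕜) • R f.abs) (c • R f),
      Elem.coe_smul ((‖c‖ : ℝ) : 𝕜) (R f.abs), Elem.coe_smul c (R f)] with b e1 e2 e3 e4
    rw [e2, e3, e4, map_sub, RCLike.re_ofReal_mul] at e1
    linarith
  filter_upwards [ae_all_iff.2 fun n => h1 (TopologicalSpace.denseSeq 𝕜 n),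
    Elem.nonneg_iff_ae.1 (hR.map_nonneg f.abs_nonneg)] with b h2 h3
  exact norm_le_of_dense_re_le (RCLike.nonneg_iff.1 h3).1 h2

theorem IsPositiveOp.isDominant_self {R : E →L[𝕜] G} (hR : IsPositiveOp R) : IsDominant R R :=
  ⟨hR, hR.norm_le⟩

theorem IsDominant.add {R R' T T' : E →L[𝕜] G} (h : IsDominant R T) (h' : IsDominant R' T') :
    IsDominant (R + R') (T + T') := by
  refine ⟨isPositiveOp_iff.2 fun f hf => add_nonneg (h.1.map_nonneg hf) (h'.1.map_nonneg hf),
    fun f => ?_⟩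
  filter_upwards [h.2 f, h'.2 f, Elem.coe_add (R f.abs) (R' f.abs), Elem.coe_add (T f) (T' f)]
    with b h1 h2 h3 h4
  rw [add_apply, add_apply, h3, h4, map_add]
  exact (norm_add_le _ _).trans (add_le_add h1 h2)

theorem IsDominant.smul {R T : E →L[𝕜] G} (h : IsDominant R T) (c : 𝕜) :
    IsDominant (((‖c‖ : ℝ) : 𝕜) • R) (c • T) := by
  refine ⟨isPositiveOp_iff.2 fun f hf =>
    Elem.smul_nonneg' (h.1.map_nonneg hf) (norm_nonneg c), fun f => ?_⟩
  filter_upwards [h.2 f, Elem.coe_smul ((‖c‖ : ℝ) : 𝕜) (R f.abs), Elem.coe_smul c (T f)]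
    with b h1 h2 h3
  rw [smul_apply, smul_apply, h2, h3,
    RCLike.re_ofReal_mul, norm_mul]
  gcongr

/-- A regular operator is dominated by a positive one. -/
theorem IsRegularOp.exists_isDominant {T : E →L[𝕜] G} (hT : IsRegularOp T) :
    ∃ R : E →L[𝕜] G, IsDominant R T := by
  refine Submodule.span_induction (p := fun T _ => ∃ R : E →L[𝕜] G, IsDominant R T)
    (fun R hR => ⟨R, IsPositiveOp.isDominant_self hR⟩) ?_ ?_ ?_ hT
  · refine ⟨0, IsPositiveOp.isDominant_self (isPositiveOp_iff.2 fun f _ => le_rfl)⟩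
  · rintro T T' - - ⟨R, hR⟩ ⟨R', hR'⟩
    exact ⟨_, hR.add hR'⟩
  · rintro c T - ⟨R, hR⟩
    exact ⟨_, hR.smul c⟩

end Positive

/-! ### Almost everywhere norm bounds through functionals -/

section Norming

variable {𝕜 : Type*} [RCLike 𝕜] {α : Type*} [MeasurableSpace α] {μ : Measure α}
  {X : Type*} [NormedAddCommGroup X] [NormedSpace 𝕜 X]

/-- The exceptional null set depends on l. Since g has separable range, functionals norming a
countable dense set suffice; replacing g(a) by a point x within ε/2 costs at most 2 · ε/2. -/
theorem ae_norm_le_of_forall_dual (𝕜 : Type*) [RCLike 𝕜] [NormedSpace 𝕜 X]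
    {g : α → X} (hg : StronglyMeasurable g) {M : α → ℝ}
    (hM : ∀ᵐ a ∂μ, 0 ≤ M a) (h : ∀ l : X →L[𝕜] 𝕜, ∀ᵐ a ∂μ, ‖l (g a)‖ ≤ ‖l‖ * M a) :
    ∀ᵐ a ∂μ, ‖g a‖ ≤ M a := by
  obtain ⟨c, hc, hcl⟩ := hg.isSeparable_range
  choose l hl1 hl2 using fun x : X => exists_dual_vector'' 𝕜 x
  have hall : ∀ᵐ a ∂μ, ∀ x ∈ c, ‖l x (g a)‖ ≤ ‖l x‖ * M a :=
    (ae_ball_iff hc).2 fun x _ => h (l x)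
  filter_upwards [hM, hall] with a h0 ha
  refine le_of_forall_pos_le_add fun ε hε => ?_
  obtain ⟨x, hx, hd⟩ := Metric.mem_closure_iff.1 (hcl ⟨a, rfl⟩) (ε / 2) (half_pos hε)
  rw [dist_eq_norm] at hd
  have e1 : ‖x‖ = ‖l x x‖ := by rw [hl2]; simp
  have e2 : ‖l x x‖ ≤ ‖l x (g a)‖ + ‖l x (g a - x)‖ := by
    rw [map_sub]
    have := norm_sub_le (l x (g a)) (l x (g a) - l x x)
    rwa [sub_sub_cancel] at this
  have e3 : ‖l x (g a - x)‖ ≤ ‖g a - x‖ := (l x).le_of_opNorm_le (hl1 x) _ |>.trans_eq (one_mul _)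
  have e4 : ‖g a‖ ≤ ‖x‖ + ‖g a - x‖ := by simpa using norm_add_le x (g a - x)
  have e5 : ‖l x‖ * M a ≤ M a := mul_le_of_le_one_left h0 (hl1 x)
  linarith [ha x hx]

end Norming

/-! ### Ampliations of an operator to vector-valued functions -/

section Ampliation

variable {𝕜 : Type*} [RCLike 𝕜] {α β : Type*} [MeasurableSpace α] [MeasurableSpace β]
  {μ : Measure α} {ν : Measure β} {E : BanachFunctionSpace 𝕜 μ} {G : BanachFunctionSpace 𝕜 ν}
  {X : Type*} [NormedAddCommGroup X] [NormedSpace 𝕜 X]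

/-- `ψ` is the image of `φ` under the ampliation of `S` to `X`-valued functions: this is so
after composition with every functional on `X`. -/
def IsAmpliation (S : E →L[𝕜] G) (φ : E.Bochner X) (ψ : G.Bochner X) : Prop :=
  ∀ l : X →L[𝕜] 𝕜, Bochner.dualComp l ψ = S (Bochner.dualComp l φ)

theorem isAmpliation_tmul (S : E →L[𝕜] G) (f : E) (x : X) :
    IsAmpliation S (tmul f x) (tmul (S f) x) := fun l => by
  rw [dualComp_tmul, dualComp_tmul, map_smul]

theorem IsAmpliation.add {S : E →L[𝕜] G} {φ φ' : E.Bochner X} {ψ ψ' : G.Bochner X}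
    (h : IsAmpliation S φ ψ) (h' : IsAmpliation S φ' ψ') :
    IsAmpliation S (φ + φ') (ψ + ψ') := fun l => by
  rw [map_add, map_add, map_add, h l, h' l]

theorem IsAmpliation.smul {S : E →L[𝕜] G} {φ : E.Bochner X} {ψ : G.Bochner X}
    (h : IsAmpliation S φ ψ) (c : 𝕜) : IsAmpliation S (c • φ) (c • ψ) := fun l => by
  rw [map_smul, map_smul, map_smul, h l]

theorem IsAmpliation.sub {S : E →L[𝕜] G} {φ φ' : E.Bochner X} {ψ ψ' : G.Bochner X}
    (h : IsAmpliation S φ ψ) (h' : IsAmpliation S φ' ψ') :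
    IsAmpliation S (φ - φ') (ψ - ψ') := fun l => by
  rw [map_sub, map_sub, map_sub, h l, h' l]

/-- For each functional, |l(ψ)| = |S(l ∘ φ)| ≤ R|l ∘ φ| ≤ ‖l‖ R|φ|_X a.e., and functionals determine
the norm. No construction of ψ enters. -/
theorem IsAmpliation.ae_norm_le {S R : E →L[𝕜] G} (hR : IsDominant R S) {φ : E.Bochner X}
    {ψ : G.Bochner X} (h : IsAmpliation S φ ψ) :
    ∀ᵐ b ∂ν, ‖ψ.toL0 b‖ ≤ RCLike.re (R φ.absE b) := by
  refine ae_norm_le_of_forall_dual 𝕜 ψ.stronglyMeasurable ?_ fun l => ?_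
  · filter_upwards [Elem.nonneg_iff_ae.1 (hR.1.map_nonneg φ.absE_nonneg)] with b hb
    exact (RCLike.nonneg_iff.1 hb).1
  · have h1 : (Bochner.dualComp l φ).abs ≤ ((‖l‖ : ℝ) : 𝕜) • φ.absE := by
      refine Elem.le_of_norm_le (Elem.abs_nonneg _)
        (Elem.smul_nonneg' φ.absE_nonneg (norm_nonneg _)) ?_
      filter_upwards [(Bochner.dualComp l φ).norm_coe_abs, Bochner.coe_dualComp l φ,
        Elem.coe_smul ((‖l‖ : ℝ) : 𝕜) φ.absE, φ.norm_coe_absE] with a e1 e2 e3 e4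
      rw [e1, e2, e3, norm_mul, e4, RCLike.norm_ofReal, abs_norm]
      exact l.le_opNorm _
    have h2 := hR.1.mono h1
    rw [map_smul] at h2
    filter_upwards [hR.2 (Bochner.dualComp l φ), Elem.le_iff_ae.1 h2,
      Elem.coe_smul ((‖l‖ : ℝ) : 𝕜) (R φ.absE), Bochner.coe_dualComp l ψ] with b e1 e2 e3 e4
    rw [← h l, e4] at e1
    refine e1.trans ((RCLike.le_iff_re_im.1 e2).1.trans_eq ?_)
    rw [e3, RCLike.re_ofReal_mul]

theorem IsAmpliation.norm_le {S R : E →L[𝕜] G} (hR : IsDominant R S) {φ : E.Bochner X}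
    {ψ : G.Bochner X} (h : IsAmpliation S φ ψ) : ‖ψ‖ ≤ ‖R‖ * ‖φ‖ := by
  refine le_trans (Bochner.norm_le_of_ae (g := R φ.absE) ?_) (R.le_opNorm φ.absE)
  filter_upwards [h.ae_norm_le hR] with b hb
  exact hb.trans (RCLike.re_le_norm _)

/-- Every functional annihilates the difference a.e., so the norming argument applies with bound 0;
no dominant is needed. -/
theorem IsAmpliation.unique {S : E →L[𝕜] G} {φ : E.Bochner X} {ψ ψ' : G.Bochner X}
    (h : IsAmpliation S φ ψ) (h' : IsAmpliation S φ ψ') : ψ = ψ' := by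
  rw [← sub_eq_zero]
  refine Bochner.ext_ae ?_
  have := ae_norm_le_of_forall_dual 𝕜 (μ := ν) (ψ - ψ').stronglyMeasurable (M := fun _ => 0)
    (ae_of_all _ fun _ => le_rfl) fun l => by
      have e : Bochner.dualComp l (ψ - ψ') = 0 := by rw [map_sub, h l, h' l, sub_self]
      filter_upwards [Bochner.coe_dualComp l (ψ - ψ'), Elem.coe_zero (E := G)] with b e1 e2
      rw [← e1, e, e2]; simp
  filter_upwards [this, Bochner.coe_zero (E := G) (X := X)] with b e1 e2
  rw [e2]; exact norm_le_zero_iff.1 e1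

/-- The functions to which the ampliation of `S` applies. -/
def ampliationDomain (S : E →L[𝕜] G) (X : Type*) [NormedAddCommGroup X] [NormedSpace 𝕜 X] :
    Submodule 𝕜 (E.Bochner X) where
  carrier := {φ | ∃ ψ : G.Bochner X, IsAmpliation S φ ψ}
  add_mem' := by rintro φ φ' ⟨ψ, h⟩ ⟨ψ', h'⟩; exact ⟨_, h.add h'⟩
  zero_mem' := ⟨0, fun l => by simp⟩
  smul_mem' := by rintro c φ ⟨ψ, h⟩; exact ⟨_, h.smul c⟩

/-- Domination makes φ ↦ ψ Lipschitz with constant ‖R‖, so the images of a convergent sequence are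
Cauchy; the defining relation passes to limits because both of its sides are continuous. -/
theorem isClosed_ampliationDomain [CompleteSpace X] {S R : E →L[𝕜] G} (hR : IsDominant R S) :
    IsClosed (ampliationDomain S X : Set (E.Bochner X)) := by
  refine isClosed_of_closure_subset fun φ hφ => ?_
  obtain ⟨u, hu, hlim⟩ := mem_closure_iff_seq_limit.1 hφ
  choose w hw using hu
  have hC : CauchySeq w := by
    rw [Metric.cauchySeq_iff]
    intro ε hε
    obtain ⟨N, hN⟩ := Metric.cauchySeq_iff.1 hlim.cauchySeq (ε / (‖R‖ + 1)) (by positivity)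
    refine ⟨N, fun m hm n hn => ?_⟩
    rw [dist_eq_norm]
    have h1 := ((hw m).sub (hw n)).norm_le hR
    have h2 := hN m hm n hn
    rw [dist_eq_norm, lt_div_iff₀ (by positivity)] at h2
    nlinarith [norm_nonneg (u m - u n)]
  obtain ⟨ψ, hψ⟩ := cauchySeq_tendsto_of_complete hC
  refine ⟨ψ, fun l => ?_⟩
  refine tendsto_nhds_unique (((Bochner.dualComp l).continuous.tendsto _).comp hψ) ?_
  have : (Bochner.dualComp l ∘ w : ℕ → G) = fun n => S (Bochner.dualComp l (u n)) :=
    funext fun n => hw n l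
  rw [this]
  exact ((S.continuous.comp (Bochner.dualComp l).continuous).tendsto _).comp hlim

theorem tensor_le_ampliationDomain [CompleteSpace X] {S R : E →L[𝕜] G} (hR : IsDominant R S) :
    E.tensor X ≤ ampliationDomain S X := by
  refine Submodule.topologicalClosure_minimal _ (Submodule.span_le.2 ?_)
    (isClosed_ampliationDomain hR)
  rintro _ ⟨f, x, rfl⟩
  exact ⟨_, isAmpliation_tmul S f x⟩

/-- The ampliation of a dominated operator to a subspace of its domain. -/
theorem exists_ampliation {S R : E →L[𝕜] G} (hR : IsDominant R S)
    {V : Submodule 𝕜 (E.Bochner X)} (hV : V ≤ ampliationDomain S X) :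
    ∃ U : V →L[𝕜] G.Bochner X, ∀ φ : V, IsAmpliation S φ.1 (U φ) := by
  -- Arbitrary choices are automatically linear, by uniqueness of ampliations.
  choose u hu using fun φ : V => hV φ.2
  exact ⟨LinearMap.mkContinuous
    { toFun := u
      map_add' := fun φ φ' => (hu (φ + φ')).unique ((hu φ).add (hu φ'))
      map_smul' := fun c φ => (hu (c • φ)).unique ((hu φ).smul c) } ‖R‖
    fun φ => (hu φ).norm_le hR, hu⟩

end Ampliation

/-! ### Linear extension from the positive cone -/

section Cone

variable {𝕜 : Type*} [RCLike 𝕜] {α β : Type*} [MeasurableSpace α] [MeasurableSpace β]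
  {μ : Measure α} {ν : Measure β} {E : BanachFunctionSpace 𝕜 μ} {G : BanachFunctionSpace 𝕜 ν}

theorem BanachFunctionSpace.linear_ext_cone {V : Type*} [AddCommGroup V] [Module 𝕜 V]
    {L L' : E →ₗ[𝕜] V} (h : ∀ f : E, 0 ≤ f → L f = L' f) : L = L' := by
  ext f
  obtain ⟨p, n, q, r, ⟨hp, hn, hq, hr⟩, -, hf, -⟩ := exists_decomp f
  rw [hf]
  simp only [map_add, map_sub, map_smul, h _ hp, h _ hn, h _ hq, h _ hr]

/-- An additive and positively homogeneous map on the nonnegative cone extends linearly. -/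
theorem BanachFunctionSpace.exists_linear_extension {V : Type*} [AddCommGroup V] [Module 𝕜 V]
    (q : E → V) (hadd : ∀ f g : E, 0 ≤ f → 0 ≤ g → q (f + g) = q f + q g)
    (hsmul : ∀ r : ℝ, 0 ≤ r → ∀ f : E, 0 ≤ f → q ((r : 𝕜) • f) = (r : 𝕜) • q f) :
    ∃ L : E →ₗ[𝕜] V, ∀ f : E, 0 ≤ f → L f = q f := by
  have hq0 : q 0 = 0 := by simpa using hsmul 0 le_rfl 0 le_rfl
  choose p n _ _ hpos _ _ hp hn using fun f : E => exists_decomp f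
  have hpn (f : E) : ∀ᵐ a ∂μ, RCLike.re (f a) = RCLike.re (p f a) - RCLike.re (n f a) := by
    filter_upwards [hp f, hn f] with a h1 h2
    rw [h1, h2, RCLike.ofReal_re, RCLike.ofReal_re]
    exact (max_zero_sub_max_neg_zero_eq_self _).symm
  -- `D` is the real-linear extension, evaluated at Re f. By `key` it may be computed from any
  -- representation of Re f as a difference of nonnegative elements.
  set D : E → V := fun f => q (p f) - q (n f) with hD
  have key (f u v : E) (hu : 0 ≤ u) (hv : 0 ≤ v)
      (h : ∀ᵐ a ∂μ, RCLike.re (f a) = RCLike.re (u a) - RCLike.re (v a)) :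
      D f = q u - q v := by
    have e : p f + v = u + n f := by
      refine Elem.ext_ae ?_
      filter_upwards [h, hpn f, Elem.coe_add (p f) v, Elem.coe_add u (n f),
        Elem.nonneg_iff_ae.1 hu, Elem.nonneg_iff_ae.1 hv, Elem.nonneg_iff_ae.1 (hpos f).1,
        Elem.nonneg_iff_ae.1 (hpos f).2.1] with a h1 h2 h3 h4 h5 h6 h7 h8
      rw [RCLike.nonneg_iff] at h5 h6 h7 h8
      rw [h3, h4]
      refine RCLike.ext ?_ ?_
      · simp only [map_add]; linarith
      · simp only [map_add]; linarith [h5.2, h6.2, h7.2, h8.2]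
    have e2 := congrArg q e
    rw [hadd _ _ (hpos f).1 hv, hadd _ _ hu (hpos f).2.1] at e2
    exact sub_eq_sub_iff_add_eq_add.2 e2
  have Dadd (f g : E) : D (f + g) = D f + D g := by
    rw [key (f + g) (p f + p g) (n f + n g) (add_nonneg (hpos f).1 (hpos g).1)
      (add_nonneg (hpos f).2.1 (hpos g).2.1), hadd _ _ (hpos f).1 (hpos g).1,
      hadd _ _ (hpos f).2.1 (hpos g).2.1]
    · simp only [hD]; abel
    · filter_upwards [hpn f, hpn g, Elem.coe_add f g, Elem.coe_add (p f) (p g),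
        Elem.coe_add (n f) (n g)] with a h1 h2 h3 h4 h5
      rw [h3, h4, h5]; simp only [map_add]; linarith
  have Dneg (f : E) : D (-f) = - D f := by
    rw [key (-f) (n f) (p f) (hpos f).2.1 (hpos f).1]
    · simp only [hD]; abel
    · filter_upwards [hpn f, Elem.coe_neg f] with a h1 h2
      rw [h2, map_neg]; linarith
  have Dsmul0 (r : ℝ) (hr : 0 ≤ r) (f : E) : D ((r : 𝕜) • f) = (r : 𝕜) • D f := by
    rw [key ((r : 𝕜) • f) ((r : 𝕜) • p f) ((r : 𝕜) • n f) (Elem.smul_nonneg' (hpos f).1 hr)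
      (Elem.smul_nonneg' (hpos f).2.1 hr), hsmul r hr _ (hpos f).1, hsmul r hr _ (hpos f).2.1,
      hD, smul_sub]
    filter_upwards [hpn f, Elem.coe_smul (r : 𝕜) f, Elem.coe_smul (r : 𝕜) (p f),
      Elem.coe_smul (r : 𝕜) (n f)] with a h1 h2 h3 h4
    rw [h2, h3, h4]; simp only [RCLike.re_ofReal_mul]; rw [h1]; ring
  have Dsmul (r : ℝ) (f : E) : D ((r : 𝕜) • f) = (r : 𝕜) • D f := by
    rcases le_total 0 r with hr | hr
    · exact Dsmul0 r hr f
    · have := Dsmul0 (-r) (by linarith) f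
      rw [RCLike.ofReal_neg, neg_smul, Dneg, neg_smul, neg_inj] at this
      exact this
  -- Complexification: Re(i f) = −Im f, so this is D(Re f) + i D(Im f). Over ℝ, where `I = 0`, the
  -- second term vanishes.
  set L : E → V := fun f => D f - (RCLike.I : 𝕜) • D ((RCLike.I : 𝕜) • f) with hL
  have Ladd (f g : E) : L (f + g) = L f + L g := by
    simp only [hL, smul_add, Dadd]; abel
  have Lreal (r : ℝ) (f : E) : L ((r : 𝕜) • f) = (r : 𝕜) • L f := by
    simp only [hL, smul_comm (RCLike.I : 𝕜) (r : 𝕜) f, Dsmul, smul_sub]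
    rw [smul_comm]
  have D0 : D 0 = 0 := by simpa using Dsmul 0 0
  have LI (f : E) : L ((RCLike.I : 𝕜) • f) = (RCLike.I : 𝕜) • L f := by
    rcases RCLike.I_mul_I (K := 𝕜) with h | h
    · simp only [hL, h, zero_smul, D0, sub_zero]
    · simp only [hL, smul_sub, smul_smul, h, neg_smul, one_smul, Dneg, smul_neg]
      abel
  refine ⟨{ toFun := L, map_add' := Ladd, map_smul' := fun c f => ?_ }, fun f hf => ?_⟩
  · rw [RingHom.id_apply]
    conv_lhs => rw [← RCLike.re_add_im c]
    conv_rhs => rw [← RCLike.re_add_im c]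
    rw [add_smul, add_smul, Ladd, Lreal, mul_smul, mul_smul, Lreal, LI]
  · show L f = q f
    have h1 : D f = q f := by
      rw [key f f 0 hf le_rfl, hq0, sub_zero]
      filter_upwards [Elem.coe_zero (E := E)] with a h
      rw [h]; simp
    have h2 : D ((RCLike.I : 𝕜) • f) = 0 := by
      rw [key _ 0 0 le_rfl le_rfl, sub_self]
      filter_upwards [Elem.coe_smul (RCLike.I : 𝕜) f, Elem.nonneg_iff_ae.1 hf] with a h1 h2
      rw [h1]; simp [(RCLike.nonneg_iff.1 h2).2]
    simp only [hL, h1, h2, smul_zero, sub_zero]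

end Cone

/-! ### Real and imaginary parts of an operator; regularity from a dominant -/

section Conj

variable {𝕜 : Type*} [RCLike 𝕜] {α β : Type*} [MeasurableSpace α] [MeasurableSpace β]
  {μ : Measure α} {ν : Measure β} {E : BanachFunctionSpace 𝕜 μ} {G : BanachFunctionSpace 𝕜 ν}

namespace BanachFunctionSpace

/-- Complex conjugation in `E`. -/
def Elem.conj (f : E) : E :=
  E.ofDominated (fun a => starRingEnd 𝕜 (f a))
    (RCLike.continuous_conj.measurable.comp f.measurable).aestronglyMeasurable f
    (ae_of_all _ fun _ => (RCLike.norm_conj _).le)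

theorem Elem.coe_conj (f : E) : ∀ᵐ a ∂μ, f.conj a = starRingEnd 𝕜 (f a) := coe_ofDominated _ _

theorem Elem.norm_conj (f : E) : ‖f.conj‖ = ‖f‖ := by
  refine Elem.norm_congr ?_
  filter_upwards [f.coe_conj] with a h
  rw [h, RCLike.norm_conj]

theorem Elem.conj_add (f g : E) : (f + g).conj = f.conj + g.conj := by
  refine Elem.ext_ae ?_
  filter_upwards [f.coe_conj, g.coe_conj, (f + g).coe_conj, Elem.coe_add f g,
    Elem.coe_add f.conj g.conj] with a h1 h2 h3 h4 h5
  rw [h3, h4, h5, h1, h2, map_add]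

theorem Elem.conj_smul (c : 𝕜) (f : E) : (c • f).conj = starRingEnd 𝕜 c • f.conj := by
  refine Elem.ext_ae ?_
  filter_upwards [f.coe_conj, (c • f).coe_conj, Elem.coe_smul c f,
    Elem.coe_smul (starRingEnd 𝕜 c) f.conj] with a h1 h3 h4 h5
  rw [h3, h4, h5, h1, map_mul]

theorem Elem.conj_of_nonneg {f : E} (hf : 0 ≤ f) : f.conj = f := by
  refine Elem.ext_ae ?_
  filter_upwards [f.coe_conj, Elem.coe_eq_norm hf] with a h1 h2
  rw [h1, h2, RCLike.conj_ofReal]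

end BanachFunctionSpace

/-- The conjugate operator `f ↦ conj (S (conj f))`. -/
def conjOp (S : E →L[𝕜] G) : E →L[𝕜] G :=
  LinearMap.mkContinuous
    { toFun := fun f => (S f.conj).conj
      map_add' := fun f g => by rw [Elem.conj_add, map_add, Elem.conj_add]
      map_smul' := fun c f => by
        rw [Elem.conj_smul, map_smul, Elem.conj_smul, RCLike.conj_conj, RingHom.id_apply] }
    ‖S‖ fun f => by
      show ‖(S f.conj).conj‖ ≤ _
      rw [Elem.norm_conj]
      exact (S.le_opNorm _).trans_eq (by rw [Elem.norm_conj])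

theorem conjOp_apply (S : E →L[𝕜] G) (f : E) : conjOp S f = (S f.conj).conj := rfl

/-- An operator that is dominated by a positive operator on the nonnegative cone is regular. -/
theorem isRegularOp_of_abs_le {S L : E →L[𝕜] G} (hL : ∀ f : E, 0 ≤ f → (S f).abs ≤ L f) :
    IsRegularOp S := by
  -- On the cone, `A f` and `B f` are the real and imaginary parts of `S f`, both at most |S f| ≤ L
  -- f. So L − A and L − B are positive, and S = A + iB is a combination of L and these two.
  set A : E →L[𝕜] G := (2⁻¹ : 𝕜) • (S + conjOp S) with hA
  set B : E →L[𝕜] G := (-(RCLike.I : 𝕜) * 2⁻¹) • (S - conjOp S) with hB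
  have hAf (f : E) (hf : 0 ≤ f) : ∀ᵐ b ∂ν, A f b = ((RCLike.re (S f b) : ℝ) : 𝕜) := by
    have e : A f = (2⁻¹ : 𝕜) • (S f + (S f).conj) := by
      simp only [hA, smul_apply, add_apply, conjOp_apply, Elem.conj_of_nonneg hf]
    rw [e]
    filter_upwards [Elem.coe_smul (2⁻¹ : 𝕜) (S f + (S f).conj), Elem.coe_add (S f) (S f).conj,
      (S f).coe_conj] with b h1 h2 h3
    rw [h1, h2, h3, RCLike.add_conj, inv_mul_cancel_left₀ two_ne_zero]
  have hBf (f : E) (hf : 0 ≤ f) : ∀ᵐ b ∂ν, B f b = ((RCLike.im (S f b) : ℝ) : 𝕜) := by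
    have e : B f = (-(RCLike.I : 𝕜) * 2⁻¹) • (S f - (S f).conj) := by
      simp only [hB, smul_apply, sub_apply, conjOp_apply, Elem.conj_of_nonneg hf]
    rw [e]
    filter_upwards [Elem.coe_smul (-(RCLike.I : 𝕜) * 2⁻¹) (S f - (S f).conj),
      Elem.coe_sub (S f) (S f).conj, (S f).coe_conj] with b h1 h2 h3
    rw [h1, h2, h3, RCLike.im_eq_conj_sub]
    ring
  have hdom (C : E →L[𝕜] G) (c : 𝕜 → ℝ) (hc : ∀ z, c z ≤ ‖z‖)
      (hC : ∀ f : E, 0 ≤ f → ∀ᵐ b ∂ν, C f b = ((c (S f b) : ℝ) : 𝕜)) : IsPositiveOp (L - C) := by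
    refine isPositiveOp_iff.2 fun f hf => ?_
    rw [sub_apply, sub_nonneg]
    refine le_trans (Elem.le_iff_ae.2 ?_) (hL f hf)
    filter_upwards [hC f hf, (S f).coe_abs] with b h1 h2
    rw [h1, h2]
    exact RCLike.ofReal_le_ofReal.2 (hc _)
  have hLpos : IsPositiveOp L := isPositiveOp_iff.2 fun f hf => (Elem.abs_nonneg _).trans (hL f hf)
  have hSAB : S = (L - (L - A)) + (RCLike.I : 𝕜) • (L - (L - B)) := by
    rw [sub_sub_cancel, sub_sub_cancel]
    refine ContinuousLinearMap.coe_injective (linear_ext_cone fun f hf => ?_)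
    refine Elem.ext_ae ?_
    show ∀ᵐ b ∂ν, S f b = (A f + (RCLike.I : 𝕜) • B f) b
    filter_upwards [hAf f hf, hBf f hf, Elem.coe_add (A f) ((RCLike.I : 𝕜) • B f),
      Elem.coe_smul (RCLike.I : 𝕜) (B f)] with b h1 h2 h3 h4
    rw [h3, h4, h1, h2, mul_comm, RCLike.re_add_im]
  have hmem {R : E →L[𝕜] G} (hR : IsPositiveOp R) :
      R ∈ Submodule.span 𝕜 {R : E →L[𝕜] G | IsPositiveOp R} := Submodule.subset_span hR
  have h1 := hmem (hdom A (fun z => RCLike.re z) RCLike.re_le_norm hAf)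
  have h2 := hmem (hdom B (fun z => RCLike.im z) RCLike.im_le_norm hBf)
  rw [IsRegularOp, hSAB]
  exact add_mem (sub_mem (hmem hLpos) h1) (Submodule.smul_mem _ _ (sub_mem (hmem hLpos) h2))

end Conj

/-! ### Partitions of unity and the Kantorovich formula -/

section Kantorovich

/-- A finite measurable partition of unity. -/
structure FinitePartition (α : Type*) [MeasurableSpace α] where
  ι : Type
  [fintype : Fintype ι]
  toFun : ι → α → ℝ
  measurable : ∀ i, Measurable (toFun i)
  nonneg : ∀ i a, 0 ≤ toFun i a
  sum_eq_one : ∀ a, ∑ i, toFun i a = 1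

attribute [instance] FinitePartition.fintype

namespace FinitePartition

variable {α : Type*} [MeasurableSpace α]

theorem le_one (Θ : FinitePartition α) (i : Θ.ι) (a : α) : Θ.toFun i a ≤ 1 := by
  rw [← Θ.sum_eq_one a]
  exact Finset.single_le_sum (f := fun i => Θ.toFun i a) (fun j _ => Θ.nonneg j a)
    (Finset.mem_univ i)

/-- The partition into one piece. -/
def trivial : FinitePartition α where
  ι := Unit
  toFun _ _ := 1
  measurable _ := measurable_const
  nonneg _ _ := zero_le_one
  sum_eq_one a := by simp

/-- The partition into a function and its complement. -/
def pair (θ : α → ℝ) (hm : Measurable θ) (h0 : ∀ a, 0 ≤ θ a) (h1 : ∀ a, θ a ≤ 1) :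
    FinitePartition α where
  ι := Bool
  toFun i a := if i then θ a else 1 - θ a
  measurable i := by
    cases i
    · simp only [Bool.false_eq_true, if_false]
      exact measurable_const.sub hm
    · simpa using hm
  nonneg i a := by cases i <;> simp [h0 a, h1 a]
  sum_eq_one a := by simp

/-- The common refinement of two partitions. -/
def mul (Θ Θ' : FinitePartition α) : FinitePartition α where
  ι := Θ.ι × Θ'.ι
  toFun i a := Θ.toFun i.1 a * Θ'.toFun i.2 a
  measurable i := (Θ.measurable i.1).mul (Θ'.measurable i.2)
  nonneg i a := mul_nonneg (Θ.nonneg _ a) (Θ'.nonneg _ a)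
  sum_eq_one a := by
    rw [Fintype.sum_prod_type]
    simp only [← Finset.mul_sum, Θ'.sum_eq_one, mul_one, Θ.sum_eq_one]

variable {𝕜 : Type*} [RCLike 𝕜] {μ : Measure α} {E : BanachFunctionSpace 𝕜 μ}

/-- The piece `θ_i f` of an element `f` of `E`. -/
def piece (Θ : FinitePartition α) (f : E) (i : Θ.ι) : E :=
  E.mulFun (fun a => ((Θ.toFun i a : ℝ) : 𝕜)) f

theorem measurable_coe (Θ : FinitePartition α) (i : Θ.ι) :
    Measurable fun a => ((Θ.toFun i a : ℝ) : 𝕜) :=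
  RCLike.continuous_ofReal.measurable.comp (Θ.measurable i)

theorem norm_coe_le (Θ : FinitePartition α) (i : Θ.ι) (a : α) :
    ‖((Θ.toFun i a : ℝ) : 𝕜)‖ ≤ 1 := by
  rw [RCLike.norm_ofReal, abs_of_nonneg (Θ.nonneg i a)]; exact Θ.le_one i a

theorem coe_piece (Θ : FinitePartition α) (f : E) (i : Θ.ι) :
    ∀ᵐ a ∂μ, Θ.piece f i a = ((Θ.toFun i a : ℝ) : 𝕜) * f a :=
  coe_mulFun (Θ.measurable_coe i) (Θ.norm_coe_le i) f

theorem ae_coe_piece (Θ : FinitePartition α) (f : E) :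
    ∀ᵐ a ∂μ, ∀ i, Θ.piece f i a = ((Θ.toFun i a : ℝ) : 𝕜) * f a :=
  ae_all_iff.2 (Θ.coe_piece f)

theorem piece_add (Θ : FinitePartition α) (f g : E) (i : Θ.ι) :
    Θ.piece (f + g) i = Θ.piece f i + Θ.piece g i := by
  refine Elem.ext_ae ?_
  filter_upwards [Θ.coe_piece f i, Θ.coe_piece g i, Θ.coe_piece (f + g) i,
    Elem.coe_add (Θ.piece f i) (Θ.piece g i), Elem.coe_add f g] with a h1 h2 h3 h4 h5
  rw [h3, h4, h5, h1, h2, mul_add]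

theorem piece_smul (Θ : FinitePartition α) (c : 𝕜) (f : E) (i : Θ.ι) :
    Θ.piece (c • f) i = c • Θ.piece f i := by
  refine Elem.ext_ae ?_
  filter_upwards [Θ.coe_piece f i, Θ.coe_piece (c • f) i,
    Elem.coe_smul c (Θ.piece f i), Elem.coe_smul c f] with a h1 h2 h3 h4
  rw [h2, h3, h4, h1, mul_left_comm]

theorem piece_mul (Θ Θ' : FinitePartition α) (f : E) (i : Θ.ι) (j : Θ'.ι) :
    (Θ.mul Θ').piece f (i, j) = Θ'.piece (Θ.piece f i) j := by
  refine Elem.ext_ae ?_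
  filter_upwards [(Θ.mul Θ').coe_piece f (i, j), Θ.coe_piece f i,
    Θ'.coe_piece (Θ.piece f i) j] with a h1 h2 h3
  have h4 : (Θ.mul Θ').toFun (i, j) a = Θ.toFun i a * Θ'.toFun j a := rfl
  rw [h1, h3, h2, h4, RCLike.ofReal_mul]; ring

theorem piece_comm (Θ Θ' : FinitePartition α) (f : E) (i : Θ.ι) (j : Θ'.ι) :
    Θ'.piece (Θ.piece f i) j = Θ.piece (Θ'.piece f j) i := by
  refine Elem.ext_ae ?_
  filter_upwards [Θ.coe_piece f i, Θ'.coe_piece (Θ.piece f i) j, Θ'.coe_piece f j,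
    Θ.coe_piece (Θ'.piece f j) i] with a h1 h2 h3 h4
  rw [h2, h1, h4, h3]; ring

theorem sum_piece (Θ : FinitePartition α) (f : E) : ∑ i, Θ.piece f i = f := by
  refine Elem.ext_ae ?_
  filter_upwards [Elem.coe_sum Finset.univ (Θ.piece f), Θ.ae_coe_piece f] with a h1 h2
  rw [h1]
  simp only [h2, ← Finset.sum_mul, ← RCLike.ofReal_sum, Θ.sum_eq_one, RCLike.ofReal_one, one_mul]

/-- Two nonnegative elements are the pieces of their sum under some partition. -/
theorem exists_piece_pair {f g : E} (hf : 0 ≤ f) (hg : 0 ≤ g) :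
    ∃ Θ : FinitePartition α, ∃ e : Bool ≃ Θ.ι,
      Θ.piece (f + g) (e true) = f ∧ Θ.piece (f + g) (e false) = g := by
  -- Where both functions vanish the quotient is 0 by the convention for division, which is harmless
  -- there.
  have hm : Measurable fun a => ‖f a‖ / (‖f a‖ + ‖g a‖) :=
    f.measurable.norm.div (f.measurable.norm.add g.measurable.norm)
  set Θ := pair (fun a => ‖f a‖ / (‖f a‖ + ‖g a‖)) hm (fun a => by positivity)
    (fun a => div_le_one_of_le₀ (by linarith [norm_nonneg (g a)]) (by positivity)) with hΘ
  have h1 : Θ.piece (f + g) true = f := by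
    refine Elem.ext_ae ?_
    filter_upwards [Θ.coe_piece (f + g) true, Elem.coe_add f g, Elem.coe_eq_norm hf,
      Elem.coe_eq_norm hg] with a e1 e2 e3 e4
    rw [e1, e2]
    have : Θ.toFun true a * (‖f a‖ + ‖g a‖) = ‖f a‖ := by
      change ‖f a‖ / (‖f a‖ + ‖g a‖) * (‖f a‖ + ‖g a‖) = ‖f a‖
      refine div_mul_cancel_of_imp fun h => ?_
      linarith [norm_nonneg (f a), norm_nonneg (g a)]
    conv_lhs => rw [e3, e4, ← RCLike.ofReal_add, ← RCLike.ofReal_mul, this, ← e3]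
  have h2 : Θ.piece (f + g) true + Θ.piece (f + g) false = f + g := by
    refine Eq.trans ?_ (Θ.sum_piece (f + g))
    exact (Fintype.sum_bool (fun i : Bool => Θ.piece (f + g) i)).symm
  refine ⟨Θ, Equiv.refl _, h1, ?_⟩
  rw [h1] at h2
  exact add_left_cancel h2

end FinitePartition

variable {𝕜 : Type*} [RCLike 𝕜] {α β : Type*} [MeasurableSpace α] [MeasurableSpace β]
  {μ : Measure α} {ν : Measure β} {E : BanachFunctionSpace 𝕜 μ} {G : BanachFunctionSpace 𝕜 ν}

theorem BanachFunctionSpace.Elem.abs_add_le (f g : E) : (f + g).abs ≤ f.abs + g.abs := by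
  rw [Elem.le_iff_ae]
  filter_upwards [f.coe_abs, g.coe_abs, (f + g).coe_abs, Elem.coe_add f g,
    Elem.coe_add f.abs g.abs] with a h1 h2 h3 h4 h5
  rw [h3, h4, h5, h1, h2, ← RCLike.ofReal_add]
  exact RCLike.ofReal_le_ofReal.2 (norm_add_le _ _)

theorem BanachFunctionSpace.Elem.abs_smul (c : 𝕜) (f : E) :
    (c • f).abs = ((‖c‖ : ℝ) : 𝕜) • f.abs := by
  refine Elem.ext_ae ?_
  filter_upwards [f.coe_abs, (c • f).coe_abs, Elem.coe_smul c f,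
    Elem.coe_smul ((‖c‖ : ℝ) : 𝕜) f.abs] with a h1 h2 h3 h4
  rw [h2, h3, h4, h1, norm_mul, RCLike.ofReal_mul]

theorem BanachFunctionSpace.Elem.abs_sum_le {ι : Type*} (s : Finset ι) (f : ι → E) :
    (∑ i ∈ s, f i).abs ≤ ∑ i ∈ s, (f i).abs := by
  classical
  induction s using Finset.induction_on with
  | empty => simp [Elem.abs_of_nonneg (le_refl (0 : E))]
  | insert i s hi ih =>
    rw [Finset.sum_insert hi, Finset.sum_insert hi]
    exact (Elem.abs_add_le _ _).trans (by gcongr)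

/-- The sum `∑ |S (θ_i f)|` over a partition of unity. -/
def partitionSum (S : E →L[𝕜] G) (Θ : FinitePartition α) (f : E) : G :=
  ∑ i, (S (Θ.piece f i)).abs

theorem partitionSum_nonneg (S : E →L[𝕜] G) (Θ : FinitePartition α) (f : E) :
    0 ≤ partitionSum S Θ f := Finset.sum_nonneg fun _ _ => Elem.abs_nonneg _

theorem partitionSum_add_le (S : E →L[𝕜] G) (Θ : FinitePartition α) (f g : E) :
    partitionSum S Θ (f + g) ≤ partitionSum S Θ f + partitionSum S Θ g := by
  rw [partitionSum, partitionSum, partitionSum, ← Finset.sum_add_distrib]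
  refine Finset.sum_le_sum fun i _ => ?_
  rw [Θ.piece_add, map_add]
  exact Elem.abs_add_le _ _

theorem partitionSum_smul (S : E →L[𝕜] G) (Θ : FinitePartition α) {r : ℝ} (hr : 0 ≤ r) (f : E) :
    partitionSum S Θ ((r : 𝕜) • f) = (r : 𝕜) • partitionSum S Θ f := by
  rw [partitionSum, partitionSum, Finset.smul_sum]
  refine Finset.sum_congr rfl fun i _ => ?_
  rw [Θ.piece_smul, map_smul, Elem.abs_smul, RCLike.norm_ofReal, abs_of_nonneg hr]

/-- Splitting each piece further can only increase the sum, by the triangle inequality. With its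
mirror image this shows that the sums are directed. -/
theorem partitionSum_le_mul_left (S : E →L[𝕜] G) (Θ Θ' : FinitePartition α) (f : E) :
    partitionSum S Θ f ≤ partitionSum S (Θ.mul Θ') f := by
  have h : partitionSum S (Θ.mul Θ') f =
      ∑ i, ∑ j, (S (Θ'.piece (Θ.piece f i) j)).abs := by
    rw [partitionSum]
    refine (Fintype.sum_prod_type _).trans ?_
    simp only [FinitePartition.piece_mul]
  rw [h]
  refine Finset.sum_le_sum fun i _ => ?_
  conv_lhs => rw [← Θ'.sum_piece (Θ.piece f i), map_sum]
  exact Elem.abs_sum_le _ _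

theorem partitionSum_le_mul_right (S : E →L[𝕜] G) (Θ Θ' : FinitePartition α) (f : E) :
    partitionSum S Θ' f ≤ partitionSum S (Θ.mul Θ') f := by
  have h : partitionSum S (Θ.mul Θ') f =
      ∑ j, ∑ i, (S (Θ.piece (Θ'.piece f j) i)).abs := by
    rw [partitionSum]
    refine (Fintype.sum_prod_type_right _).trans ?_
    simp only [FinitePartition.piece_mul, FinitePartition.piece_comm Θ Θ']
  rw [h]
  refine Finset.sum_le_sum fun j _ => ?_
  conv_lhs => rw [← Θ.sum_piece (Θ'.piece f j), map_sum]
  exact Elem.abs_sum_le _ _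

/-- The Riesz decomposition step, source of superadditivity: a two-piece partition first separates f
+ g into f and g, then Θ cuts each of them. It requires partitions into functions rather than sets.
-/
theorem exists_partitionSum_add_le (S : E →L[𝕜] G) (Θ : FinitePartition α) {f g : E}
    (hf : 0 ≤ f) (hg : 0 ≤ g) :
    ∃ Θ', partitionSum S Θ f + partitionSum S Θ g = partitionSum S Θ' (f + g) := by
  obtain ⟨Ξ, e, h1, h2⟩ := FinitePartition.exists_piece_pair hf hg
  refine ⟨Ξ.mul Θ, ?_⟩
  have h : partitionSum S (Ξ.mul Θ) (f + g) =
      ∑ i, ∑ j, (S (Θ.piece (Ξ.piece (f + g) i) j)).abs := by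
    rw [partitionSum]
    refine (Fintype.sum_prod_type _).trans ?_
    simp only [FinitePartition.piece_mul]
  rw [h, ← e.sum_comp, Fintype.sum_bool, h1, h2]
  rfl

theorem abs_le_partitionSum_trivial (S : E →L[𝕜] G) (f : E) :
    (S f).abs ≤ partitionSum S FinitePartition.trivial f := by
  have := Elem.abs_sum_le Finset.univ
    fun i => S ((FinitePartition.trivial : FinitePartition α).piece f i)
  rwa [← map_sum, FinitePartition.sum_piece] at this

/-- If the sums over partitions have suprema, then these depend linearly on the element. -/
theorem exists_linear_of_isLUB (S : E →L[𝕜] G) (q : E → G)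
    (hq : ∀ f : E, 0 ≤ f → IsLUB (Set.range fun Θ => partitionSum S Θ f) (q f)) :
    ∃ L : E →ₗ[𝕜] G, ∀ f : E, 0 ≤ f → L f = q f := by
  have hle {f : E} (hf : 0 ≤ f) (Θ : FinitePartition α) : partitionSum S Θ f ≤ q f :=
    (hq f hf).1 ⟨Θ, rfl⟩
  have hlub {f : E} (hf : 0 ≤ f) {u : G} (h : ∀ Θ, partitionSum S Θ f ≤ u) : q f ≤ u :=
    (hq f hf).2 (by rintro _ ⟨Θ, rfl⟩; exact h Θ)
  have hadd (f g : E) (hf : 0 ≤ f) (hg : 0 ≤ g) : q (f + g) = q f + q g := by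
    refine le_antisymm (hlub (add_nonneg hf hg) fun Θ =>
      (partitionSum_add_le S Θ f g).trans (add_le_add (hle hf Θ) (hle hg Θ))) ?_
    rw [← le_sub_iff_add_le]
    refine hlub hf fun Θ => ?_
    rw [le_sub_comm]
    refine hlub hg fun Θ' => ?_
    rw [le_sub_iff_add_le, add_comm]
    -- The two suprema use unrelated partitions; both sums are first raised to the common
    -- refinement.
    obtain ⟨Ξ, hΞ⟩ := exists_partitionSum_add_le S (Θ.mul Θ') hf hg
    refine le_trans (add_le_add (partitionSum_le_mul_left S Θ Θ' f)
      (partitionSum_le_mul_right S Θ Θ' g)) ?_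
    rw [hΞ]
    exact hle (add_nonneg hf hg) Ξ
  have hq0 : q 0 = 0 := by
    have h0 (Θ : FinitePartition α) : partitionSum S Θ 0 = 0 := by
      simpa using partitionSum_smul S Θ le_rfl (0 : E)
    exact le_antisymm (hlub le_rfl fun Θ => (h0 Θ).le)
      ((h0 .trivial).ge.trans (hle le_rfl _))
  have hsm (r : ℝ) (hr : 0 < r) (f : E) (hf : 0 ≤ f) : q ((r : 𝕜) • f) ≤ (r : 𝕜) • q f := by
    refine hlub (Elem.smul_nonneg' hf hr.le) fun Θ => ?_
    rw [partitionSum_smul S Θ hr.le, ← sub_nonneg, ← smul_sub]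
    exact Elem.smul_nonneg' (sub_nonneg.2 (hle hf Θ)) hr.le
  have hsmul (r : ℝ) (hr : 0 ≤ r) (f : E) (hf : 0 ≤ f) : q ((r : 𝕜) • f) = (r : 𝕜) • q f := by
    rcases hr.eq_or_lt with rfl | hr
    · simp [hq0]
    refine le_antisymm (hsm r hr f hf) ?_
    -- The reverse inequality is the one already proved, for 1/r at r f.
    have h1 := hsm r⁻¹ (inv_pos.2 hr) _ (Elem.smul_nonneg' hf hr.le)
    have hr' : ((r : ℝ) : 𝕜) ≠ 0 := RCLike.ofReal_ne_zero.2 hr.ne'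
    rw [smul_smul, RCLike.ofReal_inv, inv_mul_cancel₀ hr', one_smul] at h1
    have h2 := Elem.smul_nonneg' (sub_nonneg.2 h1) hr.le
    rwa [smul_sub, smul_smul, mul_inv_cancel₀ hr', one_smul, sub_nonneg] at h2
  exact exists_linear_extension q hadd hsmul

/-- A linear map that dominates `S` on the cone and is bounded there makes `S` regular. -/
theorem isRegularOp_of_linear {S : E →L[𝕜] G} (L : E →ₗ[𝕜] G)
    (hL : ∀ f : E, 0 ≤ f → (S f).abs ≤ L f) (C : ℝ)
    (hC : ∀ f : E, 0 ≤ f → ‖L f‖ ≤ C * ‖f‖) : IsRegularOp S := by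
  -- One |C| for each of the four nonnegative parts of f, none of which exceeds f in norm.
  have hbd (f : E) : ‖L f‖ ≤ (4 * |C|) * ‖f‖ := by
    obtain ⟨p, n, u, v, ⟨hp, hn, hu, hv⟩, ⟨h1, h2, h3, h4⟩, hf, -⟩ := exists_decomp f
    have hb {g : E} (hg : 0 ≤ g) (h : ‖g‖ ≤ ‖f‖) : ‖L g‖ ≤ |C| * ‖f‖ := by
      exact (hC g hg).trans (mul_le_mul (le_abs_self C) h (norm_nonneg _) (abs_nonneg _))
    have hI : ‖(RCLike.I : 𝕜) • (L u - L v)‖ ≤ ‖L u - L v‖ := by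
      rw [norm_smul]
      refine mul_le_of_le_one_left (norm_nonneg _) ?_
      rcases RCLike.I_mul_I (K := 𝕜) with h | h
      · simp [h]
      · have := congrArg norm h
        rw [norm_mul, norm_neg, norm_one] at this
        nlinarith [norm_nonneg (RCLike.I : 𝕜)]
    have e : L f = L p - L n + (RCLike.I : 𝕜) • (L u - L v) := by
      conv_lhs => rw [hf]
      simp only [map_add, map_sub, map_smul]
    rw [e]
    linarith [norm_add_le (L p - L n) ((RCLike.I : 𝕜) • (L u - L v)), norm_sub_le (L p) (L n),
      norm_sub_le (L u) (L v), hb hp h1, hb hn h2, hb hu h3, hb hv h4]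
  exact isRegularOp_of_abs_le (L := L.mkContinuous _ hbd) hL

/-- If the sums over partitions have suprema, then the operator is regular. -/
theorem isRegularOp_of_isLUB (S : E →L[𝕜] G) (q : E → G)
    (hq : ∀ f : E, 0 ≤ f → IsLUB (Set.range fun Θ => partitionSum S Θ f) (q f)) (C : ℝ)
    (hC : ∀ f : E, 0 ≤ f → ‖q f‖ ≤ C * ‖f‖) : IsRegularOp S := by
  obtain ⟨L, hL⟩ := exists_linear_of_isLUB S q hq
  refine isRegularOp_of_linear L (fun f hf => ?_) C fun f hf => by rw [hL f hf]; exact hC f hf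
  rw [hL f hf]
  exact (abs_le_partitionSum_trivial S f).trans ((hq f hf).1 ⟨_, rfl⟩)

theorem directed_partitionSum (S : E →L[𝕜] G) (f : E) :
    Directed (· ≤ ·) fun Θ => partitionSum S Θ f := fun Θ Θ' =>
  ⟨Θ.mul Θ', partitionSum_le_mul_left S Θ Θ' f, partitionSum_le_mul_right S Θ Θ' f⟩

end Kantorovich

/-! ### The conjugate phase -/

section Phase

variable {𝕜 : Type*} [RCLike 𝕜]

/-- The conjugate phase of a scalar. -/
def conjPhase (z : 𝕜) : 𝕜 := starRingEnd 𝕜 z / ((‖z‖ : ℝ) : 𝕜)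

/-- At z = 0 the phase is 0, since 0/0 = 0, so the identity holds without exception while the phase
has modulus at most 1 rather than exactly 1. -/
theorem mul_conjPhase (z : 𝕜) : z * conjPhase z = ((‖z‖ : ℝ) : 𝕜) := by
  rcases eq_or_ne z 0 with rfl | hz
  · simp
  · have : ((‖z‖ : ℝ) : 𝕜) ≠ 0 := RCLike.ofReal_ne_zero.2 (norm_ne_zero_iff.2 hz)
    rw [conjPhase, ← mul_div_assoc, RCLike.mul_conj, sq, mul_div_assoc, div_self this, mul_one]

theorem norm_conjPhase_le (z : 𝕜) : ‖conjPhase z‖ ≤ 1 := by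
  rw [conjPhase, norm_div, RCLike.norm_conj, RCLike.norm_ofReal, abs_norm]
  exact div_self_le_one _

theorem measurable_conjPhase : Measurable (conjPhase : 𝕜 → 𝕜) :=
  RCLike.continuous_conj.measurable.div
    (RCLike.continuous_ofReal.measurable.comp measurable_norm)

end Phase

/-! ### Köthe pairings and the order they induce -/

section Pairing

variable {𝕜 : Type*} [RCLike 𝕜] {β : Type*} [MeasurableSpace β] {ν : Measure β}

/-- The product of `F` and `G` consists of integrable functions, with a norm bound. -/
structure IsBoundedPair (F G : BanachFunctionSpace 𝕜 ν) (C : ℝ) : Prop where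
  nonneg : 0 ≤ C
  integrable : ∀ (f : F) (g : G), Integrable (fun b => f b * g b) ν
  integral_le : ∀ (f : F) (g : G), ∫ b, ‖f b‖ * ‖g b‖ ∂ν ≤ C * ‖f‖ * ‖g‖

variable {F G : BanachFunctionSpace 𝕜 ν}

/-- Multiplying f by the conjugate phase of f g does not increase its norm, and turns the pairing
into ∫ |f||g|. So the bound on the bilinear form is a bound on the integral of absolute values. -/
theorem IsKotheDualPair.exists_isBoundedPair (h : IsKotheDualPair F G) :
    ∃ C, IsBoundedPair F G C := by
  obtain ⟨C, hC⟩ := h.bounded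
  refine ⟨|C|, abs_nonneg C, h.integrable, fun f g => ?_⟩
  set m : β → 𝕜 := fun b => conjPhase (f b * g b)
  have hm : Measurable m := measurable_conjPhase.comp (f.measurable.mul g.measurable)
  have hb : ∀ b, ‖m b‖ ≤ 1 := fun b => norm_conjPhase_le _
  have e : scalarPairing (F.mulFun m f).toL0 g.toL0 = ((∫ b, ‖f b‖ * ‖g b‖ ∂ν : ℝ) : 𝕜) := by
    rw [scalarPairing, ← integral_ofReal]
    refine integral_congr_ae ?_
    filter_upwards [coe_mulFun hm hb f] with b h
    rw [h, ← norm_mul, ← mul_conjPhase]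
    ring
  have h1 := hC (F.mulFun m f) g
  rw [e, RCLike.norm_ofReal] at h1
  refine (le_abs_self _).trans (h1.trans ?_)
  have h2 : C * ‖F.mulFun m f‖ ≤ |C| * ‖f‖ :=
    mul_le_mul (le_abs_self C) (norm_mulFun_le hm hb f) (norm_nonneg _) (abs_nonneg _)
  exact mul_le_mul_of_nonneg_right h2 (norm_nonneg _)

variable {C : ℝ}

theorem IsBoundedPair.integrable_norm (h : IsBoundedPair F G C) (f : F) (g : G) :
    Integrable (fun b => ‖f b‖ * ‖g b‖) ν := by
  simpa only [norm_mul] using (h.integrable f g).norm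

theorem scalarPairing_comm (f g : β →ₘ[ν] 𝕜) : scalarPairing f g = scalarPairing g f := by
  simp only [scalarPairing, mul_comm]

theorem IsBoundedPair.norm_scalarPairing_le (h : IsBoundedPair F G C) (f : F) (g : G) :
    ‖scalarPairing f.toL0 g.toL0‖ ≤ C * ‖f‖ * ‖g‖ := by
  refine (norm_integral_le_integral_norm _).trans ?_
  simp only [norm_mul]
  exact h.integral_le f g

/-- The functional `f ↦ ∫ f g` on `F`. -/
def IsBoundedPair.toDual (h : IsBoundedPair F G C) (g : G) : F →L[𝕜] 𝕜 :=
  LinearMap.mkContinuous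
    { toFun := fun f => scalarPairing f.toL0 g.toL0
      map_add' := fun f f' => by
        simp only [scalarPairing]
        rw [← integral_add (h.integrable f g) (h.integrable f' g)]
        refine integral_congr_ae ?_
        filter_upwards [Elem.coe_add f f'] with b e
        rw [e, add_mul]
      map_smul' := fun c f => by
        simp only [scalarPairing]
        rw [RingHom.id_apply, smul_eq_mul, ← integral_const_mul]
        refine integral_congr_ae ?_
        filter_upwards [Elem.coe_smul c f] with b e
        rw [e, mul_assoc] }
    (C * ‖g‖) fun f => (h.norm_scalarPairing_le f g).trans_eq (by ring)

theorem IsBoundedPair.toDual_apply (h : IsBoundedPair F G C) (f : F) (g : G) :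
    h.toDual g f = scalarPairing f.toL0 g.toL0 := rfl

theorem IsBoundedPair.symm (h : IsBoundedPair F G C) : IsBoundedPair G F C where
  nonneg := h.nonneg
  integrable f g := by simpa only [mul_comm] using h.integrable g f
  integral_le f g := by
    have := h.integral_le g f
    rw [mul_right_comm] at this
    simpa only [mul_comm ‖f _‖] using this

theorem IsBoundedPair.scalarPairing_sub_right (h : IsBoundedPair F G C) (f : F) (g g' : G) :
    scalarPairing f.toL0 (g - g').toL0 =
      scalarPairing f.toL0 g.toL0 - scalarPairing f.toL0 g'.toL0 := by
  rw [scalarPairing_comm, ← h.symm.toDual_apply, map_sub, h.symm.toDual_apply,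
    h.symm.toDual_apply, scalarPairing_comm, scalarPairing_comm g'.toL0]

theorem scalarPairing_of_nonneg {f : F} {g : G} (hf : 0 ≤ f) (hg : 0 ≤ g) :
    scalarPairing f.toL0 g.toL0 = ((∫ b, ‖f b‖ * ‖g b‖ ∂ν : ℝ) : 𝕜) := by
  rw [scalarPairing, ← integral_ofReal]
  refine integral_congr_ae ?_
  filter_upwards [Elem.coe_eq_norm hf, Elem.coe_eq_norm hg] with b h1 h2
  rw [RCLike.ofReal_mul, ← h1, ← h2]

theorem scalarPairing_nonneg {f : F} {g : G} (hf : 0 ≤ f) (hg : 0 ≤ g) :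
    0 ≤ scalarPairing f.toL0 g.toL0 := by
  rw [scalarPairing_of_nonneg hf hg]
  exact RCLike.ofReal_nonneg.2 (integral_nonneg fun b => by positivity)

theorem IsKotheDualPair.eq_zero_of_cone (h : IsKotheDualPair F G) {g : G}
    (hg : ∀ f : F, 0 ≤ f → scalarPairing f.toL0 g.toL0 = 0) : g = 0 := by
  obtain ⟨C, hC⟩ := h.exists_isBoundedPair
  refine h.separating_right g fun f => ?_
  have : (hC.toDual g : F →ₗ[𝕜] 𝕜) = 0 := linear_ext_cone fun f hf => hg f hf
  exact congrArg (fun l : F →ₗ[𝕜] 𝕜 => l f) this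

/-- The order of `G` is the order induced by `F*`. -/
theorem IsKotheDualPair.nonneg_of_cone (h : IsKotheDualPair F G) {g : G}
    (hg : ∀ f : F, 0 ≤ f → 0 ≤ scalarPairing f.toL0 g.toL0) : 0 ≤ g := by
  obtain ⟨C, hC⟩ := h.exists_isBoundedPair
  -- Pairings with f ≥ 0 are real, so g and its conjugate agree on the cone.
  have hreal : g = g.conj := by
    rw [← sub_eq_zero]
    refine h.eq_zero_of_cone fun f hf => ?_
    have e : scalarPairing f.toL0 g.conj.toL0 =
        starRingEnd 𝕜 (scalarPairing f.toL0 g.toL0) := by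
      rw [scalarPairing, scalarPairing, ← integral_conj]
      refine integral_congr_ae ?_
      filter_upwards [Elem.coe_eq_norm hf, g.coe_conj] with b h1 h2
      rw [h1, h2, map_mul, RCLike.conj_ofReal]
    rw [hC.scalarPairing_sub_right, e, RCLike.conj_eq_iff_im.2 (RCLike.nonneg_iff.1 (hg f hf)).2,
      sub_self]
  obtain ⟨p, n, -, -, ⟨hp0, hn0, -⟩, -, -, hp, hn⟩ := exists_decomp g
  have hgp : g = p - n := by
    refine Elem.ext_ae ?_
    have hc := g.coe_conj
    rw [← hreal] at hc
    filter_upwards [hp, hn, hc, Elem.coe_sub p n] with b h1 h2 h3 h4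
    rw [h4, h1, h2, ← RCLike.ofReal_sub, max_zero_sub_max_neg_zero_eq_self]
    exact (RCLike.conj_eq_iff_re.1 h3.symm).symm
  suffices n = 0 by rw [hgp, this, sub_zero]; exact hp0
  refine h.eq_zero_of_cone fun f hf => ?_
  -- Restricting f to the set where g is negative gives −∫ f n, nonnegative by hypothesis and
  -- nonpositive by sign.
  set m : β → 𝕜 := Set.indicator {b | RCLike.re (g b) < 0} 1 with hm
  have hmm : Measurable m := measurable_one.indicator
    (measurableSet_lt (RCLike.continuous_re.measurable.comp g.measurable) measurable_const)
  have hmb (b) : ‖m b‖ ≤ 1 := by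
    rw [hm]; by_cases hb : b ∈ {b | RCLike.re (g b) < 0} <;> simp [Set.indicator, hb]
  have hmf : 0 ≤ F.mulFun m f := by
    rw [Elem.nonneg_iff_ae] at *
    filter_upwards [hf, coe_mulFun hmm hmb f] with b h1 h2
    rw [h2, hm]
    by_cases hb : b ∈ {b | RCLike.re (g b) < 0}
    · rw [Set.indicator_of_mem hb]; simpa using h1
    · rw [Set.indicator_of_notMem hb]; simp
  have e : scalarPairing (F.mulFun m f).toL0 g.toL0 = - scalarPairing f.toL0 n.toL0 := by
    rw [scalarPairing, scalarPairing, ← integral_neg]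
    refine integral_congr_ae ?_
    have hcg : ∀ᵐ b ∂ν, g b = p b - n b := by rw [hgp]; exact Elem.coe_sub p n
    filter_upwards [coe_mulFun hmm hmb f, hp, hn, hcg] with b h1 h2 h3 h4
    rw [h1, hm]
    by_cases hb : b ∈ {b | RCLike.re (g b) < 0}
    · rw [Set.indicator_of_mem hb, Pi.one_apply, one_mul, h4, h2,
        max_eq_right (le_of_lt hb)]; simp
    · rw [Set.indicator_of_notMem hb, h3, max_eq_right]
      · simp
      · simpa using hb
  have h1 := hg _ hmf
  rw [e] at h1
  exact le_antisymm (neg_nonneg.1 h1) (scalarPairing_nonneg hf hn0)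

theorem IsKotheDualPair.le_of_cone (h : IsKotheDualPair F G) {g g' : G}
    (hg : ∀ f : F, 0 ≤ f → scalarPairing f.toL0 g.toL0 ≤ scalarPairing f.toL0 g'.toL0) :
    g ≤ g' := by
  obtain ⟨C, hC⟩ := h.exists_isBoundedPair
  rw [← sub_nonneg]
  refine h.nonneg_of_cone fun f hf => ?_
  rw [hC.scalarPairing_sub_right, sub_nonneg]
  exact hg f hf

theorem IsBoundedPair.scalarPairing_mono (h : IsBoundedPair F G C) {f : F} (hf : 0 ≤ f) {g g' : G}
    (hg : g ≤ g') : scalarPairing f.toL0 g.toL0 ≤ scalarPairing f.toL0 g'.toL0 := by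
  rw [← sub_nonneg, ← h.scalarPairing_sub_right]
  exact scalarPairing_nonneg hf (sub_nonneg.2 hg)

end Pairing

/-! ### The spaces L¹ and L^∞; suprema and regularity in L¹ -/

section Lebesgue

variable {𝕜 : Type*} [RCLike 𝕜] {α : Type*} [MeasurableSpace α] {μ : Measure α}

theorem integrable_lebesgue_one (f : lebesgue 𝕜 μ 1) : Integrable f μ :=
  memLp_one_iff_integrable.1 (Lp.memLp (⟨f.1, f.2⟩ : Lp 𝕜 1 μ))

theorem norm_lebesgue_one (f : lebesgue 𝕜 μ 1) : ‖f‖ = ∫ a, ‖f a‖ ∂μ :=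
  L1.norm_eq_integral_norm (⟨f.1, f.2⟩ : Lp 𝕜 1 μ)

theorem ae_norm_le_lebesgue_top (h : lebesgue 𝕜 μ ∞) : ∀ᵐ a ∂μ, ‖h a‖ ≤ ‖h‖ := by
  have hlt : eLpNorm h.1 ∞ μ ≠ ∞ := (Lp.memLp (⟨h.1, h.2⟩ : Lp 𝕜 ∞ μ)).2.ne
  filter_upwards [ae_le_eLpNormEssSup (f := h.1) (μ := μ)] with a ha
  rw [← eLpNorm_exponent_top] at ha
  have := ENNReal.toReal_mono hlt ha
  rwa [toReal_enorm] at this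

theorem norm_lebesgue_top_le {h : lebesgue 𝕜 μ ∞} {c : ℝ} (hc : 0 ≤ c)
    (hb : ∀ᵐ a ∂μ, ‖h a‖ ≤ c) : ‖h‖ ≤ c := by
  show (eLpNorm h.1 ∞ μ).toReal ≤ c
  rw [eLpNorm_exponent_top]
  exact ENNReal.toReal_le_of_le_ofReal hc (eLpNormEssSup_le_of_ae_bound hb)

theorem exists_lebesgue_top {u : α → 𝕜} (hu : AEStronglyMeasurable u μ) {c : ℝ}
    (hc : ∀ᵐ a ∂μ, ‖u a‖ ≤ c) : ∃ h : lebesgue 𝕜 μ ∞, ∀ᵐ a ∂μ, h a = u a :=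
  ⟨⟨AEEqFun.mk u hu, ((memLp_congr_ae (AEEqFun.coeFn_mk u hu)).2
    (memLp_top_of_bound hu c hc)).2 |> fun h => by
      rw [← Lp.mem_Lp_iff_eLpNorm_lt_top] at h; exact h⟩, AEEqFun.coeFn_mk u hu⟩

theorem isBoundedPair_lebesgue : IsBoundedPair (lebesgue 𝕜 μ 1) (lebesgue 𝕜 μ ∞) 1 where
  nonneg := zero_le_one
  integrable f h := (integrable_lebesgue_one f).mul_bdd (c := ‖h‖)
    h.measurable.aestronglyMeasurable (ae_norm_le_lebesgue_top h)
  integral_le f h := by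
    rw [one_mul, norm_lebesgue_one, ← integral_mul_const]
    refine integral_mono_of_nonneg (ae_of_all _ fun a => by positivity)
      ((integrable_lebesgue_one f).norm.mul_const _) ?_
    filter_upwards [ae_norm_le_lebesgue_top h] with a ha
    exact mul_le_mul_of_nonneg_left ha (norm_nonneg _)

variable (𝕜 μ) in
/-- The constant function `1`. -/
theorem exists_one_lebesgue_top :
    ∃ e : lebesgue 𝕜 μ ∞, 0 ≤ e ∧ (∀ᵐ a ∂μ, e a = 1) ∧ ‖e‖ ≤ 1 := by
  obtain ⟨e, he⟩ := exists_lebesgue_top (𝕜 := 𝕜) (μ := μ) (u := fun _ => 1)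
    aestronglyMeasurable_const (c := 1) (ae_of_all _ fun a => by simp)
  refine ⟨e, ?_, he, norm_lebesgue_top_le zero_le_one (he.mono fun a h => by rw [h]; simp)⟩
  rw [Elem.nonneg_iff_ae]
  filter_upwards [he] with a h
  rw [h]; exact zero_le_one

/-- Additivity of the L¹-norm on the cone: this is what makes increasing norm-bounded families
Cauchy. -/
theorem norm_sub_lebesgue_one {f g : lebesgue 𝕜 μ 1} (hf : 0 ≤ f) (hfg : f ≤ g) :
    ‖g - f‖ = ‖g‖ - ‖f‖ := by
  rw [norm_lebesgue_one, norm_lebesgue_one, norm_lebesgue_one,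
    ← integral_sub (integrable_lebesgue_one g).norm (integrable_lebesgue_one f).norm]
  refine integral_congr_ae ?_
  filter_upwards [Elem.coe_sub g f, Elem.coe_eq_norm hf, Elem.coe_eq_norm (hf.trans hfg),
    Elem.norm_coe_le hf hfg] with a h1 h2 h3 h4
  conv_lhs => rw [h1, h2, h3, ← RCLike.ofReal_sub, RCLike.norm_ofReal, abs_of_nonneg (sub_nonneg.2 h4)]

/-- A directed norm-bounded family of nonnegative elements of `L¹` has a supremum. -/
theorem exists_isLUB_lebesgue_one {I : Type*} [Nonempty I] (u : I → lebesgue 𝕜 μ 1)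
    (hdir : Directed (· ≤ ·) u) (h0 : ∀ i, 0 ≤ u i) {C : ℝ} (hC : ∀ i, ‖u i‖ ≤ C) :
    ∃ q, IsLUB (Set.range u) q ∧ ‖q‖ ≤ C := by
  -- The family is reindexed by its range, whose order is directed, so that it becomes a net along
  -- `atTop`.
  have hne : (Set.range u).Nonempty := Set.range_nonempty u
  have : Nonempty (Set.range u) := hne.to_subtype
  have : IsDirectedOrder (Set.range u) := by
    refine ⟨?_⟩
    rintro ⟨_, i, rfl⟩ ⟨_, j, rfl⟩
    obtain ⟨k, hk1, hk2⟩ := hdir i j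
    exact ⟨⟨u k, k, rfl⟩, hk1, hk2⟩
  set v : Set.range u → lebesgue 𝕜 μ 1 := Subtype.val
  have hbdd : BddAbove (Set.range fun i => ‖u i‖) := ⟨C, by rintro _ ⟨i, rfl⟩; exact hC i⟩
  have hcauchy : Cauchy (map v atTop) := by
    refine Metric.cauchy_iff.2 ⟨inferInstance, fun ε hε => ?_⟩
    -- Beyond an index whose norm is within ε/2 of the supremum, the remaining growth of the norm
    -- equals the distance.
    obtain ⟨i, hi⟩ := exists_lt_of_lt_ciSup (show (⨆ i, ‖u i‖) - ε / 2 < ⨆ i, ‖u i‖ by linarith)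
    have key (d) (hd : ⟨u i, i, rfl⟩ ≤ (d : Set.range u)) : ‖v d - u i‖ < ε / 2 := by
      obtain ⟨_, j, rfl⟩ := d
      show ‖u j - u i‖ < _
      rw [norm_sub_lebesgue_one (h0 i) hd]
      linarith [le_ciSup hbdd j]
    refine ⟨v '' Set.Ici ⟨u i, i, rfl⟩, image_mem_map (Ici_mem_atTop _), ?_⟩
    rintro _ ⟨d, hd, rfl⟩ _ ⟨d', hd', rfl⟩
    rw [dist_eq_norm, ← sub_sub_sub_cancel_right _ _ (u i)]
    linarith [norm_sub_le (v d - u i) (v d' - u i), key d hd, key d' hd']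
  obtain ⟨q, hq⟩ := CompleteSpace.complete hcauchy
  have hq : Tendsto v atTop (𝓝 q) := hq
  refine ⟨q, ⟨?_, fun w hw => ?_⟩, ?_⟩
  · rintro d hd
    refine (isClosed_le d).mem_of_tendsto hq ?_
    filter_upwards [eventually_ge_atTop (⟨d, hd⟩ : Set.range u)] with d' hd'
    exact hd'
  · exact (isClosed_ge w).mem_of_tendsto hq (Eventually.of_forall fun d => hw d.2)
  · refine le_of_tendsto hq.norm (Eventually.of_forall ?_)
    rintro ⟨_, i, rfl⟩
    exact hC i

/-- The partition criterion for regularity of operators into `L¹`. -/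
theorem isRegularOp_lebesgue_one {β : Type*} [MeasurableSpace β] {ν : Measure β}
    {F : BanachFunctionSpace 𝕜 ν} (S : F →L[𝕜] lebesgue 𝕜 μ 1) (C : ℝ)
    (hC : ∀ (f : F) (Θ : FinitePartition β), 0 ≤ f → ∑ i, ‖S (Θ.piece f i)‖ ≤ C * ‖f‖) :
    IsRegularOp S := by
  have : Nonempty (FinitePartition β) := ⟨.trivial⟩
  have hb (f : F) (hf : 0 ≤ f) (Θ : FinitePartition β) : ‖partitionSum S Θ f‖ ≤ C * ‖f‖ := by
    refine le_trans ((norm_sum_le _ _).trans_eq ?_) (hC f Θ hf)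
    simp only [Elem.norm_abs]
  have hex (f : F) : ∃ q : lebesgue 𝕜 μ 1, 0 ≤ f →
      IsLUB (Set.range fun Θ => partitionSum S Θ f) q ∧ ‖q‖ ≤ C * ‖f‖ := by
    by_cases hf : 0 ≤ f
    · obtain ⟨q, hq⟩ := exists_isLUB_lebesgue_one (fun Θ => partitionSum S Θ f)
        (directed_partitionSum S f) (fun Θ => partitionSum_nonneg S Θ f) (hb f hf)
      exact ⟨q, fun _ => hq⟩
    · exact ⟨0, fun h => absurd h hf⟩
  choose q hq using hex
  exact isRegularOp_of_isLUB S q (fun f hf => (hq f hf).1) C fun f hf => (hq f hf).2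

end Lebesgue

/-! ### Suprema in G from the band property -/

section Band

variable {𝕜 : Type*} [RCLike 𝕜] {β : Type*} [MeasurableSpace β] {ν : Measure β}
  {F G : BanachFunctionSpace 𝕜 ν}

theorem dualLE_iff {φ ψ : F →L[𝕜] 𝕜} : DualLE φ ψ ↔ ∀ f : F, 0 ≤ f → φ f ≤ ψ f := by
  simp only [DualLE, isNonneg_iff, ← RCLike.nonneg_iff, sub_nonneg]

/-- If `G` is a band in `F*`, then directed families in `G` that are bounded in `F*` have
suprema in `G`. -/
theorem IsKotheDualPair.exists_isLUB (hFG : IsKotheDualPair F G)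
    (hband : IsDualBand (kotheImage F G)) {C : ℝ} (hC : IsBoundedPair F G C)
    {I : Type*} [Nonempty I] (u : I → G)
    (hdir : Directed (· ≤ ·) u) (h0 : ∀ i, 0 ≤ u i) {c : ℝ} (hc : ∀ i, ‖hC.toDual (u i)‖ ≤ c) :
    ∃ q, IsLUB (Set.range u) q := by
  have : Nonempty (Set.range u) := (Set.range_nonempty u).to_subtype
  have : IsDirectedOrder (Set.range u) := by
    refine ⟨?_⟩
    rintro ⟨_, i, rfl⟩ ⟨_, j, rfl⟩
    obtain ⟨k, hk1, hk2⟩ := hdir i j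
    exact ⟨⟨u k, k, rfl⟩, hk1, hk2⟩
  -- By Banach–Alaoglu the functionals have a weak* limit φ along an ultrafilter finer than `atTop`.
  -- Inequalities on the cone survive pointwise limits, so φ is the supremum in F*.
  set 𝒰 : Ultrafilter (Set.range u) := Ultrafilter.of atTop
  set Ψ : Set.range u → WeakDual 𝕜 F := fun d => StrongDual.toWeakDual (hC.toDual d.1) with hΨ
  have hcomp := WeakDual.isCompact_closedBall (𝕜 := 𝕜) (E := F) 0 c
  obtain ⟨φ', -, hφ'⟩ := hcomp.ultrafilter_le_nhds (𝒰.map Ψ) (by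
    rw [le_principal_iff]
    refine Filter.mem_map.2 (Eventually.of_forall ?_)
    rintro ⟨_, i, rfl⟩
    show hC.toDual (u i) ∈ Metric.closedBall 0 c
    rw [mem_closedBall_zero_iff]
    exact hc i)
  set φ : F →L[𝕜] 𝕜 := WeakDual.toStrongDual φ' with hφdef
  have hlim (f : F) : Tendsto (fun d => hC.toDual (d : Set.range u).1 f) 𝒰 (𝓝 (φ f)) :=
    ((WeakDual.eval_continuous f).tendsto φ').comp (show Tendsto Ψ 𝒰 (𝓝 φ') from hφ')
  have hle (i : I) : DualLE (hC.toDual (u i)) φ := by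
    refine dualLE_iff.2 fun f hf => ge_of_tendsto (hlim f) ?_
    have : ∀ᶠ d in (atTop : Filter (Set.range u)), (⟨u i, i, rfl⟩ : Set.range u) ≤ d :=
      eventually_ge_atTop _
    filter_upwards [(Ultrafilter.of_le atTop) this] with d hd
    exact hC.scalarPairing_mono hf hd
  have hleast (χ : F →L[𝕜] 𝕜) (hχ : ∀ i, DualLE (hC.toDual (u i)) χ) : DualLE φ χ := by
    refine dualLE_iff.2 fun f hf => le_of_tendsto (hlim f) (Eventually.of_forall ?_)
    rintro ⟨_, i, rfl⟩
    exact dualLE_iff.1 (hχ i) f hf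
  -- The band contains φ, so it is represented by some q in G; `le_of_cone` then carries the order
  -- of F* back to G.
  obtain ⟨q, hq⟩ := hband.order_closed (Set.range fun i => hC.toDual (u i))
    (by rintro _ ⟨i, rfl⟩; exact ⟨u i, fun f => rfl⟩) (Set.range_nonempty _)
    (by
      rintro _ ⟨i, rfl⟩ _ ⟨j, rfl⟩
      obtain ⟨k, hk1, hk2⟩ := hdir i j
      exact ⟨_, ⟨k, rfl⟩, dualLE_iff.2 fun f hf => hC.scalarPairing_mono hf hk1,
        dualLE_iff.2 fun f hf => hC.scalarPairing_mono hf hk2⟩)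
    (by
      rintro _ ⟨i, rfl⟩
      exact dualLE_iff.2 fun f hf => scalarPairing_nonneg hf (h0 i))
    φ (by rintro _ ⟨i, rfl⟩; exact hle i)
    (fun χ hχ => hleast χ fun i => hχ _ ⟨i, rfl⟩)
  refine ⟨q, ?_, fun w hw => ?_⟩
  · rintro _ ⟨i, rfl⟩
    refine hFG.le_of_cone fun f hf => ?_
    rw [← hq f]
    exact dualLE_iff.1 (hle i) f hf
  · refine hFG.le_of_cone fun f hf => ?_
    rw [← hq f]
    refine dualLE_iff.1 (hleast (hC.toDual w) fun i => dualLE_iff.2 fun f hf => ?_) f hf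
    exact hC.scalarPairing_mono hf (hw ⟨i, rfl⟩)

end Band

/-! ### Passage of regularity between T and S; sources of common majorants -/

section Regularity

variable {𝕜 : Type*} [RCLike 𝕜] {α β : Type*} [MeasurableSpace α] [MeasurableSpace β]
  {μ : Measure α} {ν : Measure β} {F G : BanachFunctionSpace 𝕜 ν}
  {T : lebesgue 𝕜 μ ∞ →L[𝕜] G} {S : F →L[𝕜] lebesgue 𝕜 μ 1}

theorem integral_norm_mul_sum {E E' : BanachFunctionSpace 𝕜 ν} {C : ℝ}
    (h : IsBoundedPair E E' C) {ι : Type*} [Fintype ι] (f : E) (g : ι → E') {g' : E'}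
    (hg : ∀ᵐ b ∂ν, ∑ i, ‖g i b‖ = ‖g' b‖) :
    ∑ i, ∫ b, ‖f b‖ * ‖g i b‖ ∂ν = ∫ b, ‖f b‖ * ‖g' b‖ ∂ν := by
  rw [← integral_finsetSum _ fun i _ => h.integrable_norm f (g i)]
  refine integral_congr_ae ?_
  filter_upwards [hg] with b hb
  rw [← Finset.mul_sum, hb]

theorem FinitePartition.ae_sum_norm_piece (Θ : FinitePartition β) (f : F) :
    ∀ᵐ b ∂ν, ∑ i, ‖Θ.piece f i b‖ = ‖f b‖ := by
  filter_upwards [Θ.ae_coe_piece f] with b hb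
  simp only [hb, norm_mul, RCLike.norm_ofReal, abs_of_nonneg (Θ.nonneg _ _)]
  rw [← Finset.sum_mul, Θ.sum_eq_one, one_mul]

/-- If the images of finitely many elements of the unit ball of `L^∞` have a common bound of
controlled norm, then the adjoint is regular. -/
theorem isRegularOp_adjoint_of_bound {K : ℝ} (hK : IsBoundedPair F G K)
    (hS : ∀ (f : F) (h : lebesgue 𝕜 μ ∞),
      scalarPairing f.toL0 (T h).toL0 = scalarPairing (S f).toL0 h.toL0)
    {C : ℝ} (hC : ∀ (ι : Type) [Fintype ι] (s : ι → lebesgue 𝕜 μ ∞), (∀ i, ‖s i‖ ≤ 1) →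
      ∃ g : G, ‖g‖ ≤ C ∧ ∀ i, ∀ᵐ b ∂ν, ‖T (s i) b‖ ≤ ‖g b‖) : IsRegularOp S := by
  refine isRegularOp_lebesgue_one S (K * C) fun f Θ hf => ?_
  -- The element s is the conjugate phase of S(θ_i f), which attains its L¹-norm.
  have hs (i : Θ.ι) : ∃ s : lebesgue 𝕜 μ ∞, ‖s‖ ≤ 1 ∧
      scalarPairing (S (Θ.piece f i)).toL0 s.toL0 = ((‖S (Θ.piece f i)‖ : ℝ) : 𝕜) := by
    obtain ⟨s, hs⟩ := exists_lebesgue_top (μ := μ) (c := 1)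
      (measurable_conjPhase.comp (S (Θ.piece f i)).measurable).aestronglyMeasurable
      (ae_of_all _ fun a => norm_conjPhase_le _)
    refine ⟨s, norm_lebesgue_top_le zero_le_one ?_, ?_⟩
    · filter_upwards [hs] with a ha
      rw [ha]; exact norm_conjPhase_le _
    · rw [norm_lebesgue_one, ← integral_ofReal, scalarPairing]
      refine integral_congr_ae ?_
      filter_upwards [hs] with a ha
      rw [ha]; exact mul_conjPhase _
  choose s hs1 hs2 using hs
  -- One g serves all pieces, so the sum over i collapses to ∫ |g||f|, independently of the number
  -- of pieces.
  obtain ⟨g, hg, hTg⟩ := hC Θ.ι s hs1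
  have h1 (i : Θ.ι) : ‖S (Θ.piece f i)‖ ≤ ∫ b, ‖g b‖ * ‖Θ.piece f i b‖ ∂ν := by
    have e : ‖S (Θ.piece f i)‖ = ‖scalarPairing (Θ.piece f i).toL0 (T (s i)).toL0‖ := by
      rw [hS, hs2, RCLike.norm_ofReal, abs_norm]
    rw [e]
    refine (norm_integral_le_integral_norm _).trans ?_
    refine integral_mono_ae (hK.integrable _ _).norm (hK.symm.integrable_norm _ _) ?_
    filter_upwards [hTg i] with b hb
    rw [norm_mul, mul_comm]
    exact mul_le_mul_of_nonneg_right hb (norm_nonneg _)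
  calc ∑ i, ‖S (Θ.piece f i)‖ ≤ ∑ i, ∫ b, ‖g b‖ * ‖Θ.piece f i b‖ ∂ν :=
        Finset.sum_le_sum fun i _ => h1 i
    _ = ∫ b, ‖g b‖ * ‖f b‖ ∂ν := integral_norm_mul_sum hK.symm g _ (Θ.ae_sum_norm_piece f)
    _ ≤ K * ‖g‖ * ‖f‖ := hK.symm.integral_le g f
    _ ≤ K * C * ‖f‖ := by
        have := hK.nonneg
        gcongr

/-- Regularity of the adjoint implies regularity, if `G` is a band in `F*`. -/
theorem isRegularOp_of_adjoint (hFG : IsKotheDualPair F G)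
    (hS : ∀ (f : F) (h : lebesgue 𝕜 μ ∞),
      scalarPairing f.toL0 (T h).toL0 = scalarPairing (S f).toL0 h.toL0)
    (hband : IsDualBand (kotheImage F G)) (hreg : IsRegularOp S) : IsRegularOp T := by
  obtain ⟨C, hC⟩ := hFG.exists_isBoundedPair
  obtain ⟨R, hR⟩ := hreg.exists_isDominant
  have hL := isBoundedPair_lebesgue (𝕜 := 𝕜) (μ := μ)
  -- A bound in F* for the partition sums of T, uniform in Θ. Each term is moved to S by adjointness
  -- and estimated by R|f| times the piece of h; the pieces then add up to |h|.
  have key (h : lebesgue 𝕜 μ ∞) (Θ : FinitePartition α) (f : F) :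
      ∫ b, ‖f b‖ * ‖partitionSum T Θ h b‖ ∂ν ≤ ‖R‖ * ‖h‖ * ‖f‖ := by
    have h1 (i : Θ.ι) : ∫ b, ‖f b‖ * ‖(T (Θ.piece h i)).abs b‖ ∂ν ≤
        ∫ a, ‖R f.abs a‖ * ‖Θ.piece h i a‖ ∂μ := by
      set t := T (Θ.piece h i) with ht
      -- The phase is absorbed into f, so that the integral of absolute values becomes a pairing and
      -- adjointness applies.
      set m : β → 𝕜 := fun b => conjPhase (f b * t b) with hm
      have hmm : Measurable m := measurable_conjPhase.comp (f.measurable.mul t.measurable)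
      have hmb (b : β) : ‖m b‖ ≤ 1 := norm_conjPhase_le _
      have e1 : ((∫ b, ‖f b‖ * ‖t.abs b‖ ∂ν : ℝ) : 𝕜) =
          scalarPairing (F.mulFun m f).toL0 t.toL0 := by
        rw [scalarPairing, ← integral_ofReal]
        refine integral_congr_ae ?_
        filter_upwards [coe_mulFun hmm hmb f, t.norm_coe_abs] with b h1 h2
        rw [h1, h2, ← norm_mul, ← mul_conjPhase]
        ring
      have e2 : ∫ b, ‖f b‖ * ‖t.abs b‖ ∂ν ≤ ‖scalarPairing (F.mulFun m f).toL0 t.toL0‖ := by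
        rw [← e1, RCLike.norm_ofReal]; exact le_abs_self _
      rw [ht, hS] at e2
      refine e2.trans ((norm_integral_le_integral_norm _).trans ?_)
      refine integral_mono_ae (hL.integrable _ _).norm (hL.integrable_norm _ _) ?_
      have hmf : (F.mulFun m f).abs ≤ f.abs := by
        refine Elem.le_of_norm_le (Elem.abs_nonneg _) f.abs_nonneg ?_
        filter_upwards [coe_mulFun hmm hmb f, f.norm_coe_abs, (F.mulFun m f).norm_coe_abs]
          with b h1 h2 h3
        rw [h3, h2, h1, norm_mul]
        exact mul_le_of_le_one_left (norm_nonneg _) (hmb b)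
      filter_upwards [hR.2 (F.mulFun m f), Elem.le_iff_ae.1 (hR.1.mono hmf)] with a h1 h2
      rw [norm_mul]
      exact mul_le_mul_of_nonneg_right
        (h1.trans ((RCLike.le_iff_re_im.1 h2).1.trans (RCLike.re_le_norm _))) (norm_nonneg _)
    have h2 : ∀ᵐ b ∂ν, ∑ i, ‖(T (Θ.piece h i)).abs b‖ = ‖partitionSum T Θ h b‖ := by
      filter_upwards [Elem.coe_sum Finset.univ fun i => (T (Θ.piece h i)).abs,
        ae_all_iff.2 fun i => (T (Θ.piece h i)).coe_abs] with b h1 h2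
      rw [partitionSum, h1]
      simp only [h2, ← RCLike.ofReal_sum, RCLike.norm_ofReal, abs_norm]
      exact (abs_of_nonneg (Finset.sum_nonneg fun i _ => norm_nonneg _)).symm
    rw [← integral_norm_mul_sum hC f _ h2]
    calc _ ≤ ∑ i, ∫ a, ‖R f.abs a‖ * ‖Θ.piece h i a‖ ∂μ := Finset.sum_le_sum fun i _ => h1 i
      _ = ∫ a, ‖R f.abs a‖ * ‖h a‖ ∂μ :=
          integral_norm_mul_sum hL _ _ (Θ.ae_sum_norm_piece h)
      _ ≤ 1 * ‖R f.abs‖ * ‖h‖ := hL.integral_le _ _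
      _ ≤ ‖R‖ * ‖h‖ * ‖f‖ := by
          have := R.le_opNorm f.abs
          rw [Elem.norm_abs] at this
          rw [one_mul, mul_right_comm]
          exact mul_le_mul_of_nonneg_right this (norm_nonneg _)
  have : Nonempty (FinitePartition α) := ⟨.trivial⟩
  have hex (h : lebesgue 𝕜 μ ∞) : ∃ q, IsLUB (Set.range fun Θ => partitionSum T Θ h) q := by
    refine hFG.exists_isLUB hband hC _ (directed_partitionSum T h)
      (fun Θ => partitionSum_nonneg T Θ h) (c := ‖R‖ * ‖h‖) fun Θ => ?_
    refine ContinuousLinearMap.opNorm_le_bound _ (by positivity) fun f => ?_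
    rw [hC.toDual_apply]
    refine (norm_integral_le_integral_norm _).trans ?_
    simp only [norm_mul]
    exact key h Θ f
  choose q hq using hex
  obtain ⟨L, hLq⟩ := exists_linear_of_isLUB T q fun f _ => hq f
  have hle (h : lebesgue 𝕜 μ ∞) (hh : 0 ≤ h) : (T h).abs ≤ L h := by
    rw [hLq h hh]
    exact (abs_le_partitionSum_trivial T h).trans ((hq h).1 ⟨_, rfl⟩)
  have hpos (h : lebesgue 𝕜 μ ∞) (hh : 0 ≤ h) : 0 ≤ L h := (Elem.abs_nonneg _).trans (hle h hh)
  -- The norm of G need not be controlled by that of F*, so boundedness comes from the order: 0 ≤ h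
  -- ≤ ‖h‖ e gives 0 ≤ L h ≤ ‖h‖ L e.
  obtain ⟨e, he0, he, -⟩ := exists_one_lebesgue_top 𝕜 μ
  refine isRegularOp_of_linear L hle ‖L e‖ fun h hh => ?_
  have h1 : h ≤ ((‖h‖ : ℝ) : 𝕜) • e := by
    rw [Elem.le_iff_ae]
    filter_upwards [ae_norm_le_lebesgue_top h, he, Elem.coe_smul ((‖h‖ : ℝ) : 𝕜) e,
      Elem.coe_eq_norm hh] with a h1 h2 h3 h4
    rw [h3, h2, mul_one, h4]
    exact RCLike.ofReal_le_ofReal.2 h1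
  have h2 := hpos _ (sub_nonneg.2 h1)
  rw [map_sub, map_smul, sub_nonneg] at h2
  refine (Elem.norm_mono (hpos h hh) h2).trans_eq ?_
  rw [norm_smul, RCLike.norm_ofReal, abs_norm, mul_comm]

/-- The norm of a space with strong order unit dominates the order unit norm. -/
theorem HasStrongOrderUnit.exists_bound {u : G}
    (hu : ∀ f : G, ∃ c : ℝ, 0 ≤ c ∧ ∀ᵐ a ∂ν, ‖f a‖ ≤ c * RCLike.re (u a)) (hu0 : 0 ≤ u) :
    ∃ C : ℝ, 0 ≤ C ∧ ∀ g : G, ∀ᵐ b ∂ν, ‖g b‖ ≤ C * ‖g‖ * RCLike.re (u b) := by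
  by_contra hcon
  simp only [not_exists, not_and, not_forall] at hcon
  -- If no constant works, take g_n violating 4^n. The series ∑ |g_n| / (2^n ‖g_n‖) converges to
  -- some k ≤ c u, and any n with 2^n > c gives |g_n| ≤ 2^n ‖g_n‖ · 2^n u, a contradiction.
  choose g hg using fun n : ℕ => hcon ((4 : ℝ) ^ n) (by positivity)
  have hg0 (n : ℕ) : 0 < ‖g n‖ := by
    rw [norm_pos_iff]
    intro h0
    refine hg n (Eventually.mono (Elem.coe_zero (E := G)) fun b hb => ?_)
    rw [h0, hb]; simp
  have hn (n : ℕ) : ‖((((2 : ℝ) ^ n * ‖g n‖)⁻¹ : ℝ) : 𝕜) • (g n).abs‖ = (1 / 2 : ℝ) ^ n := by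
    have := (hg0 n).ne'
    rw [norm_smul, RCLike.norm_ofReal, Elem.norm_abs, abs_of_nonneg (by positivity)]
    field_simp
    rw [← mul_pow]; norm_num
  have hs : Summable fun n => ((((2 : ℝ) ^ n * ‖g n‖)⁻¹ : ℝ) : 𝕜) • (g n).abs :=
    Summable.of_norm (by simpa only [hn] using summable_geometric_two)
  have hpos (n : ℕ) : 0 ≤ ((((2 : ℝ) ^ n * ‖g n‖)⁻¹ : ℝ) : 𝕜) • (g n).abs :=
    Elem.smul_nonneg' (Elem.abs_nonneg _) (by positivity)
  obtain ⟨k, hk⟩ := hs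
  have hle (n : ℕ) : ((((2 : ℝ) ^ n * ‖g n‖)⁻¹ : ℝ) : 𝕜) • (g n).abs ≤ k := by
    refine (BanachFunctionSpace.isClosed_le _).mem_of_tendsto hk.tendsto_sum_nat ?_
    filter_upwards [eventually_gt_atTop n] with N hN
    exact Finset.single_le_sum (fun i _ => hpos i) (Finset.mem_range.2 hN)
  obtain ⟨c, hc0, hc⟩ := hu k
  obtain ⟨n, hcn⟩ := pow_unbounded_of_one_lt c (one_lt_two (α := ℝ))
  refine hg n ?_
  filter_upwards [hc, Elem.norm_coe_le (hpos n) (hle n), Elem.nonneg_iff_ae.1 hu0,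
    Elem.coe_smul ((((2 : ℝ) ^ n * ‖g n‖)⁻¹ : ℝ) : 𝕜) (g n).abs, (g n).norm_coe_abs]
    with b h1 h2 h3 h4 h5
  have h6 := (RCLike.nonneg_iff.1 h3).1
  have hp : 0 < (2 : ℝ) ^ n * ‖g n‖ := mul_pos (by positivity) (hg0 n)
  rw [h4, norm_mul, h5, RCLike.norm_ofReal, abs_of_nonneg (by positivity),
    inv_mul_le_iff₀ hp] at h2
  calc ‖g n b‖ ≤ 2 ^ n * ‖g n‖ * ‖k b‖ := h2
    _ ≤ 2 ^ n * ‖g n‖ * (2 ^ n * RCLike.re (u b)) := by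
        gcongr
        exact h1.trans (mul_le_mul_of_nonneg_right hcn.le h6)
    _ = 4 ^ n * ‖g n‖ * RCLike.re (u b) := by
        rw [show (4 : ℝ) = 2 * 2 by norm_num, mul_pow]; ring

/-- The majorant is C‖T‖u; no regularity of T is used. -/
theorem HasStrongOrderUnit.bound (hu : G.HasStrongOrderUnit) (T : lebesgue 𝕜 μ ∞ →L[𝕜] G) :
    ∃ C : ℝ, ∀ (ι : Type) [Fintype ι] (s : ι → lebesgue 𝕜 μ ∞), (∀ i, ‖s i‖ ≤ 1) →
      ∃ g : G, ‖g‖ ≤ C ∧ ∀ i, ∀ᵐ b ∂ν, ‖T (s i) b‖ ≤ ‖g b‖ := by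
  obtain ⟨u, hu0, hu⟩ := hu
  obtain ⟨C, hC0, hC⟩ := HasStrongOrderUnit.exists_bound hu (isNonneg_iff.1 hu0)
  refine ⟨_, fun ι _ s hs => ⟨((C * ‖T‖ : ℝ) : 𝕜) • u, le_rfl, fun i => ?_⟩⟩
  filter_upwards [hC (T (s i)), Elem.coe_smul ((C * ‖T‖ : ℝ) : 𝕜) u,
    Elem.nonneg_iff_ae.1 (isNonneg_iff.1 hu0)] with b h1 h2 h3
  have h6 := (RCLike.nonneg_iff.1 h3).1
  have h7 : ‖T (s i)‖ ≤ ‖T‖ := (T.le_opNorm _).trans (mul_le_of_le_one_right (norm_nonneg _) (hs i))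
  rw [h2, norm_mul, RCLike.norm_ofReal, abs_of_nonneg (by positivity)]
  exact h1.trans (mul_le_mul (by gcongr) (RCLike.re_le_norm _) h6 (by positivity))

/-- The majorant is R applied to the constant function 1, for any dominant R. -/
theorem IsRegularOp.bound (hT : IsRegularOp T) :
    ∃ C : ℝ, ∀ (ι : Type) [Fintype ι] (s : ι → lebesgue 𝕜 μ ∞), (∀ i, ‖s i‖ ≤ 1) →
      ∃ g : G, ‖g‖ ≤ C ∧ ∀ i, ∀ᵐ b ∂ν, ‖T (s i) b‖ ≤ ‖g b‖ := by
  obtain ⟨R, hR⟩ := hT.exists_isDominant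
  obtain ⟨e, he0, he, -⟩ := exists_one_lebesgue_top 𝕜 μ
  refine ⟨_, fun ι _ s hs => ⟨R e, le_rfl, fun i => ?_⟩⟩
  have h1 : (s i).abs ≤ e := by
    refine Elem.le_of_norm_le (Elem.abs_nonneg _) he0 ?_
    filter_upwards [(s i).norm_coe_abs, ae_norm_le_lebesgue_top (s i), he] with a h1 h2 h3
    rw [h1, h3, norm_one]; exact h2.trans (hs i)
  filter_upwards [hR.2 (s i), Elem.le_iff_ae.1 (hR.1.mono h1)] with b h1 h2
  exact h1.trans ((RCLike.le_iff_re_im.1 h2).1.trans (RCLike.re_le_norm _))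

/-- A bound for an ampliation to a space containing all finite-dimensional `ℓ^∞`. -/
theorem bound_of_sup_norm {Y : Type*} [NormedAddCommGroup Y] [NormedSpace 𝕜 Y]
    (he : ∀ (ι : Type) [Fintype ι], ∃ e : ι → Y, ∀ c : ι → 𝕜, ‖∑ i, c i • e i‖ = ‖c‖) {K : ℝ}
    (hK : ∀ (ι : Type) [Fintype ι] (h : ι → lebesgue 𝕜 μ ∞) (y : ι → Y),
      ‖∑ i, tmul (T (h i)) (y i)‖ ≤ K * ‖∑ i, tmul (h i) (y i)‖) :
    ∃ C : ℝ, ∀ (ι : Type) [Fintype ι] (s : ι → lebesgue 𝕜 μ ∞), (∀ i, ‖s i‖ ≤ 1) →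
      ∃ g : G, ‖g‖ ≤ C ∧ ∀ i, ∀ᵐ b ∂ν, ‖T (s i) b‖ ≤ ‖g b‖ := by
  refine ⟨|K|, fun ι _ s hs => ?_⟩
  obtain ⟨e, he⟩ := he ι
  -- The pointwise norm of ∑ T s_i ⊗ e_i is the maximum of the |T s_i|, hence a common majorant.
  refine ⟨(∑ i, tmul (T (s i)) (e i)).absE, ?_, fun i => ?_⟩
  · rw [Bochner.norm_absE]
    refine (hK ι s e).trans ?_
    have h1 : ‖∑ i, tmul (s i) (e i)‖ ≤ 1 := by
      rw [← Bochner.norm_absE]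
      refine norm_lebesgue_top_le zero_le_one ?_
      filter_upwards [Bochner.norm_coe_absE (∑ i, tmul (s i) (e i)),
        coe_sum_tmul Finset.univ s e, ae_all_iff.2 fun i => ae_norm_le_lebesgue_top (s i)]
        with a h1 h2 h3
      rw [h1, h2, he]
      exact (pi_norm_le_iff_of_nonneg zero_le_one).2 fun i => (h3 i).trans (hs i)
    calc K * ‖∑ i, tmul (s i) (e i)‖ ≤ |K| * 1 :=
          mul_le_mul (le_abs_self K) h1 (norm_nonneg _) (abs_nonneg _)
      _ = |K| := mul_one _
  · filter_upwards [Bochner.norm_coe_absE (∑ i, tmul (T (s i)) (e i)),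
      coe_sum_tmul Finset.univ (fun i => T (s i)) e] with b h1 h2
    rw [h1, h2, he]
    exact norm_le_pi_norm (fun i => T (s i) b) i

/-- A bound for an ampliation to a space containing all finite-dimensional `ℓ^1`. -/
theorem isRegularOp_of_sum_norm {X : Type*} [NormedAddCommGroup X] [NormedSpace 𝕜 X]
    (he : ∀ (ι : Type) [Fintype ι], ∃ e : ι → X, ∀ c : ι → 𝕜, ‖∑ i, c i • e i‖ = ∑ i, ‖c i‖)
    {K : ℝ} (hK : ∀ (ι : Type) [Fintype ι] (f : ι → F) (x : ι → X),
      ‖∑ i, tmul (S (f i)) (x i)‖ ≤ K * ‖∑ i, tmul (f i) (x i)‖) : IsRegularOp S := by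
  refine isRegularOp_lebesgue_one S K fun f Θ hf => ?_
  obtain ⟨e, he⟩ := he Θ.ι
  -- Integrating the ℓ¹-norm pointwise yields exactly the sum to be bounded, while ∑ θ_i f ⊗ e_i has
  -- pointwise norm |f|.
  have h1 : ‖∑ i, tmul (S (Θ.piece f i)) (e i)‖ = ∑ i, ‖S (Θ.piece f i)‖ := by
    rw [← Bochner.norm_absE, norm_lebesgue_one]
    simp only [norm_lebesgue_one]
    rw [← integral_finsetSum _ fun i _ => (integrable_lebesgue_one _).norm]
    refine integral_congr_ae ?_
    filter_upwards [Bochner.norm_coe_absE (∑ i, tmul (S (Θ.piece f i)) (e i)),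
      coe_sum_tmul Finset.univ (fun i => S (Θ.piece f i)) e] with b h1 h2
    rw [h1, h2, he]
  have h2 : ‖∑ i, tmul (Θ.piece f i) (e i)‖ ≤ ‖f‖ := by
    refine Bochner.norm_le_of_ae ?_
    filter_upwards [coe_sum_tmul Finset.univ (Θ.piece f) e, Θ.ae_sum_norm_piece f] with b h1 h2
    rw [h1, he, h2]
  -- Equality of norms is needed, since K has no prescribed sign.
  have h3 : ‖f‖ ≤ ‖∑ i, tmul (Θ.piece f i) (e i)‖ := by
    refine Bochner.norm_ge_of_ae ?_
    filter_upwards [coe_sum_tmul Finset.univ (Θ.piece f) e, Θ.ae_sum_norm_piece f] with b h1 h2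
    rw [h1, he, h2]
  rw [← h1, le_antisymm h3 h2]
  exact hK Θ.ι (Θ.piece f) e

end Regularity

/-! ### Finite-dimensional ℓ^∞ and ℓ¹ inside the sequence spaces -/

section SequenceSpaces

variable (𝕜 : Type*) [RCLike 𝕜]

theorem lp_sum_single_apply {p : ℝ≥0∞} {ι : Type*} [Fintype ι] [DecidableEq ι] (e : ι ↪ ℕ)
    (c : ι → 𝕜) (n : ℕ) :
    (∑ i, c i • (lp.single p (e i) (1 : 𝕜) : lp (fun _ : ℕ => 𝕜) p)) n =
      ∑ i, if e i = n then c i else 0 := by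
  rw [lp.coeFn_sum, Finset.sum_apply]
  refine Finset.sum_congr rfl fun i _ => ?_
  rw [lp.coeFn_smul, Pi.smul_apply, lp.single_apply, Pi.single_apply, smul_eq_mul]
  by_cases h : e i = n
  · simp [h]
  · simp [h, Ne.symm h]

theorem exists_sup_norm_lp (ι : Type) [Fintype ι] :
    ∃ e : ι → lp (fun _ : ℕ => 𝕜) ∞, ∀ c : ι → 𝕜, ‖∑ i, c i • e i‖ = ‖c‖ := by
  classical
  set e : ι ↪ ℕ := (Fintype.equivFin ι).toEmbedding.trans Fin.valEmbedding
  refine ⟨fun i => lp.single ∞ (e i) 1, fun c => le_antisymm ?_ ?_⟩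
  · refine lp.norm_le_of_forall_le (norm_nonneg _) fun n => ?_
    rw [lp_sum_single_apply]
    by_cases h : ∃ i, e i = n
    · obtain ⟨i, rfl⟩ := h
      simp only [e.injective.eq_iff, Finset.sum_ite_eq', Finset.mem_univ, if_true]
      exact norm_le_pi_norm c i
    · rw [Finset.sum_eq_zero fun i _ => if_neg fun h' => h ⟨i, h'⟩]
      simp
  · refine (pi_norm_le_iff_of_nonneg (norm_nonneg _)).2 fun i => ?_
    have := lp.norm_apply_le_norm (p := ∞) ENNReal.top_ne_zero
      (∑ i, c i • (lp.single ∞ (e i) (1 : 𝕜) : lp (fun _ : ℕ => 𝕜) ∞)) (e i)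
    rw [lp_sum_single_apply] at this
    simpa only [e.injective.eq_iff, Finset.sum_ite_eq', Finset.mem_univ, if_true] using this

theorem exists_sum_norm_lp (ι : Type) [Fintype ι] :
    ∃ e : ι → lp (fun _ : ℕ => 𝕜) 1, ∀ c : ι → 𝕜, ‖∑ i, c i • e i‖ = ∑ i, ‖c i‖ := by
  classical
  set e : ι ↪ ℕ := (Fintype.equivFin ι).toEmbedding.trans Fin.valEmbedding
  refine ⟨fun i => lp.single 1 (e i) 1, fun c => ?_⟩
  set g : ℕ → 𝕜 := fun n => ∑ i, if e i = n then c i else 0 with hg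
  have hge (i : ι) : g (e i) = c i := by simp [hg, e.injective.eq_iff]
  have h1 := lp.norm_sum_single (E := fun _ : ℕ => 𝕜) (p := 1) (by simp) g
    (Finset.univ.map e)
  rw [Finset.sum_map, Finset.sum_map] at h1
  simp only [ENNReal.toReal_one, Real.rpow_one, hge] at h1
  rw [← h1]
  congr 1
  refine Finset.sum_congr rfl fun i _ => ?_
  rw [← lp.single_smul, smul_eq_mul, mul_one]

end SequenceSpaces

/-! ### Pairings of vector-valued functions -/

section BochnerPairing

variable {𝕜 : Type*} [RCLike 𝕜] {β : Type*} [MeasurableSpace β] {ν : Measure β}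
  {F G : BanachFunctionSpace 𝕜 ν} {C : ℝ}
  {X Y : Type*} [NormedAddCommGroup X] [NormedSpace 𝕜 X] [NormedAddCommGroup Y] [NormedSpace 𝕜 Y]
  (P : X →L[𝕜] Y →L[𝕜] 𝕜)

theorem aestronglyMeasurable_pairing (φ : β →ₘ[ν] X) (g : β →ₘ[ν] Y) :
    AEStronglyMeasurable (fun b => P (φ b) (g b)) ν :=
  P.aestronglyMeasurable_comp₂ φ.aestronglyMeasurable g.aestronglyMeasurable

theorem ae_norm_pairing_le (φ : F.Bochner X) (g : G.Bochner Y) :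
    ∀ᵐ b ∂ν, ‖P (φ.toL0 b) (g.toL0 b)‖ ≤ ‖P‖ * (‖φ.absE b‖ * ‖g.absE b‖) := by
  filter_upwards [φ.norm_coe_absE, g.norm_coe_absE] with b h1 h2
  rw [h1, h2, ← mul_assoc]
  exact P.le_opNorm₂ _ _

theorem IsBoundedPair.integrable_pairing (h : IsBoundedPair F G C) (φ : F.Bochner X)
    (g : G.Bochner Y) : Integrable (fun b => P (φ.toL0 b) (g.toL0 b)) ν :=
  ((h.integrable_norm φ.absE g.absE).const_mul ‖P‖).mono'
    (aestronglyMeasurable_pairing P _ _) (ae_norm_pairing_le P φ g)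

theorem IsBoundedPair.norm_bochnerPairing_le (h : IsBoundedPair F G C) (φ : F.Bochner X)
    (g : G.Bochner Y) : ‖bochnerPairing P φ.toL0 g.toL0‖ ≤ ‖P‖ * C * ‖φ‖ * ‖g‖ := by
  refine (norm_integral_le_integral_norm _).trans ?_
  refine (integral_mono_ae (h.integrable_pairing P φ g).norm
    ((h.integrable_norm φ.absE g.absE).const_mul ‖P‖) (ae_norm_pairing_le P φ g)).trans ?_
  rw [integral_const_mul, mul_assoc, mul_assoc, ← mul_assoc C]
  exact mul_le_mul_of_nonneg_left (h.integral_le φ.absE g.absE) (norm_nonneg P)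

/-- The pairing as a functional of its first argument. -/
def IsBoundedPair.pairingLeft (h : IsBoundedPair F G C) (g : G.Bochner Y) :
    F.Bochner X →L[𝕜] 𝕜 :=
  LinearMap.mkContinuous
    { toFun := fun φ => bochnerPairing P φ.toL0 g.toL0
      map_add' := fun φ φ' => by
        simp only [bochnerPairing]
        rw [← integral_add (h.integrable_pairing P φ g) (h.integrable_pairing P φ' g)]
        refine integral_congr_ae ?_
        filter_upwards [Bochner.coe_add φ φ'] with b e
        rw [e, map_add, add_apply]
      map_smul' := fun c φ => by
        simp only [bochnerPairing]
        rw [RingHom.id_apply, smul_eq_mul, ← integral_const_mul]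
        refine integral_congr_ae ?_
        filter_upwards [Bochner.coe_smul c φ] with b e
        rw [e, map_smul, smul_apply, smul_eq_mul] }
    (‖P‖ * C * ‖g‖) fun φ => (h.norm_bochnerPairing_le P φ g).trans_eq (by ring)

theorem IsBoundedPair.pairingLeft_apply (h : IsBoundedPair F G C) (φ : F.Bochner X)
    (g : G.Bochner Y) : h.pairingLeft P g φ = bochnerPairing P φ.toL0 g.toL0 := rfl

theorem bochnerPairing_flip (φ : β →ₘ[ν] X) (g : β →ₘ[ν] Y) :
    bochnerPairing P.flip g φ = bochnerPairing P φ g := rfl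

/-- Reduces vector-valued pairings to scalar ones, where the adjoint relation between T and S is
available. -/
theorem bochnerPairing_tmul_left (f : F) (x : X) (g : G.Bochner Y) :
    bochnerPairing P (tmul f x).toL0 g.toL0 =
      scalarPairing f.toL0 (Bochner.dualComp (P x) g).toL0 := by
  refine integral_congr_ae ?_
  filter_upwards [coe_tmul f x, Bochner.coe_dualComp (P x) g] with b h1 h2
  rw [h1, h2, map_smul, smul_apply, smul_eq_mul]

/-- Dominated convergence for the pairing. -/
theorem IsBoundedPair.tendsto_bochnerPairing (h : IsBoundedPair F G C) (φ : F.Bochner X)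
    {t : ℕ → G.Bochner Y} {g : G.Bochner Y} (w : G)
    (hw : ∀ n, ∀ᵐ b ∂ν, ‖(t n).toL0 b‖ ≤ ‖w b‖)
    (hlim : ∀ᵐ b ∂ν, Tendsto (fun n => (t n).toL0 b) atTop (𝓝 (g.toL0 b))) :
    Tendsto (fun n => bochnerPairing P φ.toL0 (t n).toL0) atTop
      (𝓝 (bochnerPairing P φ.toL0 g.toL0)) := by
  refine tendsto_integral_of_dominated_convergence
    (fun b => ‖P‖ * (‖φ.absE b‖ * ‖w b‖)) (fun n => aestronglyMeasurable_pairing P _ _)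
    ((h.integrable_norm φ.absE w).const_mul ‖P‖) (fun n => ?_) ?_
  · filter_upwards [hw n, φ.norm_coe_absE] with b h1 h2
    rw [h2, ← mul_assoc]
    exact (P.le_opNorm₂ _ _).trans (by gcongr)
  · filter_upwards [hlim] with b hb
    exact ((P (φ.toL0 b)).continuous.tendsto _).comp hb

/-- Elements of `G(Y)` are separated by the elementary tensors in `F ⊗ X`. -/
theorem IsKotheDualPair.bochner_eq_zero (hFG : IsKotheDualPair F G)
    (hP : Function.Injective P.flip) {g : G.Bochner Y}
    (hg : ∀ (f : F) (x : X), bochnerPairing P (tmul f x).toL0 g.toL0 = 0) : g = 0 := by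
  have h1 (x : X) : ∀ᵐ b ∂ν, P x (g.toL0 b) = 0 := by
    have h2 : Bochner.dualComp (P x) g = 0 := hFG.separating_right _ fun f => by
      rw [← bochnerPairing_tmul_left]; exact hg f x
    filter_upwards [Bochner.coe_dualComp (P x) g, Elem.coe_zero (E := G)] with b h3 h4
    rw [← h3, h2, h4]
  set s : Set Y := Set.range g.toL0
  have hs : TopologicalSpace.IsSeparable s := g.stronglyMeasurable.isSeparable_range
  have : TopologicalSpace.SeparableSpace s := hs.separableSpace
  have : SecondCountableTopology s := UniformSpace.secondCountable_of_separable s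
  -- The null set depends on x. As the range of g is second countable, countably many of the open
  -- sets {P x ≠ 0} cover their whole union, so one null set serves every x.
  set U : X → Set s := fun x => {y | P x y ≠ 0} with hU
  have hUo (x : X) : IsOpen (U x) :=
    isOpen_ne_fun ((P x).continuous.comp continuous_subtype_val) continuous_const
  obtain ⟨c, hc, hcU⟩ := TopologicalSpace.isOpen_iUnion_countable U hUo
  have h2 : ∀ᵐ b ∂ν, ∀ x ∈ c, P x (g.toL0 b) = 0 := (ae_ball_iff hc).2 fun x _ => h1 x
  refine Bochner.ext_ae ?_
  filter_upwards [h2, Bochner.coe_zero (E := G) (X := Y)] with b h3 h4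
  rw [h4]
  have h5 : (⟨g.toL0 b, b, rfl⟩ : s) ∉ ⋃ x, U x := by
    rw [← hcU]
    simp only [Set.mem_iUnion, not_exists]
    exact fun x hx hm => hm (h3 x hx)
  have h6 (x : X) : P x (g.toL0 b) = 0 := by
    by_contra hne
    exact h5 (Set.mem_iUnion.2 ⟨x, hne⟩)
  refine hP ?_
  rw [map_zero]
  ext x
  exact h6 x

end BochnerPairing

/-! ### Density of the elementary tensors in the closed tensor product -/

section TensorExt

variable {𝕜 : Type*} [RCLike 𝕜] {α : Type*} [MeasurableSpace α] {μ : Measure α}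
  {E : BanachFunctionSpace 𝕜 μ} {X : Type*} [NormedAddCommGroup X] [NormedSpace 𝕜 X]
  {V : Type*} [NormedAddCommGroup V] [NormedSpace 𝕜 V]

/-- A closed subspace of `E ⊗̃ X` that contains the elementary tensors is everything. -/
theorem tensor_mem_of_isClosed {W : Submodule 𝕜 (E.tensor X)}
    (hW : IsClosed (W : Set (E.tensor X))) (h : ∀ (f : E) (x : X), tmul' f x ∈ W)
    (φ : E.tensor X) : φ ∈ W := by
  obtain ⟨φ, hφ⟩ := φ
  have hspan : Submodule.span 𝕜 {φ | ∃ (f : E) (x : X), φ = tmul f x} ≤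
      W.map (E.tensor X).subtype := by
    refine Submodule.span_le.2 ?_
    rintro _ ⟨f, x, rfl⟩
    exact ⟨tmul' f x, h f x, rfl⟩
  obtain ⟨u, hu, hlim⟩ := mem_closure_iff_seq_limit.1
    (show φ ∈ closure (Submodule.span 𝕜 {φ | ∃ (f : E) (x : X), φ = tmul f x} :
      Set (E.Bochner X)) from hφ)
  choose t ht1 ht2 using fun n => hspan (hu n)
  have hlim' : Tendsto t atTop (𝓝 ⟨φ, hφ⟩) :=
    tendsto_subtype_rng.2 (hlim.congr fun n => (ht2 n).symm)
  exact hW.mem_of_tendsto hlim' (Eventually.of_forall ht1)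

/-- A bounded operator on `E ⊗̃ X` is determined by its values on elementary tensors. -/
theorem tensor_ext {L L' : E.tensor X →L[𝕜] V}
    (h : ∀ (f : E) (x : X), L (tmul' f x) = L' (tmul' f x)) : L = L' := by
  ext φ
  have := tensor_mem_of_isClosed (W := (L - L').ker) (L - L').isClosed_ker
    (fun f x => by simp [h f x]) φ
  simpa [sub_eq_zero] using this

theorem norm_sum_tmul' {ι : Type*} (s : Finset ι) (f : ι → E) (x : ι → X) :
    ‖∑ i ∈ s, tmul' (f i) (x i)‖ = ‖∑ i ∈ s, tmul (f i) (x i)‖ := by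
  show ‖((∑ i ∈ s, tmul' (f i) (x i) : E.tensor X) : E.Bochner X)‖ = _
  rw [Submodule.coe_sum]; rfl

end TensorExt

/-! ### Countably-valued functions in L^∞(A; Y) -/

section CountablyValued

variable {𝕜 : Type*} [RCLike 𝕜] {α : Type*} [MeasurableSpace α] {μ : Measure α}
  {Y : Type*} [NormedAddCommGroup Y] [NormedSpace 𝕜 Y]

theorem ae_norm_le_bochner_top (h : (lebesgue 𝕜 μ ∞).Bochner Y) : ∀ᵐ a ∂μ, ‖h.toL0 a‖ ≤ ‖h‖ := by
  filter_upwards [ae_norm_le_lebesgue_top h.absE, h.norm_coe_absE] with a h1 h2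
  rwa [← h2]

theorem norm_bochner_top_le {h : (lebesgue 𝕜 μ ∞).Bochner Y} {c : ℝ} (hc : 0 ≤ c)
    (hb : ∀ᵐ a ∂μ, ‖h.toL0 a‖ ≤ c) : ‖h‖ ≤ c := by
  rw [← Bochner.norm_absE]
  refine norm_lebesgue_top_le hc ?_
  filter_upwards [hb, h.norm_coe_absE] with a h1 h2
  rwa [h2]

/-- The countably-valued functions are dense in `L^∞(A; Y)`. -/
theorem bochner_top_mem_of_countable {Q : Set ((lebesgue 𝕜 μ ∞).Bochner Y)} (hQ : IsClosed Q)
    (hcount : ∀ (N : α → ℕ) (d : ℕ → Y) (h : (lebesgue 𝕜 μ ∞).Bochner Y), Measurable N →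
      (∀ᵐ a ∂μ, h.toL0 a = d (N a)) → h ∈ Q) (h : (lebesgue 𝕜 μ ∞).Bochner Y) : h ∈ Q := by
  classical
  refine hQ.closure_subset (Metric.mem_closure_iff.2 fun ε hε => ?_)
  obtain ⟨c, hc, hcl⟩ := h.stronglyMeasurable.isSeparable_range
  -- Inserting 0 makes the countable set nonempty, so that a sequence enumerates it.
  obtain ⟨d, hd⟩ := (hc.insert 0).exists_eq_range (Set.insert_nonempty _ _)
  have hex (a : α) : ∃ n, ‖h.toL0 a - d n‖ < ε / 2 := by
    obtain ⟨x, hx, hdx⟩ := Metric.mem_closure_iff.1 (hcl ⟨a, rfl⟩) (ε / 2) (half_pos hε)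
    obtain ⟨n, rfl⟩ : x ∈ Set.range d := hd ▸ Set.mem_insert_of_mem 0 hx
    exact ⟨n, by rwa [← dist_eq_norm]⟩
  -- The first index within ε/2 of h(a) is a measurable choice.
  set N : α → ℕ := fun a => Nat.find (hex a) with hN
  have hNm : Measurable N := measurable_find hex fun k =>
    measurableSet_lt (h.stronglyMeasurable.sub stronglyMeasurable_const).norm.measurable
      measurable_const
  have hNs (a : α) : ‖h.toL0 a - d (N a)‖ < ε / 2 := Nat.find_spec (hex a)
  obtain ⟨e, -, he, -⟩ := exists_one_lebesgue_top 𝕜 μ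
  obtain ⟨k, hk⟩ := Bochner.exists_of_dominated (E := lebesgue 𝕜 μ ∞) (u := fun a => d (N a))
    ((StronglyMeasurable.of_discrete (f := d)).comp_measurable hNm).aestronglyMeasurable
    (((‖h‖ + ε / 2 : ℝ) : 𝕜) • e) (by
      filter_upwards [ae_norm_le_bochner_top h, he, Elem.coe_smul ((‖h‖ + ε / 2 : ℝ) : 𝕜) e]
        with a h1 h2 h3
      rw [h3, h2, mul_one, RCLike.norm_ofReal, abs_of_nonneg (by positivity)]
      have := norm_sub_norm_le (d (N a)) (h.toL0 a)
      rw [norm_sub_rev] at this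
      linarith [hNs a])
  refine ⟨k, hcount N d k hNm hk, ?_⟩
  rw [dist_eq_norm]
  refine lt_of_le_of_lt (norm_bochner_top_le (half_pos hε).le ?_) (half_lt_self hε)
  filter_upwards [hk, Bochner.coe_sub h k] with a h1 h2
  rw [h2, h1]
  exact (hNs a).le

/-- A countably-valued function is the sum of a series of elementary tensors. -/
theorem exists_tensor_series {N : α → ℕ} {d : ℕ → Y} {h : (lebesgue 𝕜 μ ∞).Bochner Y}
    (hN : Measurable N) (hh : ∀ᵐ a ∂μ, h.toL0 a = d (N a)) :
    ∃ u : ℕ → lebesgue 𝕜 μ ∞, (∀ n, 0 ≤ u n) ∧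
      (∀ M, ∀ᵐ a ∂μ, ∑ n ∈ Finset.range M, ‖u n a‖ * ‖d n‖ ≤ ‖h‖) ∧
      ∀ᵐ a ∂μ, Tendsto (fun M => (∑ n ∈ Finset.range M, tmul (u n) (d n)).toL0 a) atTop
        (𝓝 (h.toL0 a)) := by
  classical
  -- Indicators of the level sets of N: at almost every point at most one term of the series is
  -- nonzero. The convergence is pointwise and bounded, not in the norm of L^∞.
  have hex (n : ℕ) : ∃ u : lebesgue 𝕜 μ ∞, ∀ᵐ a ∂μ, u a = if N a = n then 1 else 0 :=
    exists_lebesgue_top (c := 1) (Measurable.ite (hN (measurableSet_singleton n))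
      measurable_const measurable_const).aestronglyMeasurable
      (ae_of_all _ fun a => by split_ifs <;> simp)
  choose u hu using hex
  have hu' : ∀ᵐ a ∂μ, ∀ n, u n a = if N a = n then 1 else 0 := ae_all_iff.2 hu
  refine ⟨u, fun n => ?_, fun M => ?_, ?_⟩
  · rw [Elem.nonneg_iff_ae]
    filter_upwards [hu n] with a ha
    rw [ha]; split_ifs
    · exact zero_le_one
    · exact le_rfl
  · filter_upwards [hu', hh, ae_norm_le_bochner_top h] with a h1 h2 h3
    have : ∀ n, ‖u n a‖ * ‖d n‖ = if N a = n then ‖d n‖ else 0 := fun n => by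
      rw [h1]; split_ifs <;> simp
    simp only [this, Finset.sum_ite_eq]
    split_ifs
    · rwa [← h2]
    · exact norm_nonneg _
  · have hs : ∀ᵐ a ∂μ, ∀ M, (∑ n ∈ Finset.range M, tmul (u n) (d n)).toL0 a =
        ∑ n ∈ Finset.range M, u n a • d n := ae_all_iff.2 fun M => coe_sum_tmul _ u d
    filter_upwards [hu', hh, hs] with a h1 h2 h3
    refine tendsto_const_nhds.congr' ?_
    filter_upwards [eventually_gt_atTop (N a)] with M hM
    rw [h3, h2]
    simp [h1, hM]

theorem ae_norm_sum_tmul_le {u : ℕ → lebesgue 𝕜 μ ∞} {d : ℕ → Y} {c : ℝ} {M : ℕ}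
    (h : ∀ᵐ a ∂μ, ∑ n ∈ Finset.range M, ‖u n a‖ * ‖d n‖ ≤ c) :
    ∀ᵐ a ∂μ, ‖(∑ n ∈ Finset.range M, tmul (u n) (d n)).toL0 a‖ ≤ c := by
  filter_upwards [h, coe_sum_tmul (Finset.range M) u d] with a h1 h2
  rw [h2]
  exact (norm_sum_le _ _).trans (by simpa only [norm_smul] using h1)

end CountablyValued

/-! ### Weakly continuous extensions and adjointness -/

section Extension

variable {𝕜 : Type*} [RCLike 𝕜] {α β : Type*} [MeasurableSpace α] [MeasurableSpace β]
  {μ : Measure α} {ν : Measure β} {F G : BanachFunctionSpace 𝕜 ν}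
  {T : lebesgue 𝕜 μ ∞ →L[𝕜] G} {S : F →L[𝕜] lebesgue 𝕜 μ 1}
  {X Y : Type*} [NormedAddCommGroup X] [NormedSpace 𝕜 X] [NormedAddCommGroup Y] [NormedSpace 𝕜 Y]

/-- Weak continuity needs only that each test element pull back to a test element; for the
extensions this is the adjoint identity. -/
theorem continuous_weakTop {V W V' W' : Type*} {p : V → W → 𝕜} {q : V' → W' → 𝕜} {L : V → V'}
    (h : ∀ w', ∃ w, ∀ v, q (L v) w' = p v w) : @Continuous _ _ (weakTop p) (weakTop q) L := by
  let _ : TopologicalSpace V := weakTop p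
  refine continuous_induced_rng.2 (continuous_pi fun w' => ?_)
  obtain ⟨w, hw⟩ := h w'
  have e : (fun v => (fun v w => q v w) (L v) w') = fun v => p v w := funext hw
  show Continuous fun v => (fun v w => q v w) (L v) w'
  rw [e]
  exact (continuous_apply w).comp (continuous_induced_dom (f := fun v w => p v w))

theorem tendsto_of_continuous_weakTop {V W V' W' : Type*} {p : V → W → 𝕜} {q : V' → W' → 𝕜}
    {L : V → V'} (hL : @Continuous _ _ (weakTop p) (weakTop q) L) {u : ℕ → V} {v : V}
    (hu : ∀ w, Tendsto (fun n => p (u n) w) atTop (𝓝 (p v w))) (w' : W') :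
    Tendsto (fun n => q (L (u n)) w') atTop (𝓝 (q (L v) w')) := by
  let _ : TopologicalSpace V := weakTop p
  let _ : TopologicalSpace V' := weakTop q
  have h1 : Tendsto u atTop (𝓝 v) := by
    rw [nhds_induced, tendsto_comap_iff]
    exact tendsto_pi_nhds.2 hu
  have h2 : Continuous fun v => q v w' :=
    (continuous_apply w').comp (continuous_induced_dom (f := fun v w => q v w))
  exact ((h2.comp hL).tendsto v).comp h1

/-- A dominated weakly continuous operator on `L^∞` has an ampliation to all of `L^∞(A; Y)`. -/
theorem mem_ampliationDomain_top [CompleteSpace Y] (hFG : IsKotheDualPair F G)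
    (hS : ∀ (f : F) (h : lebesgue 𝕜 μ ∞),
      scalarPairing f.toL0 (T h).toL0 = scalarPairing (S f).toL0 h.toL0)
    {R : lebesgue 𝕜 μ ∞ →L[𝕜] G} (hR : IsDominant R T) (h : (lebesgue 𝕜 μ ∞).Bochner Y) :
    h ∈ ampliationDomain T Y := by
  obtain ⟨C, hC⟩ := hFG.exists_isBoundedPair
  have hL := isBoundedPair_lebesgue (𝕜 := 𝕜) (μ := μ)
  refine bochner_top_mem_of_countable (isClosed_ampliationDomain hR) (fun N d h hN hh => ?_) h
  obtain ⟨u, hu0, hub, hulim⟩ := exists_tensor_series hN hh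
  obtain ⟨e, he0, he, -⟩ := exists_one_lebesgue_top 𝕜 μ
  -- The values of the u_n add up to one disjointly, so ∑ ‖d_n‖ u_n ≤ ‖h‖ e; applying R bounds all
  -- partial sums of ∑ |T u_n| ‖d_n‖ by w, and the image series converges a.e.
  set w : G := R (((‖h‖ : ℝ) : 𝕜) • e) with hw
  have hbound (M : ℕ) :
      ∀ᵐ b ∂ν, ∑ n ∈ Finset.range M, ‖T (u n) b • d n‖ ≤ RCLike.re (w b) := by
    have h1 : ∑ n ∈ Finset.range M, ((‖d n‖ : ℝ) : 𝕜) • u n ≤ ((‖h‖ : ℝ) : 𝕜) • e := by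
      rw [Elem.le_iff_ae]
      filter_upwards [hub M, Elem.coe_sum (Finset.range M) fun n => ((‖d n‖ : ℝ) : 𝕜) • u n,
        Elem.coe_smul ((‖h‖ : ℝ) : 𝕜) e, he,
        ae_all_iff.2 fun n => Elem.coe_smul ((‖d n‖ : ℝ) : 𝕜) (u n),
        ae_all_iff.2 fun n => Elem.coe_eq_norm (hu0 n)] with a h1 h2 h3 h4 h5 h6
      rw [h2, h3, h4, mul_one]
      have : ∀ n, (((‖d n‖ : ℝ) : 𝕜) • u n) a = ((‖u n a‖ * ‖d n‖ : ℝ) : 𝕜) := fun n => by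
        rw [h5, RCLike.ofReal_mul, ← h6, mul_comm]
      simp only [this, ← RCLike.ofReal_sum]
      exact RCLike.ofReal_le_ofReal.2 h1
    have h2 := hR.1.mono h1
    simp only [map_sum, map_smul R ((‖d _‖ : ℝ) : 𝕜)] at h2
    filter_upwards [Elem.le_iff_ae.1 h2, ae_all_iff.2 fun n => hR.2 (u n),
      Elem.coe_sum (Finset.range M) fun n => ((‖d n‖ : ℝ) : 𝕜) • R (u n),
      ae_all_iff.2 fun n => Elem.coe_smul ((‖d n‖ : ℝ) : 𝕜) (R (u n))] with b h1 h2 h3 h4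
    refine le_trans ?_ (RCLike.le_iff_re_im.1 h1).1
    rw [h3, map_sum]
    refine Finset.sum_le_sum fun n _ => ?_
    rw [h4, RCLike.re_ofReal_mul, norm_smul, mul_comm]
    have := h2 n
    rw [Elem.abs_of_nonneg (hu0 n)] at this
    exact mul_le_mul_of_nonneg_left this (norm_nonneg _)
  obtain ⟨hsum, hmeas⟩ := ae_summable_of_bounded (fun n =>
    ((T (u n)).stronglyMeasurable.smul_const (d n)).aestronglyMeasurable) hbound
  obtain ⟨g, hg⟩ := Bochner.exists_of_dominated (E := G) hmeas w (by
    filter_upwards [hsum] with b hb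
    exact (norm_tsum_le_tsum_norm hb.1).trans (hb.2.trans (RCLike.re_le_norm _)))
  set s : ℕ → (lebesgue 𝕜 μ ∞).Bochner Y := fun M => ∑ n ∈ Finset.range M, tmul (u n) (d n)
  set t : ℕ → G.Bochner Y := fun M => ∑ n ∈ Finset.range M, tmul (T (u n)) (d n)
  have htcoe : ∀ᵐ b ∂ν, ∀ M, (t M).toL0 b = ∑ n ∈ Finset.range M, T (u n) b • d n :=
    ae_all_iff.2 fun M => coe_sum_tmul _ _ d
  have hst (M : ℕ) : IsAmpliation T (s M) (t M) := fun l => by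
    simp only [s, t, map_sum]
    exact Finset.sum_congr rfl fun n _ => isAmpliation_tmul T (u n) (d n) l
  -- The relation l ∘ g = T(l ∘ h) is tested against f in F. Adjointness moves T to S, after which
  -- both sides are limits of the same partial sums by dominated convergence.
  refine ⟨g, fun l => ?_⟩
  rw [← sub_eq_zero]
  refine hFG.separating_right _ fun f => ?_
  rw [hC.scalarPairing_sub_right, sub_eq_zero, hS]
  -- With ⟨c, y⟩ = c l(y), the scalar pairing of f with l ∘ g is a vector-valued pairing with f ⊗ 1.
  set P : 𝕜 →L[𝕜] Y →L[𝕜] 𝕜 := ContinuousLinearMap.toSpanSingleton 𝕜 l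
  have hP : P 1 = l := by simp [P]
  have e1 : Tendsto (fun M => bochnerPairing P (tmul f 1).toL0 (t M).toL0) atTop
      (𝓝 (bochnerPairing P (tmul f 1).toL0 g.toL0)) := by
    refine hC.tendsto_bochnerPairing P _ w (fun M => ?_) ?_
    · filter_upwards [hbound M, htcoe] with b h1 h2
      rw [h2]
      exact (norm_sum_le _ _).trans (h1.trans (RCLike.re_le_norm _))
    · filter_upwards [hsum, hg, htcoe] with b h1 h2 h3
      simp only [h2, h3]
      exact h1.1.of_norm.hasSum.tendsto_sum_nat
  have e2 : Tendsto (fun M => bochnerPairing P (tmul (S f) 1).toL0 (s M).toL0) atTop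
      (𝓝 (bochnerPairing P (tmul (S f) 1).toL0 h.toL0)) := by
    refine hL.tendsto_bochnerPairing P _ (((‖h‖ : ℝ) : 𝕜) • e) (fun M => ?_) hulim
    filter_upwards [ae_norm_sum_tmul_le (hub M), Elem.coe_smul ((‖h‖ : ℝ) : 𝕜) e, he]
      with a h1 h2 h3
    rwa [h2, h3, mul_one, RCLike.norm_ofReal, abs_norm]
  simp only [bochnerPairing_tmul_left, hP] at e1 e2
  refine tendsto_nhds_unique e1 (e2.congr fun M => ?_)
  rw [hst M l, hS]

/-- The adjoint identity for ampliations. -/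
theorem bochnerPairing_ampliation {C : ℝ} (hC : IsBoundedPair F G C)
    (hS : ∀ (f : F) (h : lebesgue 𝕜 μ ∞),
      scalarPairing f.toL0 (T h).toL0 = scalarPairing (S f).toL0 h.toL0)
    (P : X →L[𝕜] Y →L[𝕜] 𝕜) {SX : F.tensor X →L[𝕜] (lebesgue 𝕜 μ 1).Bochner X}
    (hSX : ∀ (f : F) (x : X), SX (tmul' f x) = tmul (S f) x)
    {h : (lebesgue 𝕜 μ ∞).Bochner Y} {g : G.Bochner Y} (hg : IsAmpliation T h g)
    (φ : F.tensor X) :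
    bochnerPairing P φ.1.toL0 g.toL0 = bochnerPairing P (SX φ).toL0 h.toL0 := by
  have hL := isBoundedPair_lebesgue (𝕜 := 𝕜) (μ := μ)
  -- Both sides are bounded functionals of φ, so elementary tensors decide.
  have key : (hC.pairingLeft P g).comp (F.tensor X).subtypeL = (hL.pairingLeft P h).comp SX := by
    refine tensor_ext fun f x => ?_
    show bochnerPairing P (tmul f x).toL0 g.toL0 = bochnerPairing P (SX (tmul' f x)).toL0 h.toL0
    rw [hSX, bochnerPairing_tmul_left, bochnerPairing_tmul_left, hg, hS]
  exact congrArg (fun L : F.tensor X →L[𝕜] 𝕜 => L φ) key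

/-- Weak extensions are adjoint to bounded extensions. -/
theorem bochnerPairing_weakExtension (hFG : IsKotheDualPair F G)
    (hS : ∀ (f : F) (h : lebesgue 𝕜 μ ∞),
      scalarPairing f.toL0 (T h).toL0 = scalarPairing (S f).toL0 h.toL0)
    (P : X →L[𝕜] Y →L[𝕜] 𝕜) {SX : F.tensor X →L[𝕜] (lebesgue 𝕜 μ 1).Bochner X}
    (hSX : ∀ (f : F) (x : X), SX (tmul' f x) = tmul (S f) x)
    {TY : (lebesgue 𝕜 μ ∞).Bochner Y →L[𝕜] G.Bochner Y} (hTY : IsWeakExtensionT F T P TY)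
    (φ : F.tensor X) (h : (lebesgue 𝕜 μ ∞).Bochner Y) :
    bochnerPairing P φ.1.toL0 (TY h).toL0 = bochnerPairing P (SX φ).toL0 h.toL0 := by
  obtain ⟨C, hC⟩ := hFG.exists_isBoundedPair
  have hL := isBoundedPair_lebesgue (𝕜 := 𝕜) (μ := μ)
  have hcl : IsClosed {h : (lebesgue 𝕜 μ ∞).Bochner Y |
      bochnerPairing P φ.1.toL0 (TY h).toL0 = bochnerPairing P (SX φ).toL0 h.toL0} :=
    isClosed_eq ((hC.symm.pairingLeft P.flip φ.1).continuous.comp TY.continuous)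
      (hL.symm.pairingLeft P.flip (SX φ)).continuous
  refine bochner_top_mem_of_countable hcl (fun N d h hN hh => ?_) h
  obtain ⟨u, hu0, hub, hulim⟩ := exists_tensor_series hN hh
  obtain ⟨e, he0, he, -⟩ := exists_one_lebesgue_top 𝕜 μ
  set s : ℕ → (lebesgue 𝕜 μ ∞).Bochner Y := fun M => ∑ n ∈ Finset.range M, tmul (u n) (d n)
  have hs (k : (lebesgue 𝕜 μ 1).Bochner X) :
      Tendsto (fun M => bochnerPairing P k.toL0 (s M).toL0) atTop
        (𝓝 (bochnerPairing P k.toL0 h.toL0)) := by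
    refine hL.tendsto_bochnerPairing P _ (((‖h‖ : ℝ) : 𝕜) • e) (fun M => ?_) hulim
    filter_upwards [ae_norm_sum_tmul_le (hub M), Elem.coe_smul ((‖h‖ : ℝ) : 𝕜) e, he]
      with a h1 h2 h3
    rwa [h2, h3, mul_one, RCLike.norm_ofReal, abs_norm]
  -- The partial sums converge to h only in the weak topology; here the weak continuity of T_Y is
  -- indispensable, since boundedness and the values on tensors do not reach h.
  have e1 := tendsto_of_continuous_weakTop hTY.2 hs φ
  refine tendsto_nhds_unique e1 ((hs (SX φ)).congr fun M => ?_)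
  have hst : IsAmpliation T (s M) (TY (s M)) := fun l => by
    simp only [s, map_sum, hTY.1]
    exact Finset.sum_congr rfl fun n _ => isAmpliation_tmul T (u n) (d n) l
  exact (bochnerPairing_ampliation hC hS P hSX hst φ).symm

/-- Regularity of `T` and `S` gives the weakly continuous extensions. -/
theorem exists_weakExtensions [CompleteSpace X] [CompleteSpace Y] (hFG : IsKotheDualPair F G)
    (hS : ∀ (f : F) (h : lebesgue 𝕜 μ ∞),
      scalarPairing f.toL0 (T h).toL0 = scalarPairing (S f).toL0 h.toL0)
    (hTr : IsRegularOp T) (hSr : IsRegularOp S) (P : X →L[𝕜] Y →L[𝕜] 𝕜) :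
    (∃ TY, IsWeakExtensionT F T P TY) ∧ ∃ SX, IsWeakExtensionS S P SX := by
  obtain ⟨C, hC⟩ := hFG.exists_isBoundedPair
  obtain ⟨R, hR⟩ := hTr.exists_isDominant
  obtain ⟨Q, hQ⟩ := hSr.exists_isDominant
  obtain ⟨SX, hSX⟩ := exists_ampliation hQ (tensor_le_ampliationDomain (X := X) hQ)
  obtain ⟨U, hU⟩ := exists_ampliation hR (V := (⊤ : Submodule 𝕜 ((lebesgue 𝕜 μ ∞).Bochner Y)))
    fun h _ => mem_ampliationDomain_top hFG hS hR h
  set TY : (lebesgue 𝕜 μ ∞).Bochner Y →L[𝕜] G.Bochner Y :=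
    U.comp ((ContinuousLinearMap.id 𝕜 _).codRestrict ⊤ fun _ => trivial)
  have hTY (h : (lebesgue 𝕜 μ ∞).Bochner Y) : IsAmpliation T h (TY h) := hU ⟨h, trivial⟩
  have hSX' (f : F) (x : X) : SX (tmul' f x) = tmul (S f) x :=
    (hSX (tmul' f x)).unique (isAmpliation_tmul S f x)
  have hadj := fun h => bochnerPairing_ampliation hC hS P hSX' (hTY h)
  refine ⟨⟨TY, fun h y => (hTY _).unique (isAmpliation_tmul T h y),
    continuous_weakTop fun φ => ⟨SX φ, fun h => hadj h φ⟩⟩, SX, hSX',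
    continuous_weakTop fun h => ⟨⟨(TY h).toL0, fun f => ?_⟩, fun φ => (hadj h φ).symm⟩⟩
  -- The adjoint identity represents ⟨S_X ·, h⟩ by T_Y h, which lies in F^×(Y) because G multiplies
  -- F into L¹.
  exact hC.symm.integrable (TY h).absE f

/-- Regularity guarantees that the infimum is over a nonempty set; the infimum of the empty set
would be 0. -/
theorem le_regularNorm {E : BanachFunctionSpace 𝕜 μ} {T : E →L[𝕜] G} (hT : IsRegularOp T)
    {c : ℝ} (h : ∀ R : E →L[𝕜] G, IsDominant R T → c ≤ ‖R‖) : c ≤ regularNorm T := by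
  obtain ⟨R, hR⟩ := hT.exists_isDominant
  refine le_csInf ⟨_, R, hR, rfl⟩ ?_
  rintro _ ⟨R, hR, rfl⟩
  exact h R hR

end Extension

/-! ### Test dualities for the sequence spaces, and the theorem -/

section Main

variable {𝕜 : Type} [RCLike 𝕜]

/-- The weak extension conditions range over Banach spaces in arbitrary fixed universes, so the
sequence spaces enter through `ULift`, with unchanged norm. -/
theorem exists_ulift_family {Z : Type} [NormedAddCommGroup Z] [NormedSpace 𝕜 Z]
    {ι : Type} [Fintype ι] {r : (ι → 𝕜) → ℝ}
    (h : ∃ e : ι → Z, ∀ c : ι → 𝕜, ‖∑ i, c i • e i‖ = r c) :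
    ∃ e : ι → ULift.{w} Z, ∀ c : ι → 𝕜, ‖∑ i, c i • e i‖ = r c := by
  obtain ⟨e, he⟩ := h
  refine ⟨fun i => ULift.up (e i), fun c => ?_⟩
  rw [← he, ULift.norm_def]
  congr 1
  exact map_sum (ULift.moduleEquiv : ULift.{w} Z ≃ₗ[𝕜] Z) _ _

variable (𝕜) in
/-- The evaluation pairing of a dual space with the space, lifted to given universes. -/
def evalPairing (Z : Type) [NormedAddCommGroup Z] [NormedSpace 𝕜 Z] :
    ULift.{v} (Z →L[𝕜] 𝕜) →L[𝕜] ULift.{w} Z →L[𝕜] 𝕜 :=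
  (ContinuousLinearMap.id 𝕜 (Z →L[𝕜] 𝕜)).bilinearComp
    (ContinuousLinearEquiv.ulift : ULift.{v} (Z →L[𝕜] 𝕜) ≃L[𝕜] (Z →L[𝕜] 𝕜)).toContinuousLinearMap
    (ContinuousLinearEquiv.ulift : ULift.{w} Z ≃L[𝕜] Z).toContinuousLinearMap

theorem isBanachDuality_evalPairing (Z : Type) [NormedAddCommGroup Z] [NormedSpace 𝕜 Z] :
    IsBanachDuality (evalPairing.{v, w} 𝕜 Z) := by
  refine ⟨fun l l' h => ?_, fun z z' h => ?_⟩
  · refine ULift.ext _ _ (ContinuousLinearMap.ext fun z => ?_)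
    exact congrArg (fun L : ULift.{w} Z →L[𝕜] 𝕜 => L (ULift.up z)) h
  · refine ULift.ext _ _ ?_
    refine (SeparatingDual.eq_iff_forall_dual_eq (R := 𝕜)).2 fun l => ?_
    exact congrArg (fun L : ULift.{v} (Z →L[𝕜] 𝕜) →L[𝕜] 𝕜 => L (ULift.up l)) h

theorem IsBanachDuality.flip {X Y : Type*} [NormedAddCommGroup X] [NormedSpace 𝕜 X]
    [NormedAddCommGroup Y] [NormedSpace 𝕜 Y] {P : X →L[𝕜] Y →L[𝕜] 𝕜} (h : IsBanachDuality P) :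
    IsBanachDuality P.flip := ⟨h.2, by rw [ContinuousLinearMap.flip_flip]; exact h.1⟩

end Main

end

theorem mainTheorem9 {𝕜 : Type} [RCLike 𝕜]
    {A : Type*} [MeasurableSpace A] (μ : Measure A) (hμ : IsSemifiniteMeasure μ)
    {B : Type*} [MeasurableSpace B] (ν : Measure B)
    (F G : BanachFunctionSpace 𝕜 ν) (hFG : IsKotheDualPair F G)
    (T : lebesgue 𝕜 μ ∞ →L[𝕜] G) (hT : IsWeakContinuous F T)
    (S : F →L[𝕜] lebesgue 𝕜 μ 1)
    (hS : ∀ (f : F) (h : lebesgue 𝕜 μ ∞),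
      scalarPairing f.toL0 (T h).toL0 = scalarPairing (S f).toL0 h.toL0)
    (hband : IsDualBand (kotheImage F G)) :
    List.TFAE [
      IsRegularOp T,
      IsRegularOp S,
      ∃ U : (lebesgue 𝕜 μ ∞).tensor (lp (fun _ : ℕ => 𝕜) ∞) →L[𝕜]
          G.tensor (lp (fun _ : ℕ => 𝕜) ∞),
        ∀ (h : lebesgue 𝕜 μ ∞) (y : lp (fun _ : ℕ => 𝕜) ∞), U (tmul' h y) = tmul' (T h) y,
      ∃ U : F.tensor (lp (fun _ : ℕ => 𝕜) 1) →L[𝕜]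
          (lebesgue 𝕜 μ 1).Bochner (lp (fun _ : ℕ => 𝕜) 1),
        ∀ (f : F) (x : lp (fun _ : ℕ => 𝕜) 1), U (tmul' f x) = tmul (S f) x,
      ∀ (X : Type v) (Y : Type w) [NormedAddCommGroup X] [NormedSpace 𝕜 X] [CompleteSpace X]
        [NormedAddCommGroup Y] [NormedSpace 𝕜 Y] [CompleteSpace Y]
        (P : X →L[𝕜] Y →L[𝕜] 𝕜), IsBanachDuality P →
        ∃ TY : (lebesgue 𝕜 μ ∞).Bochner Y →L[𝕜] G.Bochner Y, IsWeakExtensionT F T P TY,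
      ∀ (X : Type v) (Y : Type w) [NormedAddCommGroup X] [NormedSpace 𝕜 X] [CompleteSpace X]
        [NormedAddCommGroup Y] [NormedSpace 𝕜 Y] [CompleteSpace Y]
        (P : X →L[𝕜] Y →L[𝕜] 𝕜), IsBanachDuality P →
        ∃ SX : F.tensor X →L[𝕜] (lebesgue 𝕜 μ 1).Bochner X, IsWeakExtensionS S P SX] ∧
    (G.HasStrongOrderUnit → IsRegularOp T) ∧
    (IsRegularOp T →
      ∀ (X : Type v) (Y : Type w) [NormedAddCommGroup X] [NormedSpace 𝕜 X] [CompleteSpace X]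
        [NormedAddCommGroup Y] [NormedSpace 𝕜 Y] [CompleteSpace Y]
        (P : X →L[𝕜] Y →L[𝕜] 𝕜), IsBanachDuality P →
        ∀ (TY : (lebesgue 𝕜 μ ∞).Bochner Y →L[𝕜] G.Bochner Y)
          (SX : F.tensor X →L[𝕜] (lebesgue 𝕜 μ 1).Bochner X),
          IsWeakExtensionT F T P TY → IsWeakExtensionS S P SX →
          (∀ (φ : F.tensor X) (h : (lebesgue 𝕜 μ ∞).Bochner Y),
            bochnerPairing P φ.1.toL0 (TY h).toL0 = bochnerPairing P (SX φ).toL0 h.toL0) ∧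
          ‖SX‖ ≤ regularNorm S ∧ ‖TY‖ ≤ regularNorm T) := by

  obtain ⟨C, hC⟩ := hFG.exists_isBoundedPair
  have h12 : IsRegularOp T → IsRegularOp S := fun h => by
    obtain ⟨K, hK⟩ := h.bound
    exact isRegularOp_adjoint_of_bound hC hS hK
  have h21 : IsRegularOp S → IsRegularOp T := isRegularOp_of_adjoint hFG hS hband
  refine ⟨?_, fun hu => ?_, fun hT => ?_⟩
  · tfae_have 1 → 2 := h12
    tfae_have 2 → 1 := h21
    tfae_have 1 → 3 := by
      intro hT
      obtain ⟨R, hR⟩ := hT.exists_isDominant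
      obtain ⟨U, hU⟩ := exists_ampliation hR
        (tensor_le_ampliationDomain (X := lp (fun _ : ℕ => 𝕜) ∞) hR)
      have hU' (h : lebesgue 𝕜 μ ∞) (y : lp (fun _ : ℕ => 𝕜) ∞) :
          U (tmul' h y) = tmul (T h) y :=
        (hU (tmul' h y)).unique (isAmpliation_tmul T h y)
      -- The ampliation has values in G(ℓ^∞); the preimage of the closed subspace G ⊗̃ ℓ^∞ contains
      -- the elementary tensors, hence everything.
      have hmem := tensor_mem_of_isClosed
        (W := (G.tensor (lp (fun _ : ℕ => 𝕜) ∞)).comap U.toLinearMap)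
        ((Submodule.isClosed_topologicalClosure _).preimage U.continuous)
        fun h y => by
          show U (tmul' h y) ∈ G.tensor (lp (fun _ : ℕ => 𝕜) ∞)
          rw [hU']
          exact (tmul' (T h) y).2
      exact ⟨U.codRestrict _ hmem, fun h y => Subtype.ext (hU' h y)⟩
    tfae_have 2 → 4 := by
      intro hS'
      obtain ⟨R, hR⟩ := hS'.exists_isDominant
      obtain ⟨U, hU⟩ := exists_ampliation hR
        (tensor_le_ampliationDomain (X := lp (fun _ : ℕ => 𝕜) 1) hR)
      exact ⟨U, fun f x => (hU (tmul' f x)).unique (isAmpliation_tmul S f x)⟩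
    tfae_have 1 → 5 := by
      intro hT X Y _ _ _ _ _ _ P hP
      exact (exists_weakExtensions hFG hS hT (h12 hT) P).1
    tfae_have 1 → 6 := by
      intro hT X Y _ _ _ _ _ _ P hP
      exact (exists_weakExtensions hFG hS hT (h12 hT) P).2
    tfae_have 3 → 2 := by
      rintro ⟨U, hU⟩
      obtain ⟨K, hK⟩ := bound_of_sup_norm (T := T) (K := ‖U‖) (fun ι _ => exists_sup_norm_lp 𝕜 ι)
        fun ι _ h y => by
          have := U.le_opNorm (∑ i, tmul' (h i) (y i))
          simp only [map_sum, hU] at this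
          simpa only [norm_sum_tmul'] using this
      exact isRegularOp_adjoint_of_bound hC hS hK
    tfae_have 4 → 2 := by
      rintro ⟨U, hU⟩
      refine isRegularOp_of_sum_norm (K := ‖U‖) (fun ι _ => exists_sum_norm_lp 𝕜 ι)
        fun ι _ f x => ?_
      have := U.le_opNorm (∑ i, tmul' (f i) (x i))
      simp only [map_sum, hU] at this
      simpa only [norm_sum_tmul'] using this
    tfae_have 5 → 2 := by
      intro h
      -- The duality between (ℓ^∞)* and ℓ^∞ suffices; only boundedness and the values on tensors are
      -- needed.
      obtain ⟨TY, hTY, -⟩ := h _ _ _ (isBanachDuality_evalPairing (lp (fun _ : ℕ => 𝕜) ∞))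
      obtain ⟨K, hK⟩ := bound_of_sup_norm (T := T) (K := ‖TY‖)
        (fun ι _ => exists_ulift_family (exists_sup_norm_lp 𝕜 ι))
        fun ι _ h y => by
          have := TY.le_opNorm (∑ i, tmul (h i) (y i))
          simpa only [map_sum, hTY] using this
      exact isRegularOp_adjoint_of_bound hC hS hK
    tfae_have 6 → 2 := by
      intro h
      -- Here ℓ¹ must be the first space of the pair, so the evaluation pairing is flipped.
      obtain ⟨U, hU, -⟩ := h _ _ _ (isBanachDuality_evalPairing (lp (fun _ : ℕ => 𝕜) 1)).flip
      refine isRegularOp_of_sum_norm (K := ‖U‖)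
        (fun ι _ => exists_ulift_family (exists_sum_norm_lp 𝕜 ι)) fun ι _ f x => ?_
      have := U.le_opNorm (∑ i, tmul' (f i) (x i))
      simp only [map_sum, hU] at this
      simpa only [norm_sum_tmul'] using this
    tfae_finish
  · obtain ⟨K, hK⟩ := HasStrongOrderUnit.bound hu T
    -- The order unit yields regularity of S; the band property transfers it back to T.
    exact h21 (isRegularOp_adjoint_of_bound hC hS hK)
  · intro X Y _ _ _ _ _ _ P hP TY SX hTY hSX
    have hadj := bochnerPairing_weakExtension hFG hS P hSX.1 hTY
    refine ⟨hadj, le_regularNorm (h12 hT) fun R hR => ?_, le_regularNorm hT fun R hR => ?_⟩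
    · obtain ⟨U, hU⟩ := exists_ampliation hR (tensor_le_ampliationDomain (X := X) hR)
      have hSU : SX = U := tensor_ext fun f x => by
        rw [hSX.1]
        exact (isAmpliation_tmul S f x).unique (hU (tmul' f x))
      refine SX.opNorm_le_bound (norm_nonneg _) fun φ => ?_
      rw [hSU]
      exact (hU φ).norm_le hR
    · refine TY.opNorm_le_bound (norm_nonneg _) fun h => ?_
      obtain ⟨g, hg⟩ := mem_ampliationDomain_top hFG hS hR h
      -- T_Y h and the ampliation g of h pair identically with F ⊗ X, both being adjoint to S_X, and
      -- F ⊗ X separates G(Y). So T_Y inherits the bound ‖R‖ for every dominant R.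
      have e : TY h - g = 0 := hFG.bochner_eq_zero P hP.2 fun f x => by
        have h1 := hadj (tmul' f x) h
        rw [← bochnerPairing_ampliation hC hS P hSX.1 hg] at h1
        have h2 := map_sub (hC.symm.pairingLeft P.flip (tmul f x)) (TY h) g
        simp only [IsBoundedPair.pairingLeft_apply, bochnerPairing_flip] at h2
        rw [h2, sub_eq_zero]
        exact h1
      rw [sub_eq_zero.1 e]
      exact hg.norm_le hR
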